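/- **Conventions.** Let $M$ be a finite monoid. For an idempotent $e\in M$ let $G_e$ be the group of units of $eMe$, let $L_e=\{m\in M: Mm=Me\}$ and $R_e=\{m\in M: mM=eM\}$. The group $G_e$ acts on $R_e$ by left multiplication; put $\mathbb ZR_e^\vee=\operatorname{Hom}_{\mathbb ZG_e}(\mathbb ZR_e,\mathbb ZG_e)$ and let $\varphi_e\colon\mathbb ZL_e\to\mathbb ZR_e^\vee$ be the homomorphism with $\varphi_e(\ell)(r)=r\ell$ if $r\ell\in G_e$ and $\varphi_e(\ell)(r)=0$ otherwise ($\ell\in L_e$, $r\in R_e$). A prime $p$ is *strongly modular* for $M$ if, for some idempotent $e\in M$, it divides $|G_e|$ or the order of the torsion subgroup of $\operatorname{coker}\varphi_e$. Put $J=\operatorname{rad}(\mathbb QM)\cap\mathbb ZM$ and let $n$ be the Loewy length of $\mathbb QM$, i.e. the least $n$ with $\operatorname{rad}(\mathbb QM)^n=0$. The prime $p$ is *modular* for $M$ if it is strongly modular or divides the order of the torsion subgroup of $J^i/J^{i+1}$ for some $1\le i<n$; otherwise it is *nonmodular*. A finite dimensional algebra $A$ over a field $K$ is *split* if $A/\operatorname{rad}(A)$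 is isomorphic, as a $K$-algebra, to a finite direct product of matrix algebras over $K$. An element $e\in A$ is a *basic idempotent* of $A$ if there is a decomposition $1=\varepsilon_1+\cdots+\varepsilon_s$ into orthogonal primitive idempotents such that $e$ is the sum of a subfamily of the $\varepsilon_i$ whose members are pairwise nonconjugate and represent all conjugacy classes of primitive idempotents of $A$; then $eAe$ is called the basic algebra of $A$. For a finite quiver $Q$ and a commutative ring $R$, let $RQ$ be the path algebra, with basis all paths of $Q$ (including an empty path at each vertex) and product induced by concatenation. If $K$ is a field, an ideal $I'$ of $KQ$ is *admissible* if $J_Q^m\subseteq I'\subseteq J_Q^2$ for some $m\ge2$, where $J_Q$ is the ideal of $KQ$ generated by all arrows. **Theorem.** Let $M$ be a finite monoid and $p>0$ a prime which is nonmodular for $M$. Let $\mathcal O$ be a complete discrete valuation ring of characteristic $0$ with field of fractions $F$ and residue field $k$ of characteristic $p$, such that the algebras $FM$ and $kM$ are split. Let $e$ be a basic idempotent of $kM$. Then there is an idempotent $\tilde e\in\mathcal OM$ whose image in $kM$ is $e$ and whose image in $FM$ is a basic idempotent of $FM$. Moreover, there are a finite quiver $Q$ and a two-sided ideal $I$ of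 $\mathcal OQ$ such that 1. the natural map $F\otimes_{\mathcal O}I\to FQ$ is injective, its image (again denoted $F\otimes_{\mathcal O}I$) is an admissible ideal of $FQ$, and $FQ/(F\otimes_{\mathcal O}I)\cong\tilde e\,FM\,\tilde e$ as $F$-algebras; 2. the natural map $k\otimes_{\mathcal O}I\to kQ$ is injective, its image (again denoted $k\otimes_{\mathcal O}I$) is an admissible ideal of $kQ$, and $kQ/(k\otimes_{\mathcal O}I)\cong e\,kM\,e$ as $k$-algebras. -/

import Mathlib

noncomputable section

open scoped TensorProduct

/-! ### Idempotents, basic algebras and split algebras -/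

/-- The corner `eAe` of an `R`-algebra `A` at an idempotent `e` is an `R`-algebra
(with identity `e`). -/
instance cornerModule {R A : Type*} [CommRing R] [Ring A] [Algebra R A] {e : A}
    (he : IsIdempotentElem e) : Module R he.Corner where
  smul r x := ⟨r • x.1, by
    obtain ⟨y, hy⟩ := x.2
    exact ⟨r • y, by simp only at hy ⊢; rw [← hy]; simp⟩⟩
  one_smul x := Subtype.ext (one_smul R x.1)
  mul_smul r s x := Subtype.ext (mul_smul r s x.1)
  smul_zero r := Subtype.ext (smul_zero (A := A) r)
  smul_add r x y := Subtype.ext (smul_add r x.1 y.1)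
  add_smul r s x := Subtype.ext (add_smul r s x.1)
  zero_smul x := Subtype.ext (zero_smul R x.1)

instance cornerAlgebra {R A : Type*} [CommRing R] [Ring A] [Algebra R A] {e : A}
    (he : IsIdempotentElem e) : Algebra R he.Corner :=
  Algebra.ofModule (fun r x y => Subtype.ext (smul_mul_assoc r x.1 y.1))
    (fun r x y => Subtype.ext (mul_smul_comm r x.1 y.1))

/-- A primitive idempotent: a nonzero idempotent that is not the sum of two nonzero orthogonal
idempotents. -/
def IsPrimitiveIdempotent {A : Type*} [Ring A] (f : A) : Prop :=
  IsIdempotentElem f ∧ f ≠ 0 ∧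
    ∀ a b : A, IsIdempotentElem a → IsIdempotentElem b → a * b = 0 → b * a = 0 → a + b = f →
      a = 0 ∨ b = 0

/-- `e` is a basic idempotent of `A`: there is a decomposition `1 = ε₁ + ⋯ + εₛ` into orthogonal
primitive idempotents such that `e` is the sum of a subfamily which is pairwise nonconjugate and
represents all the conjugacy classes of primitive idempotents of `A`. -/
def IsBasicIdempotent {A : Type*} [Ring A] (e : A) : Prop :=
  ∃ (s : ℕ) (ε : Fin s → A) (T : Finset (Fin s)),
    CompleteOrthogonalIdempotents ε ∧
    (∀ i, IsPrimitiveIdempotent (ε i)) ∧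
    (∀ i ∈ T, ∀ j ∈ T, IsConj (ε i) (ε j) → i = j) ∧
    (∀ f : A, IsPrimitiveIdempotent f → ∃ i ∈ T, IsConj (ε i) f) ∧
    e = ∑ i ∈ T, ε i

theorem IsBasicIdempotent.isIdempotentElem {A : Type*} [Ring A] {e : A}
    (he : IsBasicIdempotent e) : IsIdempotentElem e := by
  obtain ⟨s, ε, T, hε, -, -, -, rfl⟩ := he
  exact hε.toOrthogonalIdempotents.isIdempotentElem_sum

/-- The `K`-algebra `A` is split: `A / rad A` is isomorphic to a finite direct product of matrix
algebras over `K`. -/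
def IsSplitAlgebra (K A : Type*) [Field K] [Ring A] [Algebra K A] : Prop :=
  ∃ (n : ℕ) (d : Fin n → ℕ),
    Nonempty ((A ⧸ Ring.jacobson A) ≃ₐ[K] ((i : Fin n) → Matrix (Fin (d i)) (Fin (d i)) K))

/-! ### Maximal subgroups, Green's classes and the sandwich map -/

section Monoids

variable {M : Type*} [Monoid M]

/-- The monoid `eMe`, for an idempotent `e`. -/
@[ext]
structure LocalMonoid {e : M} (_he : IsIdempotentElem e) where
  val : M
  self_mul : e * val = val
  mul_self : val * e = val

instance {e : M} (he : IsIdempotentElem e) : Monoid (LocalMonoid he) where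
  mul x y := ⟨x.1 * y.1, by rw [← mul_assoc, x.self_mul], by rw [mul_assoc, y.mul_self]⟩
  one := ⟨e, he, he⟩
  mul_assoc x y z := LocalMonoid.ext (mul_assoc x.1 y.1 z.1)
  one_mul x := LocalMonoid.ext x.self_mul
  mul_one x := LocalMonoid.ext x.mul_self

/-- The maximal subgroup `G_e`: the group of units of `eMe`. -/
abbrev MaximalSubgroup {e : M} (he : IsIdempotentElem e) : Type _ := (LocalMonoid he)ˣ

/-- The `𝓛`-class `L_e`: the elements generating the same principal left ideal as `e`. -/
@[ext]
structure LClass (e : M) where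
  val : M
  range_eq : Set.range (fun x : M => x * val) = Set.range (fun x : M => x * e)

/-- The `𝓡`-class `R_e`: the elements generating the same principal right ideal as `e`. -/
@[ext]
structure RClass (e : M) where
  val : M
  range_eq : Set.range (fun x : M => val * x) = Set.range (fun x : M => e * x)

theorem LClass.mul_self {e : M} (he : IsIdempotentElem e) (l : LClass e) : l.1 * e = l.1 := by
  have : l.1 ∈ Set.range (fun x : M => x * e) := by
    rw [← l.2]; exact ⟨1, one_mul _⟩
  obtain ⟨x, hx⟩ := this
  simp only at hx
  rw [← hx, mul_assoc, he.eq]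

theorem RClass.self_mul {e : M} (he : IsIdempotentElem e) (r : RClass e) : e * r.1 = r.1 := by
  have : r.1 ∈ Set.range (fun x : M => e * x) := by
    rw [← r.2]; exact ⟨1, mul_one _⟩
  obtain ⟨x, hx⟩ := this
  simp only at hx
  rw [← hx, ← mul_assoc, he.eq]

/-- `G_e` acts on `R_e` by left multiplication. -/
instance {e : M} (he : IsIdempotentElem e) : MulAction (MaximalSubgroup he) (RClass e) where
  smul g r := ⟨g.val.1 * r.1, by
    have h1 : g.val.1 * g.inv.1 = e := congrArg LocalMonoid.val g.val_inv
    apply Set.Subset.antisymm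
    · rintro _ ⟨x, rfl⟩
      refine ⟨g.val.1 * r.1 * x, ?_⟩
      simp only
      rw [← mul_assoc, ← mul_assoc, g.val.self_mul]
    · rintro _ ⟨x, rfl⟩
      have : e * (g.inv.1 * x) ∈ Set.range (fun x : M => r.1 * x) := by
        rw [r.2]; exact ⟨_, rfl⟩
      obtain ⟨y, hy⟩ := this
      refine ⟨y, ?_⟩
      simp only at hy ⊢
      rw [mul_assoc, hy, ← mul_assoc, g.val.mul_self, ← mul_assoc, h1]⟩
  one_smul r := RClass.ext (r.self_mul he)
  mul_smul g h r := RClass.ext (mul_assoc g.val.1 h.val.1 r.1)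

theorem RClass.smul_val {e : M} {he : IsIdempotentElem e} (g : MaximalSubgroup he)
    (r : RClass e) : (g • r).1 = g.val.1 * r.1 := rfl

/-- The left `ℤG_e`-module `ℤR_e`. -/
abbrev ZR {e : M} (he : IsIdempotentElem e) : Type _ :=
  (Representation.ofMulAction ℤ (MaximalSubgroup he) (RClass e)).asModule

/-- The module `ℤR_e^∨ = Hom_{ℤG_e}(ℤR_e, ℤG_e)`. -/
abbrev ZRDual {e : M} (he : IsIdempotentElem e) : Type _ :=
  ZR he →ₗ[MonoidAlgebra ℤ (MaximalSubgroup he)] MonoidAlgebra ℤ (MaximalSubgroup he)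

/-- The product `rℓ` of `r ∈ R_e` and `ℓ ∈ L_e`, as an element of `eMe`. -/
def pairing {e : M} (he : IsIdempotentElem e) (r : RClass e) (l : LClass e) : LocalMonoid he :=
  ⟨r.1 * l.1, by rw [← mul_assoc, r.self_mul he], by rw [mul_assoc, l.mul_self he]⟩

open Classical in
/-- The entry `φ_e(ℓ)(r)`: it is `rℓ` if `rℓ ∈ G_e` and `0` otherwise. -/
def sandwichEntry {e : M} (he : IsIdempotentElem e) (l : LClass e) (r : RClass e) :
    MonoidAlgebra ℤ (MaximalSubgroup he) :=
  if h : IsUnit (pairing he r l) then MonoidAlgebra.single h.unit 1 else 0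

theorem sandwichEntry_smul {e : M} (he : IsIdempotentElem e) (l : LClass e)
    (g : MaximalSubgroup he) (r : RClass e) :
    sandwichEntry he l (g • r) = MonoidAlgebra.single g 1 * sandwichEntry he l r := by
  have hp : pairing he (g • r) l = g * pairing he r l :=
    LocalMonoid.ext (mul_assoc g.val.1 r.1 l.1)
  by_cases h : IsUnit (pairing he r l)
  · have h' : IsUnit (pairing he (g • r) l) := hp ▸ g.isUnit.mul h
    have hu : h'.unit = g * h.unit := Units.ext hp
    rw [sandwichEntry, sandwichEntry, dif_pos h, dif_pos h', MonoidAlgebra.single_mul_single, hu,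
      one_mul]
  · have h' : ¬ IsUnit (pairing he (g • r) l) := by
      rw [hp, Units.isUnit_units_mul]; exact h
    rw [sandwichEntry, sandwichEntry, dif_neg h, dif_neg h', mul_zero]

/-- The functional `φ_e(ℓ) ∈ ℤR_e^∨`, which sends the basis element `r ∈ R_e` to `rℓ` if
`rℓ ∈ G_e` and to `0` otherwise. -/
def sandwichFunctional {e : M} (he : IsIdempotentElem e) (l : LClass e) : ZRDual he where
  toFun x := Finsupp.linearCombination ℤ (sandwichEntry he l)
    ((Representation.ofMulAction ℤ (MaximalSubgroup he) (RClass e)).asModuleEquiv x).coeff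
  map_add' x y := by simp
  map_smul' a x := by
    simp only [RingHom.id_apply, smul_eq_mul, Representation.asModuleEquiv_map_smul]
    generalize (Representation.ofMulAction ℤ (MaximalSubgroup he) (RClass e)).asModuleEquiv x = y
    induction a using MonoidAlgebra.induction_linear with
    | zero => simp
    | add a b ha hb => simp only [map_add, LinearMap.add_apply, MonoidAlgebra.coeff_add, ha, hb,
        add_mul]
    | single g c =>
      induction y using MonoidAlgebra.induction_linear with
      | zero => simp
      | add a b ha hb => simp only [map_add, MonoidAlgebra.coeff_add, ha, hb, mul_add]
      | single r d =>
        rw [Representation.asAlgebraHom_single, LinearMap.smul_apply,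
          Representation.ofMulAction_single, MonoidAlgebra.coeff_smul, map_smul,
          MonoidAlgebra.coeff_single, MonoidAlgebra.coeff_single,
          Finsupp.linearCombination_single, Finsupp.linearCombination_single, sandwichEntry_smul,
          mul_smul_comm, smul_comm, ← smul_mul_assoc, MonoidAlgebra.smul_single, smul_eq_mul,
          mul_one]

/-- The homomorphism `φ_e : ℤL_e → ℤR_e^∨`. -/
def sandwichMap {e : M} (he : IsIdempotentElem e) : (LClass e →₀ ℤ) →ₗ[ℤ] ZRDual he :=
  Finsupp.linearCombination ℤ (sandwichFunctional he)

end Monoids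

/-! ### Modular primes -/

/-- `p` is strongly modular for `M`: for some idempotent `e`, it divides the order of `G_e` or the
order of the torsion subgroup of `coker φ_e`. -/
def IsStronglyModular (p : ℕ) (M : Type*) [Monoid M] : Prop :=
  ∃ (e : M) (he : IsIdempotentElem e),
    p ∣ Nat.card (MaximalSubgroup he) ∨
    p ∣ Nat.card (AddCommGroup.torsion (ZRDual he ⧸ LinearMap.range (sandwichMap he)))

/-- The ideal `J = rad(ℚM) ∩ ℤM` of `ℤM`. -/
def integralRadical (M : Type*) [Monoid M] : Ideal (MonoidAlgebra ℤ M) :=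
  Ideal.comap (MonoidAlgebra.mapRingHom M (Int.castRingHom ℚ)) (Ring.jacobson (MonoidAlgebra ℚ M))

/-- The Loewy length of `A`: the least `n` with `rad(A)ⁿ = 0`. -/
def loewyLength (A : Type*) [Ring A] : ℕ := sInf {n : ℕ | Ring.jacobson A ^ n = ⊥}

/-- `p` is modular for `M`: it is strongly modular, or it divides the order of the torsion subgroup
of `J^i/J^(i+1)` for some `1 ≤ i < n`, where `n` is the Loewy length of `ℚM`. -/
def IsModular (p : ℕ) (M : Type*) [Monoid M] : Prop :=
  IsStronglyModular p M ∨
    ∃ i : ℕ, 1 ≤ i ∧ i < loewyLength (MonoidAlgebra ℚ M) ∧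
      p ∣ Nat.card (AddCommGroup.torsion
        (↥(integralRadical M ^ i) ⧸
          (integralRadical M ^ (i + 1)).submoduleOf (integralRadical M ^ i)))

/-! ### Path algebras -/

/-- A path in a quiver, with arbitrary source and target. -/
structure QuiverPath (V : Type*) [Quiver V] where
  src : V
  tgt : V
  path : Quiver.Path src tgt

/-- The path algebra: formal `R`-linear combinations of paths. -/
def PathAlgebra (R V : Type*) [CommRing R] [Quiver V] : Type _ := QuiverPath V →₀ R

namespace PathAlgebra

section Basic

variable (R V : Type*) [CommRing R] [Quiver V]

instance : AddCommGroup (PathAlgebra R V) := inferInstanceAs (AddCommGroup (QuiverPath V →₀ R))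

instance (S : Type*) [CommRing S] [Algebra S R] : Module S (PathAlgebra R V) :=
  inferInstanceAs (Module S (QuiverPath V →₀ R))

instance (S : Type*) [CommRing S] [Algebra S R] : IsScalarTower S R (PathAlgebra R V) :=
  inferInstanceAs (IsScalarTower S R (QuiverPath V →₀ R))

variable {V}

/-- The basis element of the path algebra given by a path. -/
def ofPath (p : QuiverPath V) : PathAlgebra R V := Finsupp.single p (1 : R)

/-- The empty path at `v`. -/
def nilPath (v : V) : QuiverPath V := ⟨v, v, Quiver.Path.nil⟩

/-- The path of length one given by an arrow. -/
def arrowPath {a b : V} (α : a ⟶ b) : QuiverPath V := ⟨a, b, α.toPath⟩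

open Classical in
/-- The product `qp` of two paths in the path algebra (first `p`, then `q`): their concatenation if
`p` ends where `q` starts, and `0` otherwise. -/
def pathMul (q p : QuiverPath V) : PathAlgebra R V :=
  if h : p.tgt = q.src then
    ofPath R ⟨p.src, q.tgt, p.path.comp (q.path.cast h.symm rfl)⟩
  else 0

variable (V)

/-- Multiplication in the path algebra: the bilinear extension of the product of paths. -/
def mulHom : PathAlgebra R V →ₗ[R] PathAlgebra R V →ₗ[R] PathAlgebra R V :=
  Finsupp.linearCombination R fun q => Finsupp.linearCombination R fun p => pathMul R q p

instance : Mul (PathAlgebra R V) := ⟨fun x y => mulHom R V x y⟩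

/-- The identity is the sum of all empty paths. -/
instance [Fintype V] : One (PathAlgebra R V) := ⟨∑ v : V, ofPath R (nilPath v)⟩

variable {R V}

theorem mul_def (x y : PathAlgebra R V) : x * y = mulHom R V x y := rfl

@[elab_as_elim]
theorem induction {P : PathAlgebra R V → Prop} (x : PathAlgebra R V) (h0 : P 0)
    (hadd : ∀ x y, P x → P y → P (x + y)) (hof : ∀ (c : R) p, P (c • ofPath R p)) : P x := by
  refine Finsupp.induction_linear (motive := P) x h0 hadd fun p c => ?_
  have : (Finsupp.single p c : PathAlgebra R V) = c • ofPath R p :=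
    (Finsupp.smul_single_one p c).symm
  exact this ▸ hof c p

theorem ofPath_mul_ofPath (q p : QuiverPath V) : ofPath R q * ofPath R p = pathMul R q p := by
  rw [mul_def, mulHom, ofPath, ofPath]
  erw [Finsupp.linearCombination_single, one_smul, Finsupp.linearCombination_single, one_smul]

theorem ofPath_mul_of_eq {a b c : V} (q : Quiver.Path b c) (p : Quiver.Path a b) :
    ofPath R ⟨b, c, q⟩ * ofPath R ⟨a, b, p⟩ = ofPath R ⟨a, c, p.comp q⟩ := by
  rw [ofPath_mul_ofPath, pathMul, dif_pos rfl]
  rfl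

theorem ofPath_mul_of_ne (q p : QuiverPath V) (h : p.tgt ≠ q.src) :
    ofPath R q * ofPath R p = 0 := by
  rw [ofPath_mul_ofPath, pathMul, dif_neg h]

instance : NonUnitalNonAssocRing (PathAlgebra R V) where
  left_distrib x y z := map_add (mulHom R V x) y z
  right_distrib x y z := by simp only [mul_def, map_add, LinearMap.add_apply]
  zero_mul x := by simp only [mul_def, map_zero, LinearMap.zero_apply]
  mul_zero x := map_zero (mulHom R V x)

theorem smul_mul' (c : R) (x y : PathAlgebra R V) : c • x * y = c • (x * y) := by
  simp only [mul_def, map_smul, LinearMap.smul_apply]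

theorem mul_smul' (c : R) (x y : PathAlgebra R V) : x * c • y = c • (x * y) := by
  simp only [mul_def, map_smul]

theorem mul_assoc' (x y z : PathAlgebra R V) : x * y * z = x * (y * z) := by
  induction x using induction with
  | h0 => simp only [zero_mul]
  | hadd x x' hx hx' => simp only [add_mul, hx, hx']
  | hof c p =>
  simp only [smul_mul']
  congr 1
  induction y using induction with
  | h0 => simp only [zero_mul, mul_zero]
  | hadd x x' hx hx' => simp only [add_mul, mul_add, hx, hx']
  | hof c q =>
  simp only [smul_mul', mul_smul']
  congr 1
  induction z using induction with
  | h0 => simp only [mul_zero]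
  | hadd x x' hx hx' => simp only [mul_add, hx, hx']
  | hof c r =>
  simp only [mul_smul']
  congr 1
  obtain ⟨a, b, p⟩ := p
  obtain ⟨a', b', q⟩ := q
  obtain ⟨a'', b'', r⟩ := r
  by_cases h1 : b' = a
  · subst h1
    by_cases h2 : b'' = a'
    · subst h2
      rw [ofPath_mul_of_eq, ofPath_mul_of_eq, ofPath_mul_of_eq, ofPath_mul_of_eq,
        Quiver.Path.comp_assoc]
    · rw [ofPath_mul_of_eq, ofPath_mul_of_ne _ _ h2, ofPath_mul_of_ne _ _ h2, mul_zero]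
  · rw [ofPath_mul_of_ne _ _ h1, zero_mul]
    by_cases h2 : b'' = a'
    · subst h2
      rw [ofPath_mul_of_eq, ofPath_mul_of_ne _ _ h1]
    · rw [ofPath_mul_of_ne _ _ h2, mul_zero]

variable [Fintype V]

theorem one_def : (1 : PathAlgebra R V) = ∑ v : V, ofPath R (nilPath v) := rfl

theorem one_mul' (x : PathAlgebra R V) : 1 * x = x := by
  classical
  induction x using induction with
  | h0 => rw [mul_zero]
  | hadd x y hx hy => rw [mul_add, hx, hy]
  | hof c p =>
  obtain ⟨a, b, p⟩ := p
  rw [mul_smul', one_def, Finset.sum_mul, Finset.sum_eq_single b]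
  · rw [nilPath, ofPath_mul_of_eq, Quiver.Path.comp_nil]
  · intro v _ hv
    exact ofPath_mul_of_ne _ _ hv.symm
  · simp

theorem mul_one' (x : PathAlgebra R V) : x * 1 = x := by
  classical
  induction x using induction with
  | h0 => rw [zero_mul]
  | hadd x y hx hy => rw [add_mul, hx, hy]
  | hof c p =>
  obtain ⟨a, b, p⟩ := p
  rw [smul_mul', one_def, Finset.mul_sum, Finset.sum_eq_single a]
  · rw [nilPath, ofPath_mul_of_eq, Quiver.Path.nil_comp]
  · intro v _ hv
    exact ofPath_mul_of_ne _ _ hv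
  · simp

instance : Ring (PathAlgebra R V) where
  __ : NonUnitalNonAssocRing (PathAlgebra R V) := inferInstance
  __ : One (PathAlgebra R V) := inferInstance
  mul_assoc := mul_assoc'
  one_mul := one_mul'
  mul_one := mul_one'
  zsmul := fun n x => n • x
  zsmul_zero' := fun x => zero_zsmul x
  zsmul_succ' := fun n x => SubNegMonoid.zsmul_succ' n x
  zsmul_neg' := fun n x => SubNegMonoid.zsmul_neg' n x
  neg_add_cancel := neg_add_cancel

instance (S : Type*) [CommRing S] [Algebra S R] : Algebra S (PathAlgebra R V) :=
  Algebra.ofModule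
    (fun s x y => by
      rw [← algebraMap_smul R s x, ← algebraMap_smul R s (x * y)]; exact smul_mul' _ x y)
    (fun s x y => by
      rw [← algebraMap_smul R s y, ← algebraMap_smul R s (x * y)]; exact mul_smul' _ x y)

variable (R V) in
/-- The arrow ideal: the two-sided ideal generated by all arrows. -/
def arrowIdeal : Ideal (PathAlgebra R V) :=
  (TwoSidedIdeal.span
    {x : PathAlgebra R V | ∃ (a b : V) (α : a ⟶ b), x = ofPath R (arrowPath α)}).asIdeal

/-- An ideal `I` is admissible if `Jⁿ ⊆ I ⊆ J²` for some `n ≥ 2`, where `J` is the arrow ideal. -/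
def IsAdmissible (I : Ideal (PathAlgebra R V)) : Prop :=
  I.IsTwoSided ∧ ∃ n : ℕ, 2 ≤ n ∧ arrowIdeal R V ^ n ≤ I ∧ I ≤ arrowIdeal R V ^ 2

end Basic

section BaseChange

variable {O : Type*} (K : Type*) {V : Type*} [CommRing O] [CommRing K] [Algebra O K] [Quiver V]

variable (O V) in
/-- The natural map `OQ → KQ`, applying `O → K` to the coefficients. -/
def coeffMap : PathAlgebra O V →ₗ[O] PathAlgebra K V :=
  Finsupp.mapRange.linearMap (Algebra.linearMap O K)

theorem coeffMap_ofPath (p : QuiverPath V) : coeffMap O K V (ofPath O p) = ofPath K p :=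
  (Finsupp.mapRange_single (hf := map_zero _)).trans
    (congrArg (Finsupp.single p) (map_one (algebraMap O K)))

theorem coeffMap_mul (x y : PathAlgebra O V) :
    coeffMap O K V (x * y) = coeffMap O K V x * coeffMap O K V y := by
  induction x using induction with
  | h0 => simp only [zero_mul, map_zero]
  | hadd x x' hx hx' => simp only [add_mul, map_add, hx, hx']
  | hof c p =>
  rw [smul_mul', map_smul, map_smul, ← algebraMap_smul K c, ← algebraMap_smul K c, smul_mul']
  congr 1
  induction y using induction with
  | h0 => simp only [mul_zero, map_zero]
  | hadd x x' hx hx' => simp only [mul_add, map_add, hx, hx']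
  | hof c q =>
  rw [mul_smul', map_smul, map_smul, ← algebraMap_smul K c, ← algebraMap_smul K c, mul_smul']
  congr 1
  rw [coeffMap_ofPath, coeffMap_ofPath, ofPath_mul_ofPath, ofPath_mul_ofPath, pathMul, pathMul]
  split_ifs
  · rw [coeffMap_ofPath]
  · rw [map_zero]

variable [Fintype V]

/-- The natural map `K ⊗ I → KQ` for an ideal `I` of `OQ`. -/
def baseChangeMap (I : Ideal (PathAlgebra O V)) :
    K ⊗[O] (I.restrictScalars O) →ₗ[K] PathAlgebra K V :=
  LinearMap.liftBaseChange K (coeffMap O K V ∘ₗ (I.restrictScalars O).subtype)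

theorem baseChangeMap_tmul (I : Ideal (PathAlgebra O V)) (c : K) (x : I.restrictScalars O) :
    baseChangeMap K I (c ⊗ₜ x) = c • coeffMap O K V x.1 := by
  simp [baseChangeMap]

theorem mul_mem_range_baseChangeMap (I : Ideal (PathAlgebra O V)) (a b : PathAlgebra K V)
    (hb : b ∈ LinearMap.range (baseChangeMap K I)) :
    a * b ∈ LinearMap.range (baseChangeMap K I) := by
  obtain ⟨t, rfl⟩ := hb
  induction a using induction with
  | h0 => rw [zero_mul]; exact zero_mem _
  | hadd x y hx hy => rw [add_mul]; exact add_mem hx hy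
  | hof c p =>
  rw [smul_mul']
  refine Submodule.smul_mem _ _ ?_
  induction t with
  | zero => rw [map_zero, mul_zero]; exact zero_mem _
  | add x y hx hy => rw [map_add, mul_add]; exact add_mem hx hy
  | tmul d x =>
  rw [baseChangeMap_tmul, mul_smul', ← coeffMap_ofPath (O := O), ← coeffMap_mul]
  exact ⟨d ⊗ₜ ⟨_, I.mul_mem_left (ofPath O p) x.2⟩, baseChangeMap_tmul ..⟩

theorem mul_mem_range_baseChangeMap_right (I : Ideal (PathAlgebra O V)) [I.IsTwoSided]
    (a b : PathAlgebra K V) (hb : b ∈ LinearMap.range (baseChangeMap K I)) :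
    b * a ∈ LinearMap.range (baseChangeMap K I) := by
  obtain ⟨t, rfl⟩ := hb
  induction a using induction with
  | h0 => rw [mul_zero]; exact zero_mem _
  | hadd x y hx hy => rw [mul_add]; exact add_mem hx hy
  | hof c p =>
  rw [mul_smul']
  refine Submodule.smul_mem _ _ ?_
  induction t with
  | zero => rw [map_zero, zero_mul]; exact zero_mem _
  | add x y hx hy => rw [map_add, add_mul]; exact add_mem hx hy
  | tmul d x =>
  rw [baseChangeMap_tmul, smul_mul', ← coeffMap_ofPath (O := O), ← coeffMap_mul]
  exact ⟨d ⊗ₜ ⟨_, I.mul_mem_right (ofPath O p) x.2⟩, baseChangeMap_tmul ..⟩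

/-- The ideal `K ⊗ I` of `KQ`, that is, the image of the natural map `K ⊗ I → KQ`. -/
def baseChangeIdeal (I : Ideal (PathAlgebra O V)) : Ideal (PathAlgebra K V) where
  carrier := Set.range (baseChangeMap K I)
  add_mem' := fun hx hy => add_mem (S := Submodule K (PathAlgebra K V))
    (s := LinearMap.range (baseChangeMap K I)) hx hy
  zero_mem' := ⟨0, map_zero _⟩
  smul_mem' a b hb := mul_mem_range_baseChangeMap K I a b hb

instance (I : Ideal (PathAlgebra O V)) [I.IsTwoSided] : (baseChangeIdeal K I).IsTwoSided :=
  ⟨fun a hb => mul_mem_range_baseChangeMap_right K I a _ hb⟩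

end BaseChange

end PathAlgebra

end

noncomputable section

open scoped TensorProduct

/-! ### Finite monoids -/

section FiniteMonoids

variable {M : Type*} [Monoid M]

/-! Write N_R for `sandwichIdeal R M`: the ideal of R[M] cut out by the equations coeff_e(axb) = 0,
for e idempotent, a in eM and b in Me. These equations have coefficients 0 and 1, so N_R can be
compared over ℤ, ℚ, O, F and k. It is nilpotent over every R (`exists_sandwichIdeal_pow_eq_bot`),
and over a field in which every |G_e| is nonzero it is the Jacobson radical
(`jacobson_eq_sandwichIdeal`), by a trace computation on L_e. Hence N_F and N_k are the radicals of
FM and kM, and J = N_ℤ.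

Nonmodularity then has two further consequences. As p divides neither |G_e| nor the torsion of coker
φ_e, the sandwich matrices have generalized inverses over O, and every element of N_k is the
reduction of an element of N_O (`exists_sub_mem_sandwichIdeal`). As p does not divide the torsion of
J/J², the quotient OM/N_O² is torsion-free (`mem_sandwichIdeal_mul_of_smul_mem`). The quotients
J^i/J^(i+1) with i > 1 play no role: the arrows of a quiver only see the radical modulo its square.

Completeness lifts the idempotents of kM to a family f in OM. By Nakayama the split structure lifts
as well: f_i OM f_i is O f_i modulo N_O, and f_i OM f_j lies in N_O for distinct chosen i, j
(`exists_lift_basic`). This makes the image in FM basic (`isBasicIdempotent_map`).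

The vertices of Q are the chosen f_i. The arrows a → b lift an O-basis of the image of f_b N_O f_a
in OM/N_O², which is free by purity (`exists_arrows`). Nilpotency of N_O makes OQ → ẽ OM ẽ
surjective (`mul_mul_mem_range_lift`); let I be its kernel. The surjection splits O-linearly, so I
commutes with base change to F and to k (`injective_baseChangeMap`, `mem_baseChangeIdeal_iff`). Over
either field, nilpotency puts a power of the arrow ideal inside I, and functionals dual to the
arrows and zero on the squared radical put I inside the square of the arrow ideal
(`isAdmissible_of_mem_iff`). -/

/-- `m` lies in the two-sided ideal generated by `j`. -/
def JLE (m j : M) : Prop := ∃ u v, u * j * v = m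

theorem JLE.refl (m : M) : JLE m m := ⟨1, 1, by simp⟩

theorem JLE.trans {a b c : M} (hab : JLE a b) (hbc : JLE b c) : JLE a c := by
  obtain ⟨u, v, rfl⟩ := hab
  obtain ⟨u', v', rfl⟩ := hbc
  exact ⟨u * u', v' * v, by simp only [mul_assoc]⟩

theorem jle_mul_right (m b : M) : JLE (m * b) m := ⟨1, b, by simp⟩

theorem exists_pow_isIdempotentElem [Finite M] (x : M) : ∃ n, IsIdempotentElem (x ^ (n + 1)) := by
  obtain ⟨i, j, hij, h⟩ : ∃ i j : ℕ, i < j ∧ x ^ i = x ^ j := by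
    obtain ⟨i, j, hne, h⟩ := Finite.exists_ne_map_eq_of_infinite (fun n : ℕ => x ^ n)
    rcases lt_or_gt_of_ne hne with hlt | hlt
    · exact ⟨i, j, hlt, h⟩
    · exact ⟨j, i, hlt, h.symm⟩
  obtain ⟨d, rfl⟩ := Nat.exists_eq_add_of_lt hij
  have step : ∀ t a, i ≤ a → x ^ (a + t * (d + 1)) = x ^ a := by
    intro t
    induction t with
    | zero => simp
    | succ t ih =>
      intro a ha
      have h1 : x ^ (a + (d + 1)) = x ^ a := by
        obtain ⟨c, rfl⟩ := Nat.exists_eq_add_of_le ha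
        have : i + c + (d + 1) = (i + d + 1) + c := by ring
        rw [this, pow_add, ← h, ← pow_add]
      have : a + (t + 1) * (d + 1) = (a + (d + 1)) + t * (d + 1) := by ring
      rw [this, ih _ (by omega), h1]
  -- The exponent (i + 1)(d + 1) is a multiple of the period d + 1 and at least the preperiod i, so
  -- doubling it does not change the power.
  refine ⟨(i + 1) * (d + 1) - 1, ?_⟩
  have hpos : 1 ≤ (i + 1) * (d + 1) := Nat.succ_le_of_lt (by positivity)
  rw [Nat.sub_add_cancel hpos, IsIdempotentElem, ← pow_add]
  refine step _ _ ?_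
  nlinarith

/-- Iterating gives u^k m w^k = m, and the idempotent w^k is absorbed on the right. -/
theorem mul_pow_eq_of_eq_mul_mul [Finite M] {m u w : M} (h : u * m * w = m) :
    ∀ k, IsIdempotentElem (w ^ k) → m * w ^ k = m := by
  intro k hk
  have hpow : ∀ k, u ^ k * m * w ^ k = m := by
    intro k
    induction k with
    | zero => simp
    | succ k ih =>
      rw [pow_succ, pow_succ']
      calc u ^ k * u * m * (w * w ^ k) = u ^ k * (u * m * w) * w ^ k := by simp only [mul_assoc]
        _ = m := by rw [h, ih]
  calc m * w ^ k = u ^ k * m * w ^ k * w ^ k := by rw [hpow]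
    _ = m := by rw [mul_assoc, hk.eq, hpow]

theorem pow_mul_eq_of_eq_mul_mul [Finite M] {m u w : M} (h : u * m * w = m) :
    ∀ k, IsIdempotentElem (u ^ k) → u ^ k * m = m := by
  intro k hk
  have hpow : ∀ k, u ^ k * m * w ^ k = m := by
    intro k
    induction k with
    | zero => simp
    | succ k ih =>
      rw [pow_succ, pow_succ']
      calc u ^ k * u * m * (w * w ^ k) = u ^ k * (u * m * w) * w ^ k := by simp only [mul_assoc]
        _ = m := by rw [h, ih]
  calc u ^ k * m = u ^ k * (u ^ k * m * w ^ k) := by rw [hpow]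
    _ = m := by rw [← mul_assoc, ← mul_assoc, hk.eq, hpow]

/-- Stability: if `m` lies in the ideal generated by `s * m`, then it lies in `M * s * m`. -/
theorem exists_mul_mul_eq [Finite M] {m s : M} (h : JLE m (s * m)) : ∃ y, y * (s * m) = m := by
  obtain ⟨u, v, h⟩ := h
  obtain ⟨k, hk⟩ := exists_pow_isIdempotentElem (u * s)
  -- An idempotent power of us fixes m on the left; its last factor s supplies the required
  -- right-hand end sm.
  refine ⟨(u * s) ^ k * u, ?_⟩
  have := pow_mul_eq_of_eq_mul_mul (u := u * s) (w := v) (m := m) (by simpa only [mul_assoc] using h)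
    _ hk
  rw [pow_succ] at this
  simpa only [mul_assoc] using this

theorem exists_mul_mul_eq' [Finite M] {m s : M} (h : JLE m (m * s)) : ∃ y, m * s * y = m := by
  obtain ⟨u, v, h⟩ := h
  obtain ⟨k, hk⟩ := exists_pow_isIdempotentElem (s * v)
  refine ⟨v * (s * v) ^ k, ?_⟩
  have := mul_pow_eq_of_eq_mul_mul (u := u) (w := s * v) (m := m)
    (by simpa only [mul_assoc] using h) _ hk
  rw [pow_succ'] at this
  simpa only [mul_assoc] using this

instance [Finite M] {e : M} (he : IsIdempotentElem e) : Finite (LocalMonoid he) :=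
  Finite.of_injective LocalMonoid.val fun _ _ h => LocalMonoid.ext h

instance [Finite M] (e : M) : Finite (LClass e) :=
  Finite.of_injective LClass.val fun _ _ h => LClass.ext h

instance [Finite M] (e : M) : Finite (RClass e) :=
  Finite.of_injective RClass.val fun _ _ h => RClass.ext h

/-- An element of `eMe` which generates an ideal containing `e` is a unit of `eMe`. -/
theorem LocalMonoid.isUnit_of_jle [Finite M] {e : M} {he : IsIdempotentElem e} (m : LocalMonoid he)
    (h : JLE e m.1) : IsUnit m := by
  have h' : JLE e (m.1 * e) := by rwa [m.mul_self]
  obtain ⟨y, hy⟩ := exists_mul_mul_eq h'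
  rw [m.mul_self] at hy
  have h1 : (⟨e * y * e, by rw [← mul_assoc, ← mul_assoc, he.eq], by rw [mul_assoc, he.eq]⟩ :
      LocalMonoid he) * m = 1 := by
    refine LocalMonoid.ext ?_
    change e * y * e * m.1 = e
    rw [mul_assoc, m.self_mul, mul_assoc, hy, he.eq]
  exact IsUnit.of_mul_eq_one _ (mul_eq_one_symm h1)

/-- Here m, m' and j lie in one 𝓙-class, and n witnesses that this class is regular. Stability lets
both multipliers be moved to an idempotent f of the class, so that every coefficient of a product m
x m' on the class is one of the coefficients defining `sandwichIdeal`. -/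
theorem exists_equiv_of_mul_mul_eq [Finite M] {m n m' j : M} (hj : m * n * m' = j) (hm : JLE m j)
    (hm' : JLE m' j) : ∃ f a b : M, IsIdempotentElem f ∧ f * a = a ∧ b * f = b ∧
      ∀ n', m * n' * m' = j ↔ a * n' * b = f := by
  have hmv : ∃ v, m * n * m' * v = m := by
    have := exists_mul_mul_eq' (m := m) (s := n * m') (by rwa [← mul_assoc, hj])
    simpa only [mul_assoc] using this
  obtain ⟨v, hv⟩ := hmv
  obtain ⟨k, hk⟩ := exists_pow_isIdempotentElem (n * m' * v)
  -- Since m(nm'v) = m, this idempotent fixes m on the right.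
  set f := (n * m' * v) ^ (k + 1) with hf
  have hmf : m * f = m := mul_pow_eq_of_eq_mul_mul (u := 1) (by
    rw [one_mul]; simpa only [mul_assoc] using hv) _ hk
  have hjm : JLE j m := by rw [← hj, mul_assoc]; exact jle_mul_right _ _
  have hm'm : JLE m' m := hm'.trans hjm
  have hfm : JLE f m := by
    have : JLE f m' := by
      rw [hf, pow_succ']; exact ⟨n, v * (n * m' * v) ^ k, by simp only [mul_assoc]⟩
    exact this.trans hm'm
  obtain ⟨c, hc⟩ : ∃ c, c * m = f := by
    have := exists_mul_mul_eq (m := f) (s := m) (by rwa [hmf])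
    rwa [hmf] at this
  -- The element v' is chosen so that (f n m') v' = f. Then v't is idempotent, and stability shows
  -- that it fixes m' on the right, so passing to b = m'v' loses nothing.
  set v' := v * (n * m' * v) ^ k * f with hv'
  set t := f * n * m' with ht
  have htv : t * v' = f := by
    calc t * v' = f * (n * m' * v * (n * m' * v) ^ k) * f := by simp only [ht, hv', mul_assoc]
      _ = f := by rw [← pow_succ', ← hf, hk.eq, hk.eq]
  have hft : f * t = t := by rw [ht, ← mul_assoc, ← mul_assoc, hk.eq]
  have hv'f : v' * f = v' := by rw [hv', mul_assoc, hk.eq]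
  have hidem : v' * t * (v' * t) = v' * t := by
    rw [mul_assoc, ← mul_assoc t, htv, hft]
  have hm't : JLE m' (v' * f * n * m') := by
    have h1 : JLE f (v' * t) := ⟨t, v', by
      rw [mul_assoc, mul_assoc v', htv, ← mul_assoc, htv, hk.eq]⟩
    have h2 : JLE m f := ⟨m, 1, by rw [hmf, mul_one]⟩
    have h3 : v' * f * n * m' = v' * t := by simp only [ht, mul_assoc]
    rw [h3]
    exact (hm'm.trans h2).trans h1
  obtain ⟨y, hy⟩ := exists_mul_mul_eq hm't
  have hy' : y * (v' * t) = m' := by simpa only [ht, mul_assoc] using hy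
  have hm'vt : m' * (v' * t) = m' := by
    conv_lhs => rw [← hy', mul_assoc, hidem, hy']
  refine ⟨f, f, m' * v', hk, hk.eq, by rw [mul_assoc, hv'f], fun n' => ⟨fun h => ?_, fun h => ?_⟩⟩
  · calc f * n' * (m' * v') = c * (m * n' * m') * v' := by rw [← hc]; simp only [mul_assoc]
      _ = c * (m * n * m') * v' := by rw [h, hj]
      _ = t * v' := by rw [ht, ← hc]; simp only [mul_assoc]
      _ = f := htv
  · calc m * n' * m' = (m * f) * n' * (m' * (v' * t)) := by rw [hmf, hm'vt]
      _ = m * (f * n' * (m' * v')) * t := by simp only [mul_assoc]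
      _ = (m * f) * n * m' := by rw [h, hmf, ht, ← mul_assoc, ← mul_assoc, hmf]
      _ = j := by rw [hmf, hj]

/-- Idempotents generating the same two-sided ideal factor through each other. -/
theorem exists_mul_eq_of_jle [Finite M] {e f : M} (he : IsIdempotentElem e)
    (hf : IsIdempotentElem f) (hef : JLE e f) (hfe : JLE f e) :
    ∃ u v, u * v = f ∧ v * u = e ∧ f * u = u ∧ v * f = v ∧ u * e = u ∧ e * v = v := by
  obtain ⟨x, y, h⟩ := hfe
  have huv : (f * x * e) * (e * y * f) = f := by
    calc (f * x * e) * (e * y * f) = f * (x * (e * e) * y) * f := by simp only [mul_assoc]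
      _ = f := by rw [he.eq, h, hf.eq, hf.eq]
  set u := f * x * e with hu
  set v := e * y * f with hv
  have hfu : f * u = u := by rw [hu, ← mul_assoc, ← mul_assoc, hf.eq]
  have hvf : v * f = v := by rw [hv, mul_assoc, hf.eq]
  have hue : u * e = u := by rw [hu, mul_assoc, he.eq]
  have hev : e * v = v := by rw [hv, ← mul_assoc, ← mul_assoc, he.eq]
  have hvu : IsIdempotentElem (v * u) := by
    rw [IsIdempotentElem, mul_assoc, ← mul_assoc u, huv, hfu]
  have hunit : IsUnit (⟨v * u, by rw [← mul_assoc, hev], by rw [mul_assoc, hue]⟩ :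
      LocalMonoid he) := by
    refine LocalMonoid.isUnit_of_jle _ (hef.trans ⟨u, v, ?_⟩)
    change u * (v * u) * v = f
    rw [← mul_assoc u v u, huv, hfu, huv]
  refine ⟨u, v, huv, ?_, hfu, hvf, hue, hev⟩
  have h1 := (IsIdempotentElem.iff_eq_one_of_isUnit hunit).1 (LocalMonoid.ext hvu)
  exact congrArg LocalMonoid.val h1

end FiniteMonoids

/-! ### Nil ideals and the Jacobson radical -/

theorem le_jacobson_of_forall_isNilpotent {A : Type*} [Ring A] {I : Ideal A}
    (h : ∀ x ∈ I, IsNilpotent x) : I ≤ Ring.jacobson A := by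
  rw [Ring.jacobson_eq_sInf_isMaximal]
  refine le_sInf fun m hm x hx => ?_
  replace hm : m.IsMaximal := hm
  by_contra hxm
  obtain ⟨a, y, hy, hay⟩ : ∃ a, ∃ y ∈ m, a * x + y = 1 := by
    have h1 : m ⊔ Ideal.span {x} = ⊤ :=
      hm.1.2 _ (lt_of_le_of_ne le_sup_left fun h' => hxm (h' ▸ Ideal.mem_sup_right
        (Ideal.subset_span rfl)))
    obtain ⟨y, hy, z, hz, hyz⟩ := Submodule.mem_sup.1 ((Ideal.eq_top_iff_one _).1 h1)
    obtain ⟨a, rfl⟩ := Ideal.mem_span_singleton'.1 hz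
    exact ⟨a, y, hy, by rw [add_comm, hyz]⟩
  have hu : IsUnit y := by
    have : y = 1 - a * x := by rw [← hay]; abel
    rw [this]
    exact (h _ (I.mul_mem_left a hx)).isUnit_one_sub
  exact hm.ne_top (Ideal.eq_top_of_isUnit_mem _ hy hu)

theorem isNilpotent_of_mem_of_pow_eq_bot {A : Type*} [Ring A] {I : Ideal A} {n : ℕ}
    (h : I ^ n = ⊥) {x : A} (hx : x ∈ I) : IsNilpotent x :=
  ⟨n, by simpa [h] using Ideal.pow_mem_pow hx n⟩

theorem exists_jacobson_pow_eq_bot (K A : Type*) [Field K] [Ring A] [Algebra K A]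
    [Module.Finite K A] : ∃ n, Ring.jacobson A ^ n = ⊥ := by
  have : IsArtinianRing A := IsArtinianRing.of_finite K A
  exact IsSemiprimaryRing.isNilpotent (R := A)

theorem isNilpotent_of_mem_jacobson (K : Type*) {A : Type*} [Field K] [Ring A] [Algebra K A]
    [Module.Finite K A] {x : A} (hx : x ∈ Ring.jacobson A) : IsNilpotent x := by
  obtain ⟨n, hn⟩ := exists_jacobson_pow_eq_bot K A
  exact isNilpotent_of_mem_of_pow_eq_bot hn hx

/-! ### The sandwich ideal -/

section SandwichIdeal

open MonoidAlgebra

variable {R M : Type*} [CommRing R] [Monoid M]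

theorem coeff_single_mul_single [Fintype M] [DecidableEq M] (a b e : M) (x : MonoidAlgebra R M) :
    (single a 1 * x * single b 1).coeff e = ∑ m, if a * m * b = e then x.coeff m else 0 := by
  induction x using MonoidAlgebra.induction_linear with
  | zero => simp
  | add x y hx hy =>
    rw [mul_add, add_mul, coeff_add, Finsupp.add_apply, hx, hy, ← Finset.sum_add_distrib]
    refine Finset.sum_congr rfl fun m _ => ?_
    split_ifs <;> simp
  | single m r =>
    rw [single_mul_single, single_mul_single, coeff_single, Finsupp.single_apply,
      Finset.sum_eq_single m (fun n _ hn => by simp [hn.symm]) (by simp)]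
    simp

theorem eq_sum_smul_single [Fintype M] (x : MonoidAlgebra R M) :
    x = ∑ m, x.coeff m • single m (1 : R) := by
  classical
  ext m
  simp [coeff_sum]

theorem coeff_mul_mul [Fintype M] (x y z : MonoidAlgebra R M) (j : M) :
    (x * y * z).coeff j =
      ∑ m, ∑ m', x.coeff m * z.coeff m' * (single m 1 * y * single m' 1).coeff j := by
  conv_lhs => rw [eq_sum_smul_single x, eq_sum_smul_single z]
  simp only [Finset.sum_mul, Finset.mul_sum, coeff_sum, Finsupp.finsetSum_apply, smul_mul_assoc,
    mul_smul_comm, coeff_smul, Finsupp.smul_apply, smul_eq_mul, ← mul_assoc]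
  rw [Finset.sum_comm]
  refine Finset.sum_congr rfl fun m _ => Finset.sum_congr rfl fun m' _ => ?_
  ring

/-- The elements `x` with `coeff_e (a x b) = 0` for all `a ∈ eM` and `b ∈ Me`. -/
def sandwichIdealAt (R : Type*) {M : Type*} [CommRing R] [Monoid M] (e : M) :
    Ideal (MonoidAlgebra R M) where
  carrier := {x | ∀ a b, e * a = a → b * e = b →
    (single a 1 * x * single b 1 : MonoidAlgebra R M).coeff e = 0}
  add_mem' hx hy a b ha hb := by
    rw [mul_add, add_mul, coeff_add, Finsupp.add_apply, hx a b ha hb, hy a b ha hb, add_zero]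
  zero_mem' a b _ _ := by simp
  smul_mem' c x hx a b ha hb := by
    rw [smul_eq_mul]
    induction c using MonoidAlgebra.induction_linear with
    | zero => simp
    | add c d hc hd =>
      rw [add_mul, mul_add, add_mul, coeff_add, Finsupp.add_apply, hc, hd, add_zero]
    | single m r =>
      have := hx (a * m) b (by rw [← mul_assoc, ha]) hb
      have h : (single a 1 * (single m r * x) * single b 1 : MonoidAlgebra R M) =
          r • (single (a * m) 1 * x * single b 1) := by
        rw [← mul_assoc, single_mul_single, ← smul_mul_assoc, ← smul_mul_assoc, smul_single,
          smul_eq_mul, mul_one, one_mul]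
      rw [h, coeff_smul, Finsupp.smul_apply, this, smul_zero]

instance (e : M) : (sandwichIdealAt R e).IsTwoSided where
  mul_mem_of_left {x} c hx a b ha hb := by
    induction c using MonoidAlgebra.induction_linear with
    | zero => simp
    | add c d hc hd =>
      rw [mul_add, mul_add, add_mul, coeff_add, Finsupp.add_apply, hc, hd, add_zero]
    | single m r =>
      have := hx a (m * b) ha (by rw [mul_assoc, hb])
      have h : (single a 1 * (x * single m r) * single b 1 : MonoidAlgebra R M) =
          r • (single a 1 * x * single (m * b) 1) := by
        rw [mul_assoc, mul_assoc x, single_mul_single, mul_one, mul_assoc, ← mul_smul_comm,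
          ← mul_smul_comm, smul_single, smul_eq_mul, mul_one]
      rw [h, coeff_smul, Finsupp.smul_apply, this, smul_zero]

variable (R M) in
/-- The elements `x` with `coeff_e (a x b) = 0` for all idempotents `e`, `a ∈ eM` and `b ∈ Me`. -/
def sandwichIdeal : Ideal (MonoidAlgebra R M) :=
  ⨅ (e : M) (_ : IsIdempotentElem e), sandwichIdealAt R e

theorem mem_sandwichIdeal {x : MonoidAlgebra R M} : x ∈ sandwichIdeal R M ↔
    ∀ e : M, IsIdempotentElem e → x ∈ sandwichIdealAt R e := by
  simp [sandwichIdeal, Submodule.mem_iInf]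

instance : (sandwichIdeal R M).IsTwoSided where
  mul_mem_of_left c hx := by
    rw [mem_sandwichIdeal] at hx ⊢
    exact fun e he => Ideal.mul_mem_right c _ (hx e he)

theorem map_coeff_single_mul_single {S : Type*} [CommRing S] (f : R →+* S) (a b e : M)
    (x : MonoidAlgebra R M) :
    (single a 1 * mapRingHom M f x * single b 1).coeff e =
      f ((single a 1 * x * single b 1).coeff e) := by
  rw [← coeff_mapRingHom, map_mul, map_mul, mapRingHom_single, mapRingHom_single, map_one]

theorem map_mem_sandwichIdeal {S : Type*} [CommRing S] (f : R →+* S) {x : MonoidAlgebra R M}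
    (hx : x ∈ sandwichIdeal R M) : mapRingHom M f x ∈ sandwichIdeal S M := by
  rw [mem_sandwichIdeal] at hx ⊢
  intro e he a b ha hb
  rw [map_coeff_single_mul_single, hx e he a b ha hb, map_zero]

theorem map_mem_sandwichIdeal_iff {S : Type*} [CommRing S] (f : R →+* S)
    (hf : Function.Injective f) {x : MonoidAlgebra R M} :
    mapRingHom M f x ∈ sandwichIdeal S M ↔ x ∈ sandwichIdeal R M := by
  refine ⟨fun h => ?_, map_mem_sandwichIdeal f⟩
  rw [mem_sandwichIdeal] at h ⊢
  intro e he a b ha hb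
  apply hf
  rw [← map_coeff_single_mul_single, h e he a b ha hb, map_zero]

/-- The part removed from X is a maximal 𝓙-class of X. A coefficient of yxz there only involves m
and m' from that same class, and `exists_equiv_of_mul_mul_eq` turns each contribution into a
sandwich coefficient of x, which is zero. -/
theorem exists_smaller_support [Finite M] {X : Set M} (hX : ∀ m ∈ X, ∀ n, JLE n m → n ∈ X)
    (hne : X.Nonempty) : ∃ X' ⊂ X, (∀ m ∈ X', ∀ n, JLE n m → n ∈ X') ∧
      ∀ x ∈ sandwichIdeal R M, ∀ y z : MonoidAlgebra R M, (∀ m ∉ X, y.coeff m = 0) →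
        (∀ m ∉ X, z.coeff m = 0) → ∀ m ∉ X', (y * x * z).coeff m = 0 := by
  classical
  have := Fintype.ofFinite M
  obtain ⟨a₀, ha₀, hmax⟩ := X.toFinite.exists_maximalFor (fun a => {n | JLE n a}) X hne
  have hmax' : ∀ m ∈ X, JLE a₀ m → JLE m a₀ := fun m hm h =>
    hmax hm (fun n hn => JLE.trans hn h) (JLE.refl m)
  refine ⟨X \ {m | JLE a₀ m}, ?_, ?_, ?_⟩
  · exact ⟨Set.sdiff_subset, fun h => (h ha₀).2 (JLE.refl a₀)⟩
  · rintro m ⟨hm, hm'⟩ n hn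
    exact ⟨hX m hm n hn, fun h => hm' (JLE.trans h hn)⟩
  · intro x hx y z hy hz j hj
    rw [coeff_mul_mul]
    refine Finset.sum_eq_zero fun m _ => Finset.sum_eq_zero fun m' _ => ?_
    by_cases hm : m ∈ X
    swap
    · rw [hy m hm, zero_mul, zero_mul]
    by_cases hm' : m' ∈ X
    swap
    · rw [hz m' hm', mul_zero, zero_mul]
    suffices h : (single m 1 * x * single m' 1).coeff j = 0 by rw [h, mul_zero]
    rw [coeff_single_mul_single]
    by_cases hex : ∃ n, m * n * m' = j
    swap
    · push Not at hex
      exact Finset.sum_eq_zero fun n _ => if_neg (hex n)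
    obtain ⟨n, hn⟩ := hex
    have hjX : j ∈ X := hX m hm j ⟨1, n * m', by rw [← hn]; simp [mul_assoc]⟩
    have haj : JLE a₀ j := by
      by_contra h
      exact hj ⟨hjX, h⟩
    have hjm : JLE j m := ⟨1, n * m', by rw [← hn]; simp [mul_assoc]⟩
    have hjm' : JLE j m' := ⟨m * n, 1, by rw [← hn]; simp [mul_assoc]⟩
    obtain ⟨f, a, b, hf, ha, hb, hiff⟩ := exists_equiv_of_mul_mul_eq hn
      ((hmax' m hm (haj.trans hjm)).trans haj) ((hmax' m' hm' (haj.trans hjm')).trans haj)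
    have := mem_sandwichIdeal.1 hx f hf a b ha hb
    rw [coeff_single_mul_single] at this
    exact (Finset.sum_congr rfl fun n' _ => by simp only [hiff n']).trans this

variable (R M) in
-- If the s-th power is supported on X, then the power 2s + 1, read as (s-th power)·N·(s-th power),
-- is supported on the smaller set of `exists_smaller_support`. Finiteness of M ends the descent.
theorem exists_sandwichIdeal_pow_eq_bot [Finite M] : ∃ n, sandwichIdeal R M ^ n = ⊥ := by
  suffices H : ∀ (c : ℕ) (X : Set M), X.ncard = c → (∀ m ∈ X, ∀ n, JLE n m → n ∈ X) →
      (∃ s, ∀ y ∈ sandwichIdeal R M ^ s, ∀ m ∉ X, y.coeff m = 0) →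
      ∃ n, sandwichIdeal R M ^ n = ⊥ from
    H _ Set.univ rfl (fun _ _ _ _ => Set.mem_univ _) ⟨0, fun _ _ m hm => absurd (Set.mem_univ m) hm⟩
  intro c
  induction c using Nat.strong_induction_on with
  | _ c ih =>
  rintro X rfl hX ⟨s, hs⟩
  rcases X.eq_empty_or_nonempty with rfl | hne
  · refine ⟨s, (Submodule.eq_bot_iff _).2 fun y hy => ?_⟩
    ext m
    exact hs y hy m (Set.notMem_empty m)
  obtain ⟨X', hX'X, hX', h⟩ := exists_smaller_support (R := R) hX hne
  refine ih _ (Set.ncard_lt_ncard hX'X X.toFinite) X' rfl hX' ⟨s + 1 + s, fun y hy => ?_⟩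
  rw [Ideal.IsTwoSided.pow_add, Submodule.pow_succ] at hy
  refine Submodule.mul_induction_on hy ?_ fun y y' h₁ h₂ m hm => ?_
  · intro u hu v hv
    refine Submodule.mul_induction_on hu ?_ fun y y' h₁ h₂ m hm => ?_
    · intro y hy x hx
      exact h x hx y v (hs y hy) (hs v hv)
    · rw [add_mul, coeff_add, Finsupp.add_apply, h₁ m hm, h₂ m hm, add_zero]
  · rw [coeff_add, Finsupp.add_apply, h₁ m hm, h₂ m hm, add_zero]

/-! ### Traces on 𝓛-classes and the Jacobson radical. -/

/-- The action of `M` on the span of the `𝓛`-class of `e`, as a matrix representation. -/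
def leftSchutzenberger (R : Type*) {M : Type*} [CommRing R] [Monoid M] (e : M) [Fintype (LClass e)]
    [DecidableEq M] [DecidableEq (LClass e)] : M →* Matrix (LClass e) (LClass e) R where
  toFun m := Matrix.of fun l l' => if m * l'.1 = l.1 then 1 else 0
  map_one' := by
    ext l l'
    simp only [one_mul, Matrix.of_apply, Matrix.one_apply, LClass.ext_iff, eq_comm]
  map_mul' m n := by
    ext l l'
    rw [Matrix.mul_apply]
    simp only [Matrix.of_apply, mul_ite, mul_one, mul_zero]
    by_cases h : m * n * l'.1 = l.1
    · rw [if_pos h]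
      -- The intermediate element nl' lies below l' and above mnl' = l in the 𝓛-order, so it cannot
      -- leave the class.
      let k : LClass e := ⟨n * l'.1, by
        apply Set.Subset.antisymm
        · rintro _ ⟨x, rfl⟩
          rw [← l'.2]
          exact ⟨x * n, by simp only [mul_assoc]⟩
        · rw [← l.2]
          rintro _ ⟨x, rfl⟩
          exact ⟨x * m, by simp only [← h, mul_assoc]⟩⟩
      rw [Finset.sum_eq_single k]
      · rw [if_pos rfl, if_pos (by rw [← h, mul_assoc])]
      · intro k' _ hk'
        rw [if_neg fun h' => hk' (LClass.ext h'.symm)]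
      · simp
    · rw [if_neg h]
      symm
      refine Finset.sum_eq_zero fun k _ => ?_
      split_ifs with h1 h2
      · exact absurd (by rw [mul_assoc, h1, h2]) h
      · rfl
      · rfl

theorem LClass.exists_mul_eq {e : M} (l : LClass e) : ∃ u, u * l.1 = e := by
  have : e ∈ Set.range (fun x : M => x * l.1) := by rw [l.2]; exact ⟨1, one_mul e⟩
  exact this

/-- An element of `Me` dividing `e` on the left lies in the `𝓛`-class of `e`. -/
def LClass.mk' {e l : M} (h1 : l * e = l) (h2 : ∃ u, u * l = e) : LClass e := ⟨l, by
  obtain ⟨u, hu⟩ := h2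
  apply Set.Subset.antisymm
  · rintro _ ⟨x, rfl⟩
    exact ⟨x * l, by simp only [mul_assoc, h1]⟩
  · rintro _ ⟨x, rfl⟩
    exact ⟨x * u, by simp only [mul_assoc, hu]⟩⟩

/-- An element of `eM` dividing `e` on the right lies in the `𝓡`-class of `e`. -/
def RClass.mk' {e r : M} (h1 : e * r = r) (h2 : ∃ u, r * u = e) : RClass e := ⟨r, by
  obtain ⟨u, hu⟩ := h2
  apply Set.Subset.antisymm
  · rintro _ ⟨x, rfl⟩
    exact ⟨r * x, by simp only [← mul_assoc, h1]⟩
  · rintro _ ⟨x, rfl⟩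
    exact ⟨u * x, by simp only [← mul_assoc, hu]⟩⟩

/-- The group `G_e` is the set of elements of the `𝓛`-class of `e` fixed by `e`. -/
def maximalSubgroupEquiv [Finite M] {e : M} (he : IsIdempotentElem e) :
    MaximalSubgroup he ≃ {l : LClass e // e * l.1 = l.1} where
  toFun g := ⟨LClass.mk' (l := g.val.1) g.val.mul_self
    ⟨g.inv.1, congrArg LocalMonoid.val g.inv_val⟩, g.val.self_mul⟩
  invFun l := (LocalMonoid.isUnit_of_jle (he := he) ⟨l.1.1, l.2, l.1.mul_self he⟩ (by
    obtain ⟨u, hu⟩ := l.1.exists_mul_eq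
    exact ⟨u, 1, by rw [mul_one, hu]⟩)).unit
  left_inv g := Units.ext rfl
  right_inv l := rfl

/-- The number in question is the trace of y on R L_e. An element m of eMe fixing some l in L_e has
el = l, so l belongs to G_e and m = e; and e itself fixes exactly the |G_e| elements of G_e. A
nilpotent matrix has nilpotent trace. -/
theorem isNilpotent_coeff_of_isNilpotent [Finite M] {e : M} (he : IsIdempotentElem e)
    {y : MonoidAlgebra R M} (h1 : single e 1 * y * single e 1 = y) (hy : IsNilpotent y) :
    IsNilpotent (Nat.card (MaximalSubgroup he) * y.coeff e) := by
  classical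
  have := Fintype.ofFinite M
  have := Fintype.ofFinite (LClass e)
  have hn : IsNilpotent (lift R (Matrix (LClass e) (LClass e) R) M (leftSchutzenberger R e) y) :=
    hy.map _
  have htr := Matrix.isNilpotent_trace_of_isNilpotent hn
  have hsupp : ∀ m, y.coeff m ≠ 0 → e * m = m ∧ m * e = m := by
    intro m hm
    rw [← h1, coeff_single_mul_single] at hm
    obtain ⟨n, -, hn⟩ := Finset.exists_ne_zero_of_sum_ne_zero hm
    have hn' : e * n * e = m := by
      by_contra h
      exact hn (if_neg h)
    exact ⟨by rw [← hn', ← mul_assoc, ← mul_assoc, he.eq], by rw [← hn', mul_assoc, he.eq]⟩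
  convert htr using 1
  rw [eq_sum_smul_single y]
  simp only [map_sum, map_smul, lift_single, one_smul, Matrix.trace_sum, Matrix.trace_smul,
    smul_eq_mul]
  rw [← eq_sum_smul_single y, Finset.sum_eq_single e]
  · rw [mul_comm]
    congr 1
    simp only [leftSchutzenberger, MonoidHom.coe_mk, OneHom.coe_mk, Matrix.trace, Matrix.diag,
      Matrix.of_apply, Finset.sum_boole, Nat.card_congr (maximalSubgroupEquiv he),
      Nat.card_eq_fintype_card, Fintype.card_subtype]
  · intro m _ hm
    by_cases hy0 : y.coeff m = 0
    · rw [hy0, zero_mul]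
    obtain ⟨hem, hme⟩ := hsupp m hy0
    have : (leftSchutzenberger R e m).trace = 0 := by
      refine Finset.sum_eq_zero fun l _ => ?_
      simp only [leftSchutzenberger, MonoidHom.coe_mk, OneHom.coe_mk, Matrix.diag, Matrix.of_apply]
      refine if_neg fun hl => hm ?_
      have hel : e * l.1 = l.1 := by rw [← hl, ← mul_assoc, hem]
      obtain ⟨g, hg⟩ := (maximalSubgroupEquiv he).surjective ⟨l, hel⟩
      have hg' : g.val.1 = l.1 := congrArg (fun x => x.1.1) hg
      have hgi : g.val.1 * g.inv.1 = e := congrArg LocalMonoid.val g.val_inv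
      calc m = m * (g.val.1 * g.inv.1) := by rw [hgi, hme]
        _ = e := by rw [hg', ← mul_assoc, hl, ← hg', hgi]
    rw [this, mul_zero]
  · simp

/-- If the orders of the maximal subgroups are invertible, then the radical is the sandwich
ideal. -/
theorem jacobson_eq_sandwichIdeal (K M : Type*) [Field K] [Monoid M] [Finite M]
    (hG : ∀ (e : M) (he : IsIdempotentElem e), (Nat.card (MaximalSubgroup he) : K) ≠ 0) :
    Ring.jacobson (MonoidAlgebra K M) = sandwichIdeal K M := by
  apply le_antisymm
  · intro x hx
    rw [mem_sandwichIdeal]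
    intro e he a b ha hb
    -- The element axb is nilpotent, being in the radical, and it lies in the corner at e because ea
    -- = a and be = b.
    have hy : single a 1 * x * single b 1 ∈ Ring.jacobson (MonoidAlgebra K M) :=
      Ideal.mul_mem_right _ _ (Ideal.mul_mem_left _ _ hx)
    have := isNilpotent_coeff_of_isNilpotent he (y := single a 1 * x * single b 1) (by
      have h1 : (single a 1 : MonoidAlgebra K M) = single e 1 * single a 1 := by
        rw [single_mul_single, ha, one_mul]
      have h2 : (single b 1 : MonoidAlgebra K M) = single b 1 * single e 1 := by
        rw [single_mul_single, hb, one_mul]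
      conv_rhs => rw [h1, h2]
      simp only [mul_assoc]) (isNilpotent_of_mem_jacobson K hy)
    exact (mul_eq_zero.1 this.eq_zero).resolve_left (hG e he)
  · obtain ⟨n, hn⟩ := exists_sandwichIdeal_pow_eq_bot K M
    exact le_jacobson_of_forall_isNilpotent fun x hx => isNilpotent_of_mem_of_pow_eq_bot hn hx

end SandwichIdeal

/-! ### Saturated sublattices -/

/-- A sublattice whose saturation is killed by `s` modulo the sublattice is, up to `s`, the image
of a projection. -/
theorem exists_projection_onto_saturation {Y : Type*} [AddCommGroup Y] [Module.Finite ℤ Y]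
    (W : Submodule ℤ Y) (s : ℕ)
    (hs : ∀ (n : ℤ) (y : Y), n ≠ 0 → n • y ∈ W → s • y ∈ W) :
    ∃ P : Y →ₗ[ℤ] Y, (∀ y, s • P y ∈ W) ∧ ∀ y ∈ W, P y = y := by
  let q : Y →ₗ[ℤ] (Y ⧸ W) ⧸ Submodule.torsion ℤ (Y ⧸ W) :=
    (Submodule.torsion ℤ (Y ⧸ W)).mkQ ∘ₗ W.mkQ
  have hq : Function.Surjective q :=
    (Submodule.mkQ_surjective _).comp (Submodule.mkQ_surjective _)
  -- The quotient by the saturation of W is finitely generated and torsion-free over ℤ, hence free,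
  -- so q splits and 1 - σq projects onto the saturation.
  obtain ⟨σ, hσ⟩ := Module.projective_lifting_property q LinearMap.id hq
  refine ⟨LinearMap.id - σ ∘ₗ q, fun y => ?_, fun y hy => ?_⟩
  · have h0 : q ((LinearMap.id - σ ∘ₗ q : Y →ₗ[ℤ] Y) y) = 0 := by
      have := LinearMap.congr_fun hσ (q y)
      simp only [LinearMap.comp_apply, LinearMap.id_apply] at this
      simp only [LinearMap.sub_apply, LinearMap.id_apply, LinearMap.comp_apply, map_sub, this,
        sub_self]
    generalize (LinearMap.id - σ ∘ₗ q : Y →ₗ[ℤ] Y) y = z at h0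
    have h1 : W.mkQ z ∈ Submodule.torsion ℤ (Y ⧸ W) := by
      simpa [q] using h0
    obtain ⟨n, hn⟩ := (Submodule.mem_torsion_iff _).1 h1
    refine hs n z (nonZeroDivisors.coe_ne_zero n) ?_
    rw [← Submodule.Quotient.mk_eq_zero]
    exact hn
  · have : q y = 0 := by
      have h1 : W.mkQ y = 0 := by simpa using hy
      simp [q, h1]
    simp [this]

/-! ### Generalized inverses of sandwich matrices -/

section Sandwich

open MonoidAlgebra

variable {M : Type*} [Monoid M]

theorem pairing_smul {e : M} (he : IsIdempotentElem e) (g : MaximalSubgroup he) (r : RClass e)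
    (l : LClass e) : pairing he (g • r) l = g * pairing he r l :=
  LocalMonoid.ext (mul_assoc g.val.1 r.1 l.1)

/-- The equivariant map `R_e → ℤG_e` whose coefficient at the identity is `v`. -/
def dualEntry {e : M} (he : IsIdempotentElem e) [Fintype (MaximalSubgroup he)]
    (v : RClass e → ℤ) (r : RClass e) : MonoidAlgebra ℤ (MaximalSubgroup he) :=
  ∑ g, single g (v (g⁻¹ • r))

theorem dualEntry_smul {e : M} (he : IsIdempotentElem e) [Fintype (MaximalSubgroup he)]
    (v : RClass e → ℤ) (g : MaximalSubgroup he) (r : RClass e) :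
    dualEntry he v (g • r) = single g 1 * dualEntry he v r := by
  rw [dualEntry, dualEntry, Finset.mul_sum]
  refine (Fintype.sum_equiv (Equiv.mulLeft g) _ _ fun h => ?_).symm
  rw [single_mul_single, one_mul, Equiv.coe_mulLeft, mul_inv_rev, mul_smul, inv_smul_smul]

theorem coeff_dualEntry {e : M} (he : IsIdempotentElem e) [Fintype (MaximalSubgroup he)]
    (v : RClass e → ℤ) (r : RClass e) (g : MaximalSubgroup he) :
    (dualEntry he v r).coeff g = v (g⁻¹ • r) := by
  classical
  rw [dualEntry, coeff_sum, Finsupp.finsetSum_apply, Finset.sum_eq_single g]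
  · simp
  · intro h _ hh
    simp [hh.symm]
  · simp

/-- The element of `ℤR_e^∨` given by an integer valued function on `R_e`. -/
def dualOfFunction {e : M} (he : IsIdempotentElem e) [Fintype (MaximalSubgroup he)]
    (v : RClass e → ℤ) : ZRDual he where
  toFun x := Finsupp.linearCombination ℤ (dualEntry he v)
    ((Representation.ofMulAction ℤ (MaximalSubgroup he) (RClass e)).asModuleEquiv x).coeff
  map_add' x y := by simp
  map_smul' a x := by
    simp only [RingHom.id_apply, smul_eq_mul, Representation.asModuleEquiv_map_smul]
    generalize (Representation.ofMulAction ℤ (MaximalSubgroup he) (RClass e)).asModuleEquiv x = y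
    induction a using MonoidAlgebra.induction_linear with
    | zero => simp
    | add a b ha hb => simp only [map_add, LinearMap.add_apply, MonoidAlgebra.coeff_add, ha, hb,
        add_mul]
    | single g c =>
      induction y using MonoidAlgebra.induction_linear with
      | zero => simp
      | add a b ha hb => simp only [map_add, MonoidAlgebra.coeff_add, ha, hb, mul_add]
      | single r d =>
        rw [Representation.asAlgebraHom_single, LinearMap.smul_apply,
          Representation.ofMulAction_single, MonoidAlgebra.coeff_smul, map_smul,
          MonoidAlgebra.coeff_single, MonoidAlgebra.coeff_single,
          Finsupp.linearCombination_single, Finsupp.linearCombination_single, dualEntry_smul,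
          mul_smul_comm, smul_comm, ← smul_mul_assoc, MonoidAlgebra.smul_single, smul_eq_mul,
          mul_one]

/-- The integer valued function on `R_e` given by an element of `ℤR_e^∨`. -/
def functionOfDual {e : M} (he : IsIdempotentElem e) : ZRDual he →ₗ[ℤ] (RClass e → ℤ) :=
  AddMonoidHom.toIntLinearMap
    { toFun := fun f r => (f ((Representation.ofMulAction ℤ (MaximalSubgroup he)
        (RClass e)).asModuleEquiv.symm (single r 1))).coeff 1
      map_zero' := by ext r; simp
      map_add' := fun f g => by ext r; simp }

theorem functionOfDual_dualOfFunction {e : M} (he : IsIdempotentElem e)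
    [Fintype (MaximalSubgroup he)] (v : RClass e → ℤ) :
    functionOfDual he (dualOfFunction he v) = v := by
  ext r
  simp [functionOfDual, dualOfFunction, coeff_dualEntry]

/-- Equivariance recovers the coefficient of f(r) at g as the coefficient of f(g⁻¹r) at 1. So ℤR_e^∨
is identified with integer functions on R_e, and modules over ℤG_e can be replaced by lattices. -/
theorem dualOfFunction_functionOfDual {e : M} (he : IsIdempotentElem e)
    [Fintype (MaximalSubgroup he)] (f : ZRDual he) :
    dualOfFunction he (functionOfDual he f) = f := by
  let ρ := Representation.ofMulAction ℤ (MaximalSubgroup he) (RClass e)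
  suffices h : ∀ y : MonoidAlgebra ℤ (RClass e),
      dualOfFunction he (functionOfDual he f) (ρ.asModuleEquiv.symm y) =
        f (ρ.asModuleEquiv.symm y) from
    LinearMap.ext fun x => by simpa using h (ρ.asModuleEquiv x)
  intro y
  induction y using MonoidAlgebra.induction_linear with
  | zero => simp
  | add a b ha hb => simp only [map_add, ha, hb]
  | single r c =>
    have hc : (single r c : MonoidAlgebra ℤ (RClass e)) = c • single r 1 := by simp
    rw [hc, map_smul, map_zsmul, map_zsmul]
    congr 1
    ext g
    have hg : ρ.asModuleEquiv.symm (single (g⁻¹ • r) 1) =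
        (single g⁻¹ 1 : MonoidAlgebra ℤ (MaximalSubgroup he)) • ρ.asModuleEquiv.symm
          (single r 1) := by
      apply ρ.asModuleEquiv.injective
      rw [Representation.asModuleEquiv_map_smul]
      simp [ρ]
    have h1 : (dualOfFunction he (functionOfDual he f) (ρ.asModuleEquiv.symm (single r 1))) =
        dualEntry he (functionOfDual he f) r := by
      simp [dualOfFunction, ρ]
    rw [h1, coeff_dualEntry]
    change (f (ρ.asModuleEquiv.symm (single (g⁻¹ • r) 1))).coeff 1 = _
    rw [hg, map_smul, smul_eq_mul, coeff_single_mul_apply]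
    simp

/-- In these coordinates φ_e is the 0/1 matrix recording whether rℓ = e. -/
theorem functionOfDual_sandwichFunctional {e : M} (he : IsIdempotentElem e) [DecidableEq M]
    (l : LClass e) (r : RClass e) :
    functionOfDual he (sandwichFunctional he l) r = if r.1 * l.1 = e then 1 else 0 := by
  have h1 : functionOfDual he (sandwichFunctional he l) r = (sandwichEntry he l r).coeff 1 := by
    simp [functionOfDual, sandwichFunctional]
  rw [h1, sandwichEntry]
  split_ifs with h h' h'
  · have : h.unit = 1 := Units.ext (LocalMonoid.ext h')
    rw [this, coeff_single, Finsupp.single_eq_same]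
  · have : h.unit ≠ 1 := fun h'' => h' (congrArg (fun g => g.val.1) h'')
    rw [coeff_single, Finsupp.single_eq_of_ne (Ne.symm this)]
  · exact absurd (by
      have : pairing he r l = 1 := LocalMonoid.ext h'
      rw [this]; exact isUnit_one) h
  · simp

/-- Up to the order of the torsion of the cokernel, the sandwich matrix has a generalized
inverse. -/
theorem exists_sandwich_inverse [Finite M] {e : M} (he : IsIdempotentElem e) [DecidableEq M]
    [Fintype (LClass e)] [Fintype (RClass e)] :
    ∃ c : LClass e → RClass e → ℤ, ∀ (r : RClass e) (l : LClass e),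
      (∑ l' : LClass e, ∑ r' : RClass e, (if r.1 * l'.1 = e then (1 : ℤ) else 0) * c l' r' *
        (if r'.1 * l.1 = e then 1 else 0)) =
      (Nat.card (AddCommGroup.torsion (ZRDual he ⧸ LinearMap.range (sandwichMap he))) : ℤ) *
        if r.1 * l.1 = e then 1 else 0 := by
  classical
  have := Fintype.ofFinite (MaximalSubgroup he)
  set s := Nat.card (AddCommGroup.torsion (ZRDual he ⧸ LinearMap.range (sandwichMap he)))
  let b : (LClass e →₀ ℤ) →ₗ[ℤ] (RClass e → ℤ) := functionOfDual he ∘ₗ sandwichMap he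
  have hb : ∀ l r, b (Finsupp.single l 1) r = if r.1 * l.1 = e then 1 else 0 := by
    intro l r
    simp only [b, LinearMap.comp_apply, sandwichMap, Finsupp.linearCombination_single, one_smul]
    exact functionOfDual_sandwichFunctional he l r
  have hs : ∀ (n : ℤ) (y : RClass e → ℤ), n ≠ 0 → n • y ∈ LinearMap.range b →
      s • y ∈ LinearMap.range b := by
    rintro n y hn ⟨x, hx⟩
    have h1 : n • dualOfFunction he y = sandwichMap he x := by
      rw [← dualOfFunction_functionOfDual he (n • dualOfFunction he y),
        ← dualOfFunction_functionOfDual he (sandwichMap he x), map_smul,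
        functionOfDual_dualOfFunction]
      exact congrArg _ hx.symm
    have h2 : (Submodule.Quotient.mk (dualOfFunction he y) :
        ZRDual he ⧸ LinearMap.range (sandwichMap he)) ∈ AddCommGroup.torsion _ := by
      rw [← Submodule.torsion_int]
      refine (Submodule.mem_torsion_iff _).2 ⟨⟨n, mem_nonZeroDivisors_of_ne_zero hn⟩, ?_⟩
      change n • (Submodule.Quotient.mk (dualOfFunction he y) :
        ZRDual he ⧸ LinearMap.range (sandwichMap he)) = 0
      rw [← Submodule.Quotient.mk_smul, h1, Submodule.Quotient.mk_eq_zero]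
      exact ⟨x, rfl⟩
    have h3 : s • (Submodule.Quotient.mk (dualOfFunction he y) :
        ZRDual he ⧸ LinearMap.range (sandwichMap he)) = 0 := by
      have := card_nsmul_eq_zero' (x := (⟨_, h2⟩ :
        AddCommGroup.torsion (ZRDual he ⧸ LinearMap.range (sandwichMap he))))
      exact congrArg Subtype.val this
    rw [← Submodule.Quotient.mk_smul, Submodule.Quotient.mk_eq_zero] at h3
    obtain ⟨x', hx'⟩ := h3
    refine ⟨x', ?_⟩
    rw [LinearMap.comp_apply, hx', map_nsmul, functionOfDual_dualOfFunction]
  -- The torsion order s pushes the saturation of the image of b into the image. Hence sP factors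
  -- through b as bD, and since P is the identity on the image, bDb = sb: the matrix of D is the
  -- generalized inverse.
  obtain ⟨P, hP1, hP2⟩ := exists_projection_onto_saturation (LinearMap.range b) s hs
  obtain ⟨D, hD⟩ := Module.projective_lifting_property b.rangeRestrict
    ((s • P).codRestrict (LinearMap.range b) hP1) b.surjective_rangeRestrict
  refine ⟨fun l r => D (Pi.single r 1) l, fun r l => ?_⟩
  have h1 : b (D (b (Finsupp.single l 1))) = s • b (Finsupp.single l 1) := by
    have := congrArg Subtype.val (LinearMap.congr_fun hD (b (Finsupp.single l 1)))
    simp only [LinearMap.comp_apply, LinearMap.codRestrict_apply] at this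
    refine Eq.trans this ?_
    rw [ LinearMap.smul_apply, hP2 _ ⟨_, rfl⟩]
  have h2 : ∀ v : LClass e →₀ ℤ, b v r = ∑ l', (if r.1 * l'.1 = e then (1 : ℤ) else 0) * v l' := by
    intro v
    have : v = ∑ l', v l' • Finsupp.single l' (1 : ℤ) := by
      ext l'; simp
    conv_lhs => rw [this]
    simp only [map_sum, map_smul, Finset.sum_apply, Pi.smul_apply, hb, smul_eq_mul, mul_comm]
  have h3 : ∀ (v : RClass e → ℤ) l', D v l' = ∑ r', D (Pi.single r' 1) l' * v r' := by
    intro v l'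
    have : v = ∑ r', v r' • Pi.single r' (1 : ℤ) := by
      ext r'; simp [Finset.sum_apply, Pi.single_apply]
    conv_lhs => rw [this]
    simp only [map_sum, map_smul, Finsupp.finsetSum_apply, Finsupp.smul_apply, smul_eq_mul,
      mul_comm]
  have h4 := congrFun h1 r
  rw [h2, Pi.smul_apply, hb, nsmul_eq_mul] at h4
  rw [← h4]
  refine Finset.sum_congr rfl fun l' _ => ?_
  rw [h3, Finset.mul_sum]
  refine Finset.sum_congr rfl fun r' _ => ?_
  rw [hb, mul_assoc]

end Sandwich

/-! ### Local identities from generalized inverses. -/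

section LocalIdentity

open MonoidAlgebra

/-- The only possible nonzero term is h = α, with β = h⁻¹. This splits the condition (al)(rb) = e
into a condition on l and one on r, which is the shape needed to apply the matrix identity of
`exists_sandwich_inverse`. -/
theorem sum_units_ite_mul_ite {N S : Type*} [Monoid N] [IsDedekindFiniteMonoid N] [Fintype Nˣ]
    [DecidableEq N] [CommRing S] (α β : N) :
    (∑ h : Nˣ, (if (↑h⁻¹ : N) * α = 1 then (1 : S) else 0) * (if β * h = 1 then 1 else 0)) =
      if α * β = 1 then 1 else 0 := by
  split_ifs with hab
  · have hba : β * α = 1 := mul_eq_one_symm hab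
    let g : Nˣ := ⟨α, β, hab, hba⟩
    rw [Finset.sum_eq_single g]
    · have h1 : (↑g⁻¹ : N) * α = 1 := hba
      have h2 : β * (g : N) = 1 := hba
      rw [if_pos h1, if_pos h2, mul_one]
    · intro h _ hg
      rw [if_neg, zero_mul]
      intro h1
      apply hg
      ext
      have h2 : α = h := by
        calc α = h * (↑h⁻¹ * α) := by rw [← mul_assoc, Units.mul_inv, one_mul]
          _ = h := by rw [h1, mul_one]
      exact h2.symm
    · simp
  · refine Finset.sum_eq_zero fun h _ => ?_
    split_ifs with h1 h2
    · exfalso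
      apply hab
      have h3 : α = h := by
        calc α = h * (↑h⁻¹ * α) := by rw [← mul_assoc, Units.mul_inv, one_mul]
          _ = h := by rw [h1, mul_one]
      rw [h3]
      exact mul_eq_one_symm h2
    all_goals simp

variable {R M : Type*} [CommRing R] [Monoid M]

/-- `G_e` acts on the right of `L_e`. -/
def LClass.mulUnit {e : M} {he : IsIdempotentElem e} (l : LClass e) (g : MaximalSubgroup he) :
    LClass e :=
  LClass.mk' (l := l.1 * g.val.1) (by rw [mul_assoc, g.val.mul_self]) (by
    obtain ⟨u, hu⟩ := l.exists_mul_eq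
    refine ⟨g.inv.1 * u, ?_⟩
    rw [mul_assoc, ← mul_assoc u, hu, g.val.self_mul]
    exact congrArg LocalMonoid.val g.inv_val)

theorem pairing_mulUnit {e : M} (he : IsIdempotentElem e) (g : MaximalSubgroup he) (r : RClass e)
    (l : LClass e) : pairing he r (l.mulUnit g) = pairing he r l * g :=
  LocalMonoid.ext (mul_assoc r.1 l.1 g.val.1).symm

theorem pairing_eq_one_iff {e : M} (he : IsIdempotentElem e) (r : RClass e) (l : LClass e) :
    pairing he r l = 1 ↔ r.1 * l.1 = e := LocalMonoid.ext_iff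

/-- An element of the ideal of `e` acting as the identity through the sandwich form at `e`. -/
theorem exists_local_identity [Finite M] [DecidableEq M] {e : M} (he : IsIdempotentElem e)
    (hG : IsUnit (Nat.card (MaximalSubgroup he) : R))
    (hT : IsUnit (Nat.card (AddCommGroup.torsion
      (ZRDual he ⧸ LinearMap.range (sandwichMap he))) : R)) :
    ∃ d ∈ Submodule.span R {x : MonoidAlgebra R M | ∃ l r, l * e = l ∧ e * r = r ∧
        x = single (l * r) 1}, ∀ a b, e * a = a → b * e = b →
      (single a 1 * d * single b 1 : MonoidAlgebra R M).coeff e = if a * b = e then 1 else 0 := by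
  classical
  have := Fintype.ofFinite (MaximalSubgroup he)
  have := Fintype.ofFinite (LClass e)
  have := Fintype.ofFinite (RClass e)
  obtain ⟨c, hc⟩ := exists_sandwich_inverse he
  obtain ⟨u, hu⟩ := (hG.mul hT).exists_left_inv
  -- The scalar u inverts |G_e| times the torsion order: the torsion order comes from the
  -- generalized inverse, and |G_e| from repeating its identity once for each unit h.
  refine ⟨∑ l : LClass e, ∑ r : RClass e, (u * c l r) • single (l.1 * r.1) 1, ?_, ?_⟩
  · refine Submodule.sum_mem _ fun l _ => Submodule.sum_mem _ fun r _ =>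
      Submodule.smul_mem _ _ (Submodule.subset_span ⟨l.1, r.1, l.mul_self he, r.self_mul he, rfl⟩)
  intro a b ha hb
  have hexp : (single a 1 * (∑ l : LClass e, ∑ r : RClass e, (u * c l r) • single (l.1 * r.1) 1) *
      single b 1 : MonoidAlgebra R M).coeff e = ∑ l : LClass e, ∑ r : RClass e,
        u * c l r * if a * l.1 * (r.1 * b) = e then 1 else 0 := by
    simp only [Finset.mul_sum, Finset.sum_mul, coeff_sum, Finsupp.finsetSum_apply, mul_smul_comm,
      smul_mul_assoc, single_mul_single, coeff_smul, Finsupp.smul_apply, coeff_single,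
      Finsupp.single_apply, smul_eq_mul, mul_one, mul_assoc]
  rw [hexp]
  -- Unless a lies in R_e and b in L_e, no product a·n·b equals e and both sides vanish.
  by_cases hab : (∃ v, a * v = e) ∧ ∃ v, v * b = e
  swap
  · rw [if_neg fun h => hab ⟨⟨b, h⟩, ⟨a, h⟩⟩]
    refine Finset.sum_eq_zero fun l _ => Finset.sum_eq_zero fun r _ => ?_
    rw [if_neg fun h => hab ⟨⟨l.1 * (r.1 * b), by rw [← mul_assoc, h]⟩,
      ⟨a * l.1 * r.1, by rw [mul_assoc (a * l.1), h]⟩⟩, mul_zero]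
  obtain ⟨hav, hbv⟩ := hab
  let a' : RClass e := RClass.mk' ha hav
  let b' : LClass e := LClass.mk' hb hbv
  have hsum : ∀ (l : LClass e) (r : RClass e), (if a * l.1 * (r.1 * b) = e then (1 : R) else 0) =
      ∑ h : MaximalSubgroup he, (if (h⁻¹ • a').1 * l.1 = e then (1 : R) else 0) *
        (if r.1 * (b'.mulUnit h).1 = e then 1 else 0) := by
    intro l r
    have h1 : (a * l.1 * (r.1 * b) = e) ↔ pairing he a' l * pairing he r b' = 1 :=
      (LocalMonoid.ext_iff (x := pairing he a' l * pairing he r b') (y := 1)).symm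
    rw [if_congr h1 rfl rfl, ← sum_units_ite_mul_ite]
    refine Finset.sum_congr rfl fun h _ => ?_
    congr 1
    · refine if_congr ?_ rfl rfl
      rw [← pairing_eq_one_iff he, pairing_smul]
    · refine if_congr ?_ rfl rfl
      rw [← pairing_eq_one_iff he, pairing_mulUnit]
  have hc' : ∀ h : MaximalSubgroup he, (∑ l : LClass e, ∑ r : RClass e,
      (if (h⁻¹ • a').1 * l.1 = e then (1 : R) else 0) * c l r *
        (if r.1 * (b'.mulUnit h).1 = e then 1 else 0)) =
      (Nat.card (AddCommGroup.torsion (ZRDual he ⧸ LinearMap.range (sandwichMap he))) : R) *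
        if a * b = e then 1 else 0 := by
    intro h
    have h1 := congrArg (Int.cast : ℤ → R) (hc (h⁻¹ • a') (b'.mulUnit h))
    push_cast at h1
    refine h1.trans ?_
    congr 1
    refine if_congr ?_ rfl rfl
    rw [← pairing_eq_one_iff he, pairing_smul, pairing_mulUnit]
    have h2 : a * b = e ↔ pairing he a' b' = 1 :=
      (pairing_eq_one_iff he a' b').symm
    rw [h2]
    constructor
    · intro h3
      calc pairing he a' b' = h * (↑h⁻¹ * (pairing he a' b' * h)) * ↑h⁻¹ := by
            rw [Units.mul_inv_cancel_left, Units.mul_inv_cancel_right]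
        _ = 1 := by rw [h3, mul_one, Units.mul_inv]
    · intro h3
      rw [h3, one_mul, Units.inv_mul]
  calc ∑ l : LClass e, ∑ r : RClass e, u * c l r * (if a * l.1 * (r.1 * b) = e then (1 : R) else 0)
      = u * ∑ h : MaximalSubgroup he, ∑ l : LClass e, ∑ r : RClass e,
        (if (h⁻¹ • a').1 * l.1 = e then (1 : R) else 0) * c l r *
          (if r.1 * (b'.mulUnit h).1 = e then 1 else 0) := by
        simp only [hsum, Finset.mul_sum]
        symm
        rw [Finset.sum_comm]
        refine Finset.sum_congr rfl fun l _ => ?_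
        rw [Finset.sum_comm]
        refine Finset.sum_congr rfl fun r _ => Finset.sum_congr rfl fun h _ => ?_
        ring
    _ = if a * b = e then 1 else 0 := by
        simp only [hc', Finset.sum_const, Finset.card_univ, nsmul_eq_mul, ← mul_assoc]
        rw [← Nat.card_eq_fintype_card, mul_assoc u, hu, one_mul]

end LocalIdentity

/-! ### Lifting elements of the sandwich ideal modulo an ideal of coefficients. -/

section Lifting

open MonoidAlgebra

variable {R M : Type*} [CommRing R] [Monoid M]

theorem mem_sandwichIdealAt_of_coeff_eq_zero [Finite M] {f : M} {x : MonoidAlgebra R M}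
    (h : ∀ m, JLE f m → x.coeff m = 0) : x ∈ sandwichIdealAt R f := by
  classical
  have := Fintype.ofFinite M
  intro a b _ _
  rw [coeff_single_mul_single]
  refine Finset.sum_eq_zero fun m _ => ?_
  split_ifs with hm
  · exact h m ⟨a, b, hm⟩
  · rfl

/-- The conditions at e and at f are exchanged by translating with u and v, where uv = f and vu = e;
only the 𝓙-class of the idempotent matters. -/
theorem mem_sandwichIdealAt_of_jle [Finite M] {e f : M} (he : IsIdempotentElem e)
    (hf : IsIdempotentElem f) (hef : JLE e f) (hfe : JLE f e) {x : MonoidAlgebra R M}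
    (hx : x ∈ sandwichIdealAt R e) : x ∈ sandwichIdealAt R f := by
  classical
  have := Fintype.ofFinite M
  obtain ⟨u, v, huv, hvu, hfu, hvf, hue, hev⟩ := exists_mul_eq_of_jle he hf hef hfe
  intro a b ha hb
  have := hx (v * a) (b * u) (by rw [← mul_assoc, hev]) (by rw [mul_assoc, hue])
  rw [coeff_single_mul_single] at this ⊢
  refine (Finset.sum_congr rfl fun m _ => if_congr ?_ rfl rfl).trans this
  constructor
  · intro h
    calc v * a * m * (b * u) = v * (a * m * b) * u := by simp only [mul_assoc]
      _ = e := by rw [h, hvf, hvu]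
  · intro h
    calc a * m * b = (f * a) * m * (b * f) := by rw [ha, hb]
      _ = u * (v * a * m * (b * u)) * v := by rw [← huv]; simp only [mul_assoc]
      _ = f := by rw [h, hue, huv]

/-- The part of `d y d'` on the `𝓙`-class of `e` only involves the sandwich form at `e`. -/
theorem coeff_mul_mul_mem [Finite M] {e : M} (he : IsIdempotentElem e) (𝔭 : Ideal R)
    {y : MonoidAlgebra R M} (hy : ∀ a b, e * a = a → b * e = b →
      (single a 1 * y * single b 1 : MonoidAlgebra R M).coeff e ∈ 𝔭)
    {d d' : MonoidAlgebra R M}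
    (hd : d ∈ Submodule.span R {x : MonoidAlgebra R M | ∃ l r, l * e = l ∧ e * r = r ∧
        x = single (l * r) 1})
    (hd' : d' ∈ Submodule.span R {x : MonoidAlgebra R M | ∃ l r, l * e = l ∧ e * r = r ∧
        x = single (l * r) 1}) {j : M} (hj : JLE e j) : (d * y * d').coeff j ∈ 𝔭 := by
  classical
  have := Fintype.ofFinite M
  induction hd using Submodule.span_induction with
  | zero => simp
  | add d₁ d₂ _ _ h₁ h₂ =>
    rw [add_mul, add_mul, coeff_add, Finsupp.add_apply]
    exact add_mem h₁ h₂
  | smul c d₁ _ h₁ =>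
    rw [smul_mul_assoc, smul_mul_assoc, coeff_smul, Finsupp.smul_apply]
    exact Ideal.mul_mem_left _ _ h₁
  | mem d hd =>
  induction hd' using Submodule.span_induction with
  | zero => simp
  | add d₁ d₂ _ _ h₁ h₂ =>
    rw [mul_add, coeff_add, Finsupp.add_apply]
    exact add_mem h₁ h₂
  | smul c d₁ _ h₁ =>
    rw [mul_smul_comm, coeff_smul, Finsupp.smul_apply]
    exact Ideal.mul_mem_left _ _ h₁
  | mem d' hd' =>
  obtain ⟨l, r, hl, hr, rfl⟩ := hd
  obtain ⟨l', r', hl', hr', rfl⟩ := hd'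
  have hre : (single (l * r) 1 * y * single (l' * r') 1 : MonoidAlgebra R M) =
      single l 1 * (single r 1 * y * single l' 1) * single r' 1 := by
    rw [← one_mul (1 : R), ← single_mul_single, ← single_mul_single]
    simp only [mul_assoc, one_mul]
  rw [hre, coeff_single_mul_single]
  refine sum_mem fun m _ => ?_
  split_ifs with hm
  swap
  · exact zero_mem _
  -- Only m in eMe can occur in r y l'. Such an m generates an ideal containing e, so it is some g
  -- in G_e, and multiplying by g⁻¹ moves the coefficient from m to e.
  by_cases hmem : e * m = m ∧ m * e = m
  · let m' : LocalMonoid he := ⟨m, hmem.1, hmem.2⟩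
    have hu : IsUnit m' := LocalMonoid.isUnit_of_jle _ (hj.trans ⟨l, r', hm⟩)
    obtain ⟨g, hg⟩ := hu
    have hgm : g.val.1 = m := congrArg LocalMonoid.val hg
    have hgi : g.inv.1 * g.val.1 = e := congrArg LocalMonoid.val g.inv_val
    have hig : g.val.1 * g.inv.1 = e := congrArg LocalMonoid.val g.val_inv
    have := hy (g.inv.1 * r) l' (by rw [← mul_assoc, g.inv.self_mul]) hl'
    rw [coeff_single_mul_single] at this ⊢
    convert this using 3 with n
    refine ⟨fun h => ?_, fun h => ?_⟩
    · rw [mul_assoc, mul_assoc, ← mul_assoc r, h, ← hgm, hgi]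
    · calc r * n * l' = e * r * n * l' := by rw [hr]
        _ = g.val.1 * (g.inv.1 * r * n * l') := by
          simp only [← mul_assoc]
          rw [hig]
        _ = m := by rw [h, g.val.mul_self, hgm]
  · suffices h : (single r 1 * y * single l' 1 : MonoidAlgebra R M).coeff m = 0 by
      rw [h]; exact zero_mem _
    rw [coeff_single_mul_single]
    refine Finset.sum_eq_zero fun n _ => if_neg fun h => hmem ⟨?_, ?_⟩
    · rw [← h, ← mul_assoc, ← mul_assoc, hr]
    · rw [← h, mul_assoc, hl']

theorem coeff_mul_mul_eq_zero_of_not_jle [Finite M] {e : M} {d : MonoidAlgebra R M}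
    (hd : d ∈ Submodule.span R {x : MonoidAlgebra R M | ∃ l r, l * e = l ∧ e * r = r ∧
        x = single (l * r) 1}) (y : MonoidAlgebra R M) {m : M} (hm : ¬ JLE m e) :
    (d * y * d).coeff m = 0 := by
  classical
  have := Fintype.ofFinite M
  have hsupp : ∀ n, ¬ JLE n e → d.coeff n = 0 := by
    intro n hn
    induction hd using Submodule.span_induction with
    | zero => simp
    | add d₁ d₂ _ _ h₁ h₂ => rw [coeff_add, Finsupp.add_apply, h₁, h₂, add_zero]
    | smul c d₁ _ h₁ => rw [coeff_smul, Finsupp.smul_apply, h₁, smul_zero]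
    | mem d hd =>
      obtain ⟨l, r, hl, -, rfl⟩ := hd
      rw [coeff_single, Finsupp.single_apply, if_neg]
      rintro rfl
      exact hn ⟨l, r, by rw [hl]⟩
  rw [coeff_mul_mul]
  refine Finset.sum_eq_zero fun n _ => Finset.sum_eq_zero fun n' _ => ?_
  by_cases hn : JLE n e
  · rw [coeff_single_mul_single, Finset.sum_eq_zero, mul_zero]
    refine fun k _ => if_neg fun h => hm (JLE.trans ⟨1, k * n', ?_⟩ hn)
    rw [one_mul, ← mul_assoc, h]
  · rw [hsupp n hn, zero_mul, zero_mul]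

/-- As far as the form at e can see, d is a left and a right identity, so dyd reproduces y there. -/
theorem sub_mem_sandwichIdealAt [Finite M] {e : M} [DecidableEq M] {d : MonoidAlgebra R M}
    (hd : ∀ a b, e * a = a → b * e = b →
      (single a 1 * d * single b 1 : MonoidAlgebra R M).coeff e = if a * b = e then 1 else 0)
    (y : MonoidAlgebra R M) : y - d * y * d ∈ sandwichIdealAt R e := by
  have h1 : ∀ y : MonoidAlgebra R M, y - d * y ∈ sandwichIdealAt R e := by
    intro y a b ha hb
    induction y using MonoidAlgebra.induction_linear with
    | zero => simp
    | add y z hy hz =>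
      have : single a 1 * (y + z - d * (y + z)) * single b 1 = single a 1 * (y - d * y) * single b 1
        + single a 1 * (z - d * z) * single b 1 := by noncomm_ring
      rw [this, coeff_add, Finsupp.add_apply, hy, hz, add_zero]
    | single m c =>
      have h2 := hd a (m * b) ha (by rw [mul_assoc, hb])
      have h3 : single a 1 * (single m c - d * single m c) * single b 1 =
          c • (single (a * (m * b)) 1 - single a 1 * d * single (m * b) 1) := by
        rw [mul_sub, sub_mul, mul_assoc, single_mul_single, single_mul_single, mul_assoc,
          mul_assoc d, single_mul_single, smul_sub, smul_single, ← mul_smul_comm, smul_single]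
        simp [mul_assoc]
      rw [h3, coeff_smul, Finsupp.smul_apply, coeff_sub, Finsupp.sub_apply, h2, coeff_single,
        Finsupp.single_apply, sub_self, smul_zero]
  have h2 : ∀ y : MonoidAlgebra R M, y - y * d ∈ sandwichIdealAt R e := by
    intro y a b ha hb
    induction y using MonoidAlgebra.induction_linear with
    | zero => simp
    | add y z hy hz =>
      have : single a 1 * (y + z - (y + z) * d) * single b 1 = single a 1 * (y - y * d) * single b 1
        + single a 1 * (z - z * d) * single b 1 := by noncomm_ring
      rw [this, coeff_add, Finsupp.add_apply, hy, hz, add_zero]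
    | single m c =>
      have h2 := hd (a * m) b (by rw [← mul_assoc, ha]) hb
      have h3 : single a 1 * (single m c - single m c * d) * single b 1 =
          c • (single (a * m * b) 1 - single (a * m) 1 * d * single b 1) := by
        rw [mul_sub, sub_mul, single_mul_single, single_mul_single, ← mul_assoc,
          single_mul_single, smul_sub, smul_single, ← smul_mul_assoc, ← smul_mul_assoc, smul_single]
        simp
      rw [h3, coeff_smul, Finsupp.smul_apply, coeff_sub, Finsupp.sub_apply, h2, coeff_single,
        Finsupp.single_apply, sub_self, smul_zero]
  have : y - d * y * d = (y - d * y) + (d * y - d * y * d) := by abel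
  rw [this]
  exact add_mem (h1 y) (h2 (d * y))

/-- If all maximal subgroups and sandwich forms are nonmodular over `R`, then an element whose
sandwich forms are zero modulo `𝔭` is congruent modulo `𝔭` to an element of the sandwich ideal. -/
theorem exists_sub_mem_sandwichIdeal [Finite M]
    (hG : ∀ (e : M) (he : IsIdempotentElem e), IsUnit (Nat.card (MaximalSubgroup he) : R))
    (hT : ∀ (e : M) (he : IsIdempotentElem e), IsUnit (Nat.card (AddCommGroup.torsion
      (ZRDual he ⧸ LinearMap.range (sandwichMap he))) : R))
    (𝔭 : Ideal R) (x : MonoidAlgebra R M)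
    (hx : ∀ e : M, IsIdempotentElem e → ∀ a b, e * a = a → b * e = b →
      (single a 1 * x * single b 1 : MonoidAlgebra R M).coeff e ∈ 𝔭) :
    ∃ z : MonoidAlgebra R M, (∀ m, z.coeff m ∈ 𝔭) ∧ x - z ∈ sandwichIdeal R M := by
  classical
  have := Fintype.ofFinite M
  have hsingle : ∀ z : MonoidAlgebra R M, (∀ m, z.coeff m ∈ 𝔭) → ∀ a b e,
      (single a 1 * z * single b 1 : MonoidAlgebra R M).coeff e ∈ 𝔭 := by
    intro z hz a b e
    rw [coeff_single_mul_single]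
    refine sum_mem fun m _ => ?_
    split_ifs
    · exact hz m
    · exact zero_mem _
  suffices H : ∀ (c : ℕ) (X : Set M), X.ncard = c → (∀ m ∈ X, ∀ n, JLE n m → n ∈ X) →
      (∃ z : MonoidAlgebra R M, (∀ m, z.coeff m ∈ 𝔭) ∧
        ∀ f, IsIdempotentElem f → f ∉ X → x - z ∈ sandwichIdealAt R f) →
      ∃ z : MonoidAlgebra R M, (∀ m, z.coeff m ∈ 𝔭) ∧ x - z ∈ sandwichIdeal R M from
    H _ Set.univ rfl (fun _ _ _ _ => Set.mem_univ _)
      ⟨0, by simp, fun f _ hf => absurd (Set.mem_univ f) hf⟩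
  intro c
  induction c using Nat.strong_induction_on with
  | _ c ih =>
  rintro X rfl hX ⟨z, hz, hzX⟩
  by_cases hE : ∃ e ∈ X, IsIdempotentElem e
  swap
  · push Not at hE
    exact ⟨z, hz, mem_sandwichIdeal.2 fun f hf => hzX f hf fun h => hE f h hf⟩
  -- Induction over 𝓙-classes from the top: X is the part not yet treated, and at each stage the
  -- class of a maximal idempotent e of X is corrected without disturbing the idempotents already
  -- done.
  obtain ⟨e, ⟨heX, he⟩, hmax⟩ := (X ∩ {e | IsIdempotentElem e}).toFinite.exists_maximalFor
    (fun a => {n | JLE n a}) _ hE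
  have hmax' : ∀ f ∈ X, IsIdempotentElem f → JLE e f → JLE f e := fun m hm hm' h =>
    hmax (j := m) ⟨hm, hm'⟩ (fun n hn => JLE.trans hn h) (JLE.refl m)
  obtain ⟨d, hd, hde⟩ := exists_local_identity (R := R) he (hG e he) (hT e he)
  set y := x - z with hy
  have hy𝔭 : ∀ a b, e * a = a → b * e = b →
      (single a 1 * y * single b 1 : MonoidAlgebra R M).coeff e ∈ 𝔭 := by
    intro a b ha hb
    rw [hy, mul_sub, sub_mul, coeff_sub, Finsupp.sub_apply]
    exact sub_mem (hx e he a b ha hb) (hsingle z hz a b e)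
  -- The correction keeps only the part of dyd on the 𝓙-class of e, where all coefficients lie in 𝔭.
  -- The discarded part lives strictly below e, where neither the form at e nor the forms at
  -- idempotents outside X can detect it.
  let w : MonoidAlgebra R M := ofCoeff ((d * y * d).coeff.filter (JLE e))
  have hw𝔭 : ∀ m, w.coeff m ∈ 𝔭 := by
    intro m
    by_cases hm : JLE e m
    · have : w.coeff m = (d * y * d).coeff m := Finsupp.filter_apply_pos _ _ hm
      rw [this]
      exact coeff_mul_mul_mem he 𝔭 hy𝔭 hd hd hm
    · have : w.coeff m = 0 := Finsupp.filter_apply_neg _ _ hm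
      rw [this]
      exact zero_mem _
  have hrest : ∀ f, (f ∉ X ∨ f = e) → d * y * d - w ∈ sandwichIdealAt R f := by
    intro f hf
    refine mem_sandwichIdealAt_of_coeff_eq_zero fun m hm => ?_
    rw [coeff_sub, Finsupp.sub_apply]
    by_cases hem : JLE e m
    · have : w.coeff m = (d * y * d).coeff m := Finsupp.filter_apply_pos _ _ hem
      rw [this, sub_self]
    · have : w.coeff m = 0 := Finsupp.filter_apply_neg _ _ hem
      rw [this, sub_zero]
      refine coeff_mul_mul_eq_zero_of_not_jle hd y fun hme => ?_
      rcases hf with hf | rfl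
      · exact hf (hX e heX f (hm.trans hme))
      · exact hem hm
  refine ih _ (Set.ncard_lt_ncard (s := X \ {m | JLE e m}) ?_ X.toFinite) _ rfl ?_
    ⟨z + w, fun m => ?_, fun f hf hfX => ?_⟩
  · exact ⟨Set.sdiff_subset, fun h => (h heX).2 (JLE.refl e)⟩
  · rintro m ⟨hm, hm'⟩ n hn
    exact ⟨hX m hm n hn, fun h => hm' (JLE.trans h hn)⟩
  · rw [coeff_add, Finsupp.add_apply]
    exact add_mem (hz m) (hw𝔭 m)
  · rw [← sub_sub, ← hy]
    by_cases hfX' : f ∈ X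
    · have hef : JLE e f := by
        by_contra h
        exact hfX ⟨hfX', h⟩
      refine mem_sandwichIdealAt_of_jle he hf hef (hmax' f hfX' hf hef) ?_
      have : y - w = (y - d * y * d) + (d * y * d - w) := by abel
      rw [this]
      exact add_mem (sub_mem_sandwichIdealAt hde y) (hrest e (Or.inr rfl))
    · have : y - w = y - d * y * d + (d * y * d - w) := by abel
      rw [this]
      exact add_mem (sub_mem (hzX f hf hfX') (Ideal.mul_mem_right _ _
        (Ideal.mul_mem_left _ _ (hzX f hf hfX')))) (hrest f (Or.inl hfX'))

end Lifting

/-! ### Extension of scalars for monoid algebras -/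

section ExtendScalars

open MonoidAlgebra

variable {R : Type*} (K : Type*) {M Y : Type*} [CommRing R] [CommRing K]
  [AddCommGroup Y] [Module R Y] [Module K Y]

/-- The `K`-linear extension of an `R`-linear map defined on `R[M]`. -/
def extendLinear (g : MonoidAlgebra R M →ₗ[R] Y) : MonoidAlgebra K M →ₗ[K] Y :=
  Finsupp.linearCombination K (fun m => g (single m 1)) ∘ₗ (coeffLinearEquiv K).toLinearMap

theorem extendLinear_single (g : MonoidAlgebra R M →ₗ[R] Y) (m : M) (c : K) :
    extendLinear K g (single m c) = c • g (single m 1) := by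
  change Finsupp.linearCombination K (fun m => g (single m 1)) (Finsupp.single m c) = _
  rw [Finsupp.linearCombination_single]

variable [Algebra R K] [Monoid M]

theorem extendLinear_map [IsScalarTower R K Y] (g : MonoidAlgebra R M →ₗ[R] Y)
    (x : MonoidAlgebra R M) :
    extendLinear K g (mapRingHom M (algebraMap R K) x) = g x := by
  induction x using MonoidAlgebra.induction_linear with
  | zero => simp
  | add x y hx hy => simp only [map_add, hx, hy]
  | single m c =>
    rw [mapRingHom_single, extendLinear_single, algebraMap_smul, ← map_smul, smul_single,
      smul_eq_mul, mul_one]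

theorem map_smul_eq_smul_map (c : R) (x : MonoidAlgebra R M) :
    mapRingHom M (algebraMap R K) (c • x) = algebraMap R K c • mapRingHom M (algebraMap R K) x := by
  ext m
  simp only [coeff_mapRingHom, coeff_smul, Finsupp.smul_apply, smul_eq_mul, map_mul]

end ExtendScalars

/-! ### The sandwich ideal over a ring of characteristic zero -/

section CharZero

open MonoidAlgebra

variable {R M : Type*} [CommRing R] [IsDomain R] [CharZero R] [Monoid M] [Finite M]

/-- The coefficients of x generate a finite free ℤ-module. Expanding x along a ℤ-basis gives
integral vectors, each of which satisfies the defining equations because these have integral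
coefficients and the basis is independent. -/
theorem sandwichIdeal_le_span {x : MonoidAlgebra R M} (hx : x ∈ sandwichIdeal R M) :
    x ∈ Submodule.span R (mapRingHom M (Int.castRingHom R) '' (sandwichIdeal ℤ M)) := by
  classical
  have := Fintype.ofFinite M
  let W : Submodule ℤ R := Submodule.span ℤ (Set.range fun m => x.coeff m)
  have : Module.Finite ℤ W := Module.Finite.span_of_finite ℤ (Set.finite_range _)
  let o := Module.Free.chooseBasis ℤ W
  let y : Module.Free.ChooseBasisIndex ℤ W → MonoidAlgebra ℤ M := fun i =>
    ofCoeff (Finsupp.equivFunOnFinite.symm fun m =>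
      o.repr ⟨x.coeff m, Submodule.subset_span ⟨m, rfl⟩⟩ i)
  have hli : LinearIndependent ℤ fun i => (o i : R) :=
    o.linearIndependent.map' W.subtype (Submodule.ker_subtype W)
  have hxy : x = ∑ i, (o i : R) • mapRingHom M (Int.castRingHom R) (y i) := by
    ext m
    rw [coeff_sum, Finsupp.finsetSum_apply]
    have h1 := congrArg Subtype.val (o.sum_repr ⟨x.coeff m, Submodule.subset_span ⟨m, rfl⟩⟩)
    simp only [Submodule.coe_sum, Submodule.coe_smul] at h1
    rw [← h1]
    refine Finset.sum_congr rfl fun i _ => ?_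
    rw [coeff_smul, Finsupp.smul_apply, coeff_mapRingHom, zsmul_eq_mul, smul_eq_mul, mul_comm]
    rfl
  rw [hxy]
  refine Submodule.sum_mem _ fun i _ => Submodule.smul_mem _ _ (Submodule.subset_span
    ⟨y i, ?_, rfl⟩)
  refine mem_sandwichIdeal.2 fun e he a b ha hb => ?_
  have h0 := mem_sandwichIdeal.1 hx e he a b ha hb
  rw [hxy] at h0
  simp only [Finset.mul_sum, Finset.sum_mul, coeff_sum, Finsupp.finsetSum_apply, mul_smul_comm,
    smul_mul_assoc, coeff_smul, Finsupp.smul_apply, map_coeff_single_mul_single] at h0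
  refine Fintype.linearIndependent_iff.1 hli
    (fun i => (single a 1 * y i * single b 1 : MonoidAlgebra ℤ M).coeff e) ?_ i
  rw [← h0]
  refine Finset.sum_congr rfl fun i _ => ?_
  rw [zsmul_eq_mul, smul_eq_mul, mul_comm]
  rfl

/-- Purity passes from ℤ to R through a projection P onto the saturation of N_ℤ². Its R-linear
extension fixes N_R², as N_R is spanned by N_ℤ. If cx is in N_R², cancelling c shows that x is fixed
too, and s times the image of P lies in N_ℤ², with s invertible in R. -/
theorem mem_sandwichIdeal_mul_of_smul_mem (s : ℕ) (hsu : IsUnit (s : R))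
    (hs : ∀ (n : ℤ) (y : MonoidAlgebra ℤ M), n ≠ 0 → y ∈ sandwichIdeal ℤ M →
      n • y ∈ sandwichIdeal ℤ M * sandwichIdeal ℤ M →
      s • y ∈ sandwichIdeal ℤ M * sandwichIdeal ℤ M)
    {c : R} (hc : c ≠ 0) {x : MonoidAlgebra R M}
    (hx : c • x ∈ sandwichIdeal R M * sandwichIdeal R M) :
    x ∈ sandwichIdeal R M * sandwichIdeal R M := by
  classical
  have := Fintype.ofFinite M
  let W : Submodule ℤ (MonoidAlgebra ℤ M) :=
    (sandwichIdeal ℤ M * sandwichIdeal ℤ M).restrictScalars ℤ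
  obtain ⟨P, hP1, hP2⟩ := exists_projection_onto_saturation W s (by
    intro n y hn hy
    refine hs n y hn (mem_sandwichIdeal.2 fun e he a b ha hb => ?_) hy
    have h1 := mem_sandwichIdeal.1 (Ideal.mul_le_left hy) e he a b ha hb
    rw [mul_smul_comm, smul_mul_assoc, coeff_smul, Finsupp.smul_apply, smul_eq_mul] at h1
    exact (mul_eq_zero.1 h1).resolve_left hn)
  let ι := mapRingHom M (algebraMap ℤ R)
  have hι : ∀ (n : ℤ) y, ι (n • y) = n • ι y := fun n y => map_zsmul ι n y
  let ιP : MonoidAlgebra ℤ M →ₗ[ℤ] MonoidAlgebra R M :=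
    { toFun := fun y => ι (P y), map_add' := by simp,
      map_smul' := fun n y => by rw [map_smul, hι]; rfl }
  let PR : MonoidAlgebra R M →ₗ[R] MonoidAlgebra R M := extendLinear R ιP
  have hPR : ∀ y, PR (ι y) = ι (P y) := fun y => extendLinear_map R ιP y
  have hfix : ∀ x ∈ sandwichIdeal R M * sandwichIdeal R M, PR x = x := by
    intro x hx
    refine Submodule.mul_induction_on hx ?_ fun u v hu hv => by rw [map_add, hu, hv]
    intro u hu v hv
    have hu' := sandwichIdeal_le_span hu
    have hv' := sandwichIdeal_le_span hv
    clear hu hv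
    induction hu' using Submodule.span_induction with
    | zero => simp
    | add u₁ u₂ _ _ h₁ h₂ => rw [add_mul, map_add, h₁, h₂]
    | smul c u _ h => rw [smul_mul_assoc, map_smul, h]
    | mem u hu =>
    induction hv' using Submodule.span_induction with
    | zero => simp
    | add u₁ u₂ _ _ h₁ h₂ => rw [mul_add, map_add, h₁, h₂]
    | smul c u _ h => rw [mul_smul_comm, map_smul, h]
    | mem v hv =>
    obtain ⟨u, hu, rfl⟩ := hu
    obtain ⟨v, hv, rfl⟩ := hv
    rw [← map_mul]
    exact (hPR (u * v)).trans (congrArg ι (hP2 _ (Ideal.mul_mem_mul hu hv)))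
  have hιmem : ∀ y ∈ sandwichIdeal ℤ M * sandwichIdeal ℤ M,
      ι y ∈ sandwichIdeal R M * sandwichIdeal R M := by
    intro y hy
    refine Submodule.mul_induction_on hy (fun u hu v hv => ?_) fun u v hu hv => by
      rw [map_add]; exact add_mem hu hv
    rw [map_mul]
    exact Ideal.mul_mem_mul (map_mem_sandwichIdeal _ hu) (map_mem_sandwichIdeal _ hv)
  have hPx : PR x = x := by
    have h1 := hfix _ hx
    rw [map_smul] at h1
    exact smul_right_injective _ hc h1
  obtain ⟨t, ht⟩ := hsu.exists_left_inv
  rw [← hPx, eq_sum_smul_single x, map_sum]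
  refine sum_mem fun m _ => ?_
  rw [map_smul]
  refine Submodule.smul_of_tower_mem _ _ ?_
  have h2 : PR (single m 1) = t • ι (s • P (single m 1)) := by
    have h3 : (single m 1 : MonoidAlgebra R M) = ι (single m 1) := by
      rw [mapRingHom_single, map_one]
    rw [h3, hPR, map_nsmul, ← Nat.cast_smul_eq_nsmul R, smul_smul, ht, one_smul]
  rw [h2]
  exact Submodule.smul_of_tower_mem _ _ (hιmem _ (hP1 _))

end CharZero

/-! ### Nonmodular primes -/

section Nonmodular

open MonoidAlgebra

/-- Over ℚ the group orders are invertible, so the radical is given by the sandwich equations, and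
these restrict verbatim to ℤ. -/
theorem integralRadical_eq_sandwichIdeal (M : Type*) [Monoid M] [Finite M] :
    integralRadical M = sandwichIdeal ℤ M := by
  have h := jacobson_eq_sandwichIdeal ℚ M (fun e he => by
    exact_mod_cast (Nat.card_pos (α := MaximalSubgroup he)).ne')
  ext x
  rw [integralRadical, h, Ideal.mem_comap]
  exact map_mem_sandwichIdeal_iff _ Int.cast_injective

/-- The witness is the order of the torsion of J/J², the case i = 1 of nonmodularity. -/
theorem exists_coprime_of_not_isModular {M : Type*} [Monoid M] [Finite M] {p : ℕ} (hp : p.Prime)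
    (hM : ¬ IsModular p M) : ∃ s : ℕ, ¬ p ∣ s ∧
      ∀ (n : ℤ) (y : MonoidAlgebra ℤ M), n ≠ 0 → y ∈ sandwichIdeal ℤ M →
      n • y ∈ sandwichIdeal ℤ M * sandwichIdeal ℤ M →
      s • y ∈ sandwichIdeal ℤ M * sandwichIdeal ℤ M := by
  rw [← integralRadical_eq_sandwichIdeal]
  by_cases hl : 1 < loewyLength (MonoidAlgebra ℚ M)
  · refine ⟨_, fun h => hM (Or.inr ⟨1, le_rfl, hl, h⟩), fun n y hn hy hny => ?_⟩
    have hpow : integralRadical M ^ (1 + 1) = integralRadical M * integralRadical M := by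
      rw [Submodule.pow_succ, Submodule.pow_one]
    have hy' : y ∈ integralRadical M ^ 1 := by rwa [Submodule.pow_one]
    set Q := ↥(integralRadical M ^ 1) ⧸
          (integralRadical M ^ (1 + 1)).submoduleOf (integralRadical M ^ 1)
    have h1 : (Submodule.Quotient.mk ⟨y, hy'⟩ : Q) ∈ AddCommGroup.torsion Q := by
      rw [← Submodule.torsion_int]
      refine (Submodule.mem_torsion_iff _).2 ⟨⟨n, mem_nonZeroDivisors_of_ne_zero hn⟩, ?_⟩
      change n • (Submodule.Quotient.mk ⟨y, hy'⟩ : Q) = 0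
      rw [← Submodule.Quotient.mk_smul, Submodule.Quotient.mk_eq_zero]
      change n • y ∈ integralRadical M ^ (1 + 1)
      rwa [hpow]
    have h2 := congrArg Subtype.val (card_nsmul_eq_zero' (x := (⟨_, h1⟩ : AddCommGroup.torsion Q)))
    have h3 : Nat.card (AddCommGroup.torsion Q) • (Submodule.Quotient.mk ⟨y, hy'⟩ : Q) = 0 := h2
    rw [← Submodule.Quotient.mk_smul, Submodule.Quotient.mk_eq_zero] at h3
    rw [← hpow]
    exact h3
  -- With Loewy length at most 1 the definition says nothing about J/J², but then the radical of ℚM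
  -- is zero and so is J.
  · refine ⟨1, hp.not_dvd_one, fun n y hn hy hny => ?_⟩
    suffices h : y = 0 by rw [h, smul_zero]; exact zero_mem _
    have h1 : Ring.jacobson (MonoidAlgebra ℚ M) ^ loewyLength (MonoidAlgebra ℚ M) = ⊥ :=
      Nat.sInf_mem (s := {n : ℕ | Ring.jacobson (MonoidAlgebra ℚ M) ^ n = ⊥})
        (exists_jacobson_pow_eq_bot ℚ _)
    have h2 : Ring.jacobson (MonoidAlgebra ℚ M) = ⊥ := by
      refine le_bot_iff.1 ?_
      calc Ring.jacobson (MonoidAlgebra ℚ M) = Ring.jacobson (MonoidAlgebra ℚ M) ^ 1 :=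
            (Submodule.pow_one _).symm
        _ ≤ Ring.jacobson (MonoidAlgebra ℚ M) ^ loewyLength (MonoidAlgebra ℚ M) :=
            Ideal.pow_le_pow_right (by omega)
        _ = ⊥ := h1
    rw [integralRadical, h2] at hy
    have h3 : mapRingHom M (Int.castRingHom ℚ) y = 0 := hy
    ext m
    have h4 := coeff_mapRingHom (Int.castRingHom ℚ) y m
    rw [h3] at h4
    simpa using h4.symm

theorem isUnit_natCast_of_not_dvd {O : Type*} [CommRing O] [IsLocalRing O] {p : ℕ}
    [CharP (IsLocalRing.ResidueField O) p] {n : ℕ} (hn : ¬ p ∣ n) : IsUnit (n : O) := by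
  rw [← IsLocalRing.residue_ne_zero_iff_isUnit, map_natCast, Ne,
    CharP.cast_eq_zero_iff (IsLocalRing.ResidueField O) p]
  exact hn

end Nonmodular

/-! ### Lifting conjugacy and primitive idempotents in split algebras -/

section Conjugacy

variable {A S : Type*} [Ring A] [Ring S]

theorem isUnit_of_map_isUnit (q : A →+* S) (hq : Function.Surjective q)
    (hu : ∀ x, q x = 1 → IsUnit x) {a : A} (ha : IsUnit (q a)) : IsUnit a := by
  obtain ⟨u, hu'⟩ := ha
  obtain ⟨b, hb⟩ := hq ↑u⁻¹
  have h1 : IsUnit (a * b) := hu _ (by rw [map_mul, hb, ← hu', Units.mul_inv])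
  have h2 : IsUnit (b * a) := hu _ (by rw [map_mul, hb, ← hu', Units.inv_mul])
  obtain ⟨c, hc⟩ := h1.exists_right_inv
  obtain ⟨d, hd⟩ := h2.exists_left_inv
  exact isUnit_iff_exists_and_exists.2 ⟨⟨b * c, by rw [← mul_assoc, hc]⟩,
    ⟨d * b, by rw [mul_assoc, hd]⟩⟩

/-- The element hg + (1 - h)(1 - g) carries g to h and maps to 1 under q when g and h have equal
images. -/
theorem isConj_of_map_eq (q : A →+* S) (hu : ∀ x, q x = 1 → IsUnit x) {g h : A}
    (hg : IsIdempotentElem g) (hh : IsIdempotentElem h) (hgh : q g = q h) : IsConj g h := by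
  have hw : IsUnit (h * g + (1 - h) * (1 - g)) := by
    refine hu _ ?_
    simp only [map_add, map_mul, map_sub, map_one, hgh]
    have : q h * q h = q h := by rw [← map_mul, hh.eq]
    noncomm_ring
    simp [this]
  obtain ⟨w, hw⟩ := hw
  refine ⟨w, ?_⟩
  rw [SemiconjBy, hw]
  have h1 : g * g = g := hg
  have h2 : h * h = h := hh
  calc (h * g + (1 - h) * (1 - g)) * g = h * (g * g) + (1 - h) * (g - g * g) := by noncomm_ring
    _ = (h * h) * g + (h - h * h) * (1 - g) := by rw [h1, h2]; noncomm_ring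
    _ = h * (h * g + (1 - h) * (1 - g)) := by noncomm_ring

theorem isConj_of_isConj_map (q : A →+* S) (hq : Function.Surjective q)
    (hu : ∀ x, q x = 1 → IsUnit x) {g h : A} (hg : IsIdempotentElem g) (hh : IsIdempotentElem h)
    (hgh : IsConj (q g) (q h)) : IsConj g h := by
  obtain ⟨c, hc⟩ := hgh
  obtain ⟨a, ha⟩ := hq c
  obtain ⟨u, hu'⟩ := isUnit_of_map_isUnit q hq hu (a := a) (by rw [ha]; exact c.isUnit)
  have h1 : IsConj g (u * g * ↑u⁻¹) := ⟨u, by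
    rw [SemiconjBy, mul_assoc, mul_assoc, Units.inv_mul, mul_one]⟩
  refine h1.trans (isConj_of_map_eq q hu ?_ hh ?_)
  · rw [IsIdempotentElem]
    calc u * g * ↑u⁻¹ * (u * g * ↑u⁻¹) = u * (g * (↑u⁻¹ * u) * g) * ↑u⁻¹ := by
          simp only [mul_assoc]
      _ = u * g * ↑u⁻¹ := by rw [Units.inv_mul, mul_one, hg.eq]
  · have h2 : q u = c := by rw [hu', ha]
    have h3 : (c : S) * q ↑u⁻¹ = 1 := by rw [← h2, ← map_mul, Units.mul_inv, map_one]
    rw [map_mul, map_mul, h2, hc.eq, mul_assoc, h3, mul_one]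

end Conjugacy

/-! ### Primitive idempotents in split algebras. -/

section Split

open Matrix

variable {K : Type*} [Field K]

/-- The matrix v ⊗ (μ - ν) has square zero, so 1 plus it is a unit, and it conjugates one projection
to the other. -/
theorem isConj_vecMulVec_of_same_left {n : Type*} [Fintype n] [DecidableEq n] {v μ ν : n → K}
    (hμ : μ ⬝ᵥ v = 1) (hν : ν ⬝ᵥ v = 1) : IsConj (vecMulVec v μ) (vecMulVec v ν) := by
  have h0 : vecMulVec v (μ - ν) * vecMulVec v (μ - ν) = 0 := by
    rw [vecMulVec_mul_vecMulVec, sub_dotProduct, hμ, hν, sub_self]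
    simp
  refine ⟨⟨1 + vecMulVec v (μ - ν), 1 - vecMulVec v (μ - ν), ?_, ?_⟩, ?_⟩
  · rw [add_mul, mul_sub, mul_sub, h0]; simp
  · rw [sub_mul, mul_add, mul_add, h0]; simp
  · rw [SemiconjBy]
    simp only [add_mul, mul_add, one_mul, mul_one, vecMulVec_mul_vecMulVec, sub_dotProduct, hμ, hν,
      sub_self, zero_smul, vecMulVec_zero, one_smul]
    rw [← vecMulVec_add]
    simp

theorem isConj_vecMulVec_of_same_right {n : Type*} [Fintype n] [DecidableEq n] {v w μ : n → K}
    (hv : μ ⬝ᵥ v = 1) (hw : μ ⬝ᵥ w = 1) : IsConj (vecMulVec v μ) (vecMulVec w μ) := by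
  have h0 : vecMulVec (w - v) μ * vecMulVec (w - v) μ = 0 := by
    rw [vecMulVec_mul_vecMulVec, dotProduct_sub, hv, hw, sub_self]
    simp
  refine ⟨⟨1 + vecMulVec (w - v) μ, 1 - vecMulVec (w - v) μ, ?_, ?_⟩, ?_⟩
  · rw [add_mul, mul_sub, mul_sub, h0]; simp
  · rw [sub_mul, mul_add, mul_add, h0]; simp
  · rw [SemiconjBy]
    simp only [add_mul, mul_add, one_mul, mul_one, vecMulVec_mul_vecMulVec, dotProduct_sub, hv, hw,
      sub_self, zero_smul, vecMulVec_zero, one_smul]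
    rw [← add_vecMulVec]
    simp

/-- Idempotent matrices of rank one are conjugate. -/
theorem isConj_vecMulVec {n : Type*} [Fintype n] [DecidableEq n] {v w μ ν : n → K}
    (hv : μ ⬝ᵥ v = 1) (hw : ν ⬝ᵥ w = 1) : IsConj (vecMulVec v μ) (vecMulVec w ν) := by
  -- A vector on which neither functional vanishes links the two projections: change the vector to a
  -- multiple of z, then the functional, then the vector again.
  obtain ⟨z, hμz, hνz⟩ : ∃ z, μ ⬝ᵥ z ≠ 0 ∧ ν ⬝ᵥ z ≠ 0 := by
    by_cases h1 : μ ⬝ᵥ w = 0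
    · by_cases h2 : ν ⬝ᵥ v = 0
      · exact ⟨v + w, by rw [dotProduct_add, hv, h1]; simp, by rw [dotProduct_add, hw, h2]; simp⟩
      · exact ⟨v, by rw [hv]; simp, h2⟩
    · exact ⟨w, h1, by rw [hw]; simp⟩
  have h1 : μ ⬝ᵥ ((μ ⬝ᵥ z)⁻¹ • z) = 1 := by
    rw [dotProduct_smul, smul_eq_mul, inv_mul_cancel₀ hμz]
  have h2 : ν ⬝ᵥ ((ν ⬝ᵥ z)⁻¹ • z) = 1 := by
    rw [dotProduct_smul, smul_eq_mul, inv_mul_cancel₀ hνz]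
  refine (isConj_vecMulVec_of_same_right hv h1).trans (IsConj.trans ?_
    (isConj_vecMulVec_of_same_right h2 hw))
  have h3 : vecMulVec ((μ ⬝ᵥ z)⁻¹ • z) μ =
      vecMulVec ((ν ⬝ᵥ z)⁻¹ • z) (((μ ⬝ᵥ z)⁻¹ * (ν ⬝ᵥ z)) • μ) := by
    rw [smul_vecMulVec, smul_vecMulVec, vecMulVec_smul, smul_smul]
    congr 1
    field_simp
  rw [h3]
  refine isConj_vecMulVec_of_same_left ?_ h2
  rw [smul_dotProduct, dotProduct_smul, smul_eq_mul, smul_eq_mul]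
  field_simp

theorem IsConj.piSingle {ι : Type*} [DecidableEq ι] {B : ι → Type*} [∀ i, Ring (B i)] (i : ι)
    {x y : B i} (h : IsConj x y) : IsConj (Pi.single i x) (Pi.single i y : ∀ i, B i) := by
  obtain ⟨c, hc⟩ := h
  refine ⟨Units.map (MonoidHom.mulSingle B i) c, ?_⟩
  rw [SemiconjBy, Units.coe_map]
  funext j
  by_cases hj : j = i
  · subst hj
    simpa using hc.eq
  · simp [hj]

/-- In a nonzero block choose v in the image of e and a functional μ fixed by e with μ(v) = 1. Then
v ⊗ μ is a nonzero idempotent below e, and primitivity forces equality. -/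
theorem exists_eq_single_vecMulVec {ι : Type*} [DecidableEq ι] {d : ι → ℕ}
    {e : (i : ι) → Matrix (Fin (d i)) (Fin (d i)) K} (he : IsPrimitiveIdempotent e) :
    ∃ (i : ι) (v μ : Fin (d i) → K), μ ⬝ᵥ v = 1 ∧ e = Pi.single i (vecMulVec v μ) := by
  obtain ⟨hidem, hne, hprim⟩ := he
  obtain ⟨i, hi⟩ : ∃ i, e i ≠ 0 := by
    by_contra! h
    exact hne (funext h)
  have hP : e i * e i = e i := congrFun hidem i
  obtain ⟨w, hw⟩ : ∃ w, e i *ᵥ w ≠ 0 := by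
    by_contra! h
    refine hi (Matrix.ext_of_mulVec_single fun j => ?_)
    rw [h, zero_mulVec]
  set v := e i *ᵥ w with hv
  have hPv : e i *ᵥ v = v := by rw [hv, mulVec_mulVec, hP]
  obtain ⟨j, hj⟩ : ∃ j, v j ≠ 0 := by
    by_contra! h
    exact hw (funext h)
  set μ := Pi.single j (v j)⁻¹ ᵥ* e i with hμ
  have hμv : μ ⬝ᵥ v = 1 := by
    rw [hμ, ← dotProduct_mulVec, hPv, single_dotProduct, inv_mul_cancel₀ hj]
  have hμP : μ ᵥ* e i = μ := by rw [hμ, vecMul_vecMul, hP]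
  let a : (i : ι) → Matrix (Fin (d i)) (Fin (d i)) K := Pi.single i (vecMulVec v μ)
  have haa : a * a = a := by
    rw [← Pi.single_mul, vecMulVec_mul_vecMulVec, hμv, one_smul]
  have hea : e * a = a := by
    funext k
    by_cases hk : k = i
    · subst hk
      simp [a, mul_vecMulVec, hPv]
    · simp [a, hk]
  have hae : a * e = a := by
    funext k
    by_cases hk : k = i
    · subst hk
      simp [a, vecMulVec_mul, hμP]
    · simp [a, hk]
  have ha0 : a ≠ 0 := by
    intro h
    have h1 : vecMulVec v μ = 0 := by simpa [a] using congrFun h i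
    have h2 := congrArg (fun X => X *ᵥ v) h1
    simp only [vecMulVec_mulVec, zero_mulVec, hμv] at h2
    exact hw (by simpa using h2)
  refine ⟨i, v, μ, hμv, ?_⟩
  have h := hprim a (e - a) haa ?_ ?_ ?_ (by abel)
  · exact sub_eq_zero.1 (h.resolve_left ha0)
  · rw [IsIdempotentElem, sub_mul, mul_sub, mul_sub, hidem.eq, hea, hae, haa]; abel
  · rw [mul_sub, hae, haa, sub_self]
  · rw [sub_mul, hea, haa, sub_self]

variable {A : Type*} [Ring A] [Algebra K A]

/-- A decomposition of q(g) lifts: the summand a lifts to an idempotent orthogonal to 1 - g, hence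
to one lying below g. -/
theorem IsPrimitiveIdempotent.map {S : Type*} [Ring S] (q : A →+* S) (hq : Function.Surjective q)
    (hn : ∀ x ∈ RingHom.ker q, IsNilpotent x) {g : A} (hg : IsPrimitiveIdempotent g) :
    IsPrimitiveIdempotent (q g) := by
  obtain ⟨hidem, hne, hprim⟩ := hg
  refine ⟨hidem.map q, fun h => hne (hidem.eq_zero_of_isNilpotent (hn g h)), ?_⟩
  intro a b ha hb hab hba hsum
  have hga : a * q g = a := by rw [← hsum, mul_add, ha.eq, hab, add_zero]
  have hag : q g * a = a := by rw [← hsum, add_mul, ha.eq, hba, add_zero]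
  obtain ⟨a', ha', haa', h1, h2⟩ := exists_isIdempotentElem_mul_eq_zero_of_ker_isNilpotent q hn a
    (hq a) ha (1 - g) hidem.one_sub (by rw [map_sub, map_one, mul_sub, mul_one, hga, sub_self])
    (by rw [map_sub, map_one, sub_mul, one_mul, hag, sub_self])
  have h1' : a' * g = a' := by
    rw [mul_sub, mul_one, sub_eq_zero] at h1; exact h1.symm
  have h2' : g * a' = a' := by
    rw [sub_mul, one_mul, sub_eq_zero] at h2; exact h2.symm
  have h := hprim a' (g - a') ha' ?_ ?_ ?_ (by abel)
  · rcases h with h | h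
    · left; rw [← haa', h, map_zero]
    · right
      have : b = q (g - a') := by rw [map_sub, haa', ← hsum]; abel
      rw [this, h, map_zero]
  · rw [IsIdempotentElem, sub_mul, mul_sub, mul_sub, hidem.eq, h1', h2', ha'.eq]; abel
  · rw [mul_sub, h1', ha'.eq, sub_self]
  · rw [sub_mul, h2', ha'.eq, sub_self]

theorem IsSplitAlgebra.exists_surjective [Module.Finite K A] (h : IsSplitAlgebra K A) :
    ∃ (n : ℕ) (d : Fin n → ℕ) (q : A →ₐ[K] ((i : Fin n) → Matrix (Fin (d i)) (Fin (d i)) K)),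
      Function.Surjective q ∧ ∀ x, q x = 0 ↔ x ∈ Ring.jacobson A := by
  obtain ⟨n, d, ⟨φ⟩⟩ := h
  refine ⟨n, d, φ.toAlgHom.comp (Ideal.Quotient.mkₐ K (Ring.jacobson A)), ?_, fun x => ?_⟩
  · exact φ.surjective.comp (Ideal.Quotient.mkₐ_surjective K _)
  · change φ (Ideal.Quotient.mk _ x) = 0 ↔ _
    rw [map_eq_zero_iff φ φ.injective, Ideal.Quotient.eq_zero_iff_mem]

theorem IsPrimitiveIdempotent.exists_mul_mul_sub_mem [Module.Finite K A] (h : IsSplitAlgebra K A)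
    {g : A} (hg : IsPrimitiveIdempotent g) (x : A) :
    ∃ c : K, g * x * g - c • g ∈ Ring.jacobson A := by
  obtain ⟨n, d, q, hq, hker⟩ := h.exists_surjective
  obtain ⟨i, v, μ, hμv, hgi⟩ := exists_eq_single_vecMulVec
    (hg.map q.toRingHom hq fun x hx => isNilpotent_of_mem_jacobson K ((hker x).1 hx))
  have hgi' : q g = Pi.single i (vecMulVec v μ) := hgi
  refine ⟨μ ⬝ᵥ (q x i *ᵥ v), ?_⟩
  rw [← hker, map_sub, map_mul, map_mul, map_smul, hgi', sub_eq_zero]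
  funext j
  by_cases hj : j = i
  · subst hj
    simp only [Pi.mul_apply, Pi.smul_apply, Pi.single_eq_same]
    rw [vecMulVec_mul, vecMulVec_mul_vecMulVec, vecMulVec_smul, dotProduct_mulVec]
  · simp [hj]

/-- Modulo the radical both are rank one projections. In the same matrix block they are conjugate,
and conjugacy lifts through the nil radical; in different blocks they annihilate each other's
multiples. -/
theorem IsPrimitiveIdempotent.isConj_or [Module.Finite K A] (h : IsSplitAlgebra K A)
    {g g' : A} (hg : IsPrimitiveIdempotent g) (hg' : IsPrimitiveIdempotent g') :
    IsConj g g' ∨ ∀ x, g * x * g' ∈ Ring.jacobson A := by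
  obtain ⟨n, d, q, hq, hker⟩ := h.exists_surjective
  have hnil : ∀ x ∈ RingHom.ker q.toRingHom, IsNilpotent x :=
    fun x hx => isNilpotent_of_mem_jacobson K ((hker x).1 hx)
  obtain ⟨i, v, μ, hμv, hgi⟩ := exists_eq_single_vecMulVec (hg.map q.toRingHom hq hnil)
  obtain ⟨i', v', μ', hμv', hgi'⟩ := exists_eq_single_vecMulVec (hg'.map q.toRingHom hq hnil)
  by_cases hii : i = i'
  · subst hii
    left
    refine isConj_of_isConj_map q.toRingHom hq (fun x hx => ?_) hg.1 hg'.1 ?_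
    · have h1 : IsNilpotent (1 - x) := hnil _ (by rw [RingHom.mem_ker, map_sub, hx, map_one, sub_self])
      simpa using h1.isUnit_one_sub
    · rw [hgi, hgi']
      exact (isConj_vecMulVec hμv hμv').piSingle i
  · right
    intro x
    have h1 : q g = Pi.single i (vecMulVec v μ) := hgi
    have h2 : q g' = Pi.single i' (vecMulVec v' μ') := hgi'
    rw [← hker, map_mul, map_mul, h1, h2]
    funext j
    by_cases hj : j = i
    · have : j ≠ i' := fun h => hii (hj.symm.trans h)
      simp [this]
    · simp [hj]

end Split

/-! ### Lifting idempotents over a complete local ring -/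

section AdicLifting

open MonoidAlgebra

variable {R M : Type*} [CommRing R] [Monoid M]

variable (M) in
/-- The elements of `R[M]` with coefficients in `I`. -/
def coeffIdeal (I : Ideal R) : Ideal (MonoidAlgebra R M) :=
  RingHom.ker (mapRingHom M (Ideal.Quotient.mk I))

theorem mem_coeffIdeal {I : Ideal R} {x : MonoidAlgebra R M} :
    x ∈ coeffIdeal M I ↔ ∀ m, x.coeff m ∈ I := by
  rw [coeffIdeal, RingHom.mem_ker]
  constructor
  · intro h m
    rw [← Ideal.Quotient.eq_zero_iff_mem, ← coeff_mapRingHom, h, coeff_zero, Finsupp.zero_apply]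
  · intro h
    ext m
    rw [coeff_mapRingHom, Ideal.Quotient.eq_zero_iff_mem.2 (h m), coeff_zero, Finsupp.zero_apply]

instance (I : Ideal R) : (coeffIdeal M I).IsTwoSided :=
  inferInstanceAs (RingHom.ker _).IsTwoSided

theorem coeffIdeal_mono {I J : Ideal R} (h : I ≤ J) : coeffIdeal M I ≤ coeffIdeal M J :=
  fun _ hx => mem_coeffIdeal.2 fun m => h (mem_coeffIdeal.1 hx m)

theorem mul_mem_coeffIdeal {I J : Ideal R} {x y : MonoidAlgebra R M} (hx : x ∈ coeffIdeal M I)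
    (hy : y ∈ coeffIdeal M J) : x * y ∈ coeffIdeal M (I * J) := by
  classical
  rw [mem_coeffIdeal] at hx hy ⊢
  intro m
  rw [coeff_mul]
  refine sum_mem fun a _ => sum_mem fun b _ => ?_
  beta_reduce
  split_ifs
  · exact Ideal.mul_mem_mul (hx a) (hy b)
  · exact zero_mem _

theorem eq_zero_of_forall_mem_coeffIdeal {I : Ideal R} [IsHausdorff I R] {x : MonoidAlgebra R M}
    (h : ∀ n, x ∈ coeffIdeal M (I ^ n)) : x = 0 := by
  ext m
  refine IsHausdorff.haus (I := I) inferInstance _ fun n => ?_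
  rw [SModEq.zero, smul_eq_mul, Ideal.mul_top]
  exact mem_coeffIdeal.1 (h n) m

theorem mem_smul_of_mem_coeffIdeal [Finite M] {I : Ideal R} {x : MonoidAlgebra R M}
    (hx : x ∈ coeffIdeal M I) : x ∈ I • (⊤ : Submodule R (MonoidAlgebra R M)) := by
  have := Fintype.ofFinite M
  rw [eq_sum_smul_single x]
  exact sum_mem fun m _ => Submodule.smul_mem_smul (mem_coeffIdeal.1 hx m) Submodule.mem_top

theorem exists_limit [Finite M] {I : Ideal R} [IsPrecomplete I R] (f : ℕ → MonoidAlgebra R M)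
    (h : ∀ n, f (n + 1) - f n ∈ coeffIdeal M (I ^ n)) :
    ∃ L, ∀ n, L - f n ∈ coeffIdeal M (I ^ n) := by
  have hmn : ∀ {m n}, m ≤ n → f n - f m ∈ coeffIdeal M (I ^ m) := by
    intro m n hmn
    induction n, hmn using Nat.le_induction with
    | base => rw [sub_self]; exact zero_mem _
    | succ n hmn ih =>
      have : f (n + 1) - f m = (f (n + 1) - f n) + (f n - f m) := by abel
      rw [this]
      exact add_mem (coeffIdeal_mono (Ideal.pow_le_pow_right hmn) (h n)) ih
  have hL : ∀ a : M, ∃ L : R, ∀ n, (f n).coeff a ≡ L [SMOD (I ^ n • ⊤ : Submodule R R)] := by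
    intro a
    refine IsPrecomplete.prec (I := I) inferInstance (f := fun n => (f n).coeff a) ?_
    intro m n hm
    rw [SModEq.sub_mem, smul_eq_mul, Ideal.mul_top, ← neg_sub, neg_mem_iff]
    have := mem_coeffIdeal.1 (hmn hm) a
    rwa [coeff_sub, Finsupp.sub_apply] at this
  choose L hL using hL
  refine ⟨ofCoeff (Finsupp.equivFunOnFinite.symm L), fun n => mem_coeffIdeal.2 fun a => ?_⟩
  have := hL a n
  rw [SModEq.sub_mem, smul_eq_mul, Ideal.mul_top, ← neg_sub, neg_mem_iff] at this
  rw [coeff_sub, Finsupp.sub_apply]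
  exact this

/-- Newton iteration b ↦ 3b² - 2b³, whose defect b² - b tends to zero. The polynomial has no
constant term, so annihilators of a persist to the limit; this is what keeps successively lifted
idempotents orthogonal. -/
theorem exists_isIdempotentElem_sub_mem [Finite M] {I : Ideal R} [IsAdicComplete I R]
    (a : MonoidAlgebra R M) (ha : a * a - a ∈ coeffIdeal M I) :
    ∃ f, IsIdempotentElem f ∧ f - a ∈ coeffIdeal M I ∧ (∀ c, c * a = 0 → c * f = 0) ∧
      ∀ c, a * c = 0 → f * c = 0 := by
  let u : ℕ → MonoidAlgebra R M := fun n =>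
    Nat.rec a (fun _ b => b * b + b * b + b * b - (b * b * b + b * b * b)) n
  have hu : ∀ n, u (n + 1) =
      u n * u n + u n * u n + u n * u n - (u n * u n * u n + u n * u n * u n) := fun n => rfl
  have hidem : ∀ n, u n * u n - u n ∈ coeffIdeal M (I ^ (n + 1)) := by
    intro n
    induction n with
    | zero => rw [zero_add, pow_one]; exact ha
    | succ n ih =>
      rw [hu]
      generalize u n = b at ih ⊢
      have h1 : (b * b + b * b + b * b - (b * b * b + b * b * b)) *
          (b * b + b * b + b * b - (b * b * b + b * b * b)) -
          (b * b + b * b + b * b - (b * b * b + b * b * b)) =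
          (b * b - b) * (b * b - b) * (4 * (b * b) - 4 * b - 3) := by noncomm_ring
      rw [h1]
      refine Ideal.mul_mem_right _ _ (coeffIdeal_mono ?_ (mul_mem_coeffIdeal ih ih))
      rw [← pow_add]
      exact Ideal.pow_le_pow_right (by omega)
  have hstep : ∀ n, u (n + 1) - u n ∈ coeffIdeal M (I ^ (n + 1)) := by
    intro n
    have h1 : u (n + 1) - u n = (u n * u n - u n) * (1 - 2 * u n) := by
      rw [hu]; noncomm_ring
    rw [h1]
    exact Ideal.mul_mem_right _ _ (hidem n)
  obtain ⟨L, hL⟩ := exists_limit (I := I) u fun n =>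
    coeffIdeal_mono (Ideal.pow_le_pow_right n.le_succ) (hstep n)
  refine ⟨L, ?_, ?_, fun c hc => ?_, fun c hc => ?_⟩
  · rw [IsIdempotentElem, ← sub_eq_zero]
    refine eq_zero_of_forall_mem_coeffIdeal (I := I) fun n => ?_
    have h1 : L * L - L = L * (L - u n) + (L - u n) * u n + (u n * u n - u n) - (L - u n) := by
      noncomm_ring
    rw [h1]
    exact sub_mem (add_mem (add_mem (Ideal.mul_mem_left _ _ (hL n)) (Ideal.mul_mem_right _ _ (hL n)))
      (coeffIdeal_mono (Ideal.pow_le_pow_right n.le_succ) (hidem n))) (hL n)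
  · have h1 : L - a = (L - u 1) + (u 1 - u 0) := by
      change L - a = L - u 1 + (u 1 - a); abel
    rw [h1]
    have h2 := hL 1
    have h3 := hstep 0
    rw [pow_one] at h2
    rw [zero_add, pow_one] at h3
    exact add_mem h2 h3
  · have hn : ∀ n, c * u n = 0 := by
      intro n
      induction n with
      | zero => exact hc
      | succ n ih => rw [hu]; simp only [mul_sub, mul_add, ← mul_assoc, ih, zero_mul]; simp
    refine eq_zero_of_forall_mem_coeffIdeal (I := I) fun n => ?_
    have := Ideal.mul_mem_left _ c (hL n)
    rwa [mul_sub, hn, sub_zero] at this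
  · have hn : ∀ n, u n * c = 0 := by
      intro n
      induction n with
      | zero => exact hc
      | succ n ih => rw [hu]; simp only [sub_mul, add_mul, mul_assoc, ih, mul_zero]; simp
    refine eq_zero_of_forall_mem_coeffIdeal (I := I) fun n => ?_
    have := Ideal.mul_mem_right c _ (hL n)
    rwa [sub_mul, hn, sub_zero] at this

variable {O : Type*} [CommRing O] [IsLocalRing O]

theorem mapRingHom_residue_surjective :
    Function.Surjective (mapRingHom M (IsLocalRing.residue O)) := by
  intro x
  induction x using MonoidAlgebra.induction_linear with
  | zero => exact ⟨0, map_zero _⟩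
  | add x y hx hy =>
    obtain ⟨x, rfl⟩ := hx
    obtain ⟨y, rfl⟩ := hy
    exact ⟨x + y, map_add _ _ _⟩
  | single m c =>
    obtain ⟨c, rfl⟩ := IsLocalRing.residue_surjective c
    exact ⟨single m c, mapRingHom_single _ _ _⟩

theorem mapRingHom_residue_eq_zero_iff {x : MonoidAlgebra O M} :
    mapRingHom M (IsLocalRing.residue O) x = 0 ↔ x ∈ coeffIdeal M (IsLocalRing.maximalIdeal O) :=
  Iff.rfl

theorem OrthogonalIdempotents.lift_residue [Finite M]
    [IsAdicComplete (IsLocalRing.maximalIdeal O) O] {n : ℕ}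
    {e : Fin n → MonoidAlgebra (IsLocalRing.ResidueField O) M} (he : OrthogonalIdempotents e) :
    ∃ e' : Fin n → MonoidAlgebra O M, OrthogonalIdempotents e' ∧
      ∀ i, mapRingHom M (IsLocalRing.residue O) (e' i) = e i := by
  induction n with
  | zero => exact ⟨0, ⟨finZeroElim, finZeroElim⟩, finZeroElim⟩
  | succ n IH =>
    obtain ⟨e', h₁, h₂⟩ := IH (he.embedding (Fin.succEmb n))
    have h₂' (i) : mapRingHom M (IsLocalRing.residue O) (e' i) = e i.succ := h₂ i
    set q := mapRingHom M (IsLocalRing.residue O)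
    obtain ⟨a, ha⟩ := mapRingHom_residue_surjective (M := M) (O := O) (e 0)
    set g := ∑ i, e' i with hg
    have hgg : g * g = g := h₁.isIdempotentElem_sum
    have hga : q g * e 0 = 0 := by
      rw [hg, map_sum, Finset.sum_mul]
      exact Finset.sum_eq_zero fun i _ => by rw [h₂', he.ortho (Fin.succ_ne_zero i)]
    have hag : e 0 * q g = 0 := by
      rw [hg, map_sum, Finset.mul_sum]
      exact Finset.sum_eq_zero fun i _ => by rw [h₂', he.ortho (Fin.succ_ne_zero i).symm]
    have hb : q ((1 - g) * a * (1 - g)) = e 0 := by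
      rw [map_mul, map_mul, map_sub, map_one, ha, sub_mul, one_mul, hga, sub_zero, mul_sub, mul_one,
        hag, sub_zero]
    -- Any lift a of the new idempotent is first cut by 1 - g on both sides, so that the sum g of
    -- the idempotents already lifted annihilates it.
    obtain ⟨e₀, h₃, h₄, h₅, h₆⟩ := exists_isIdempotentElem_sub_mem
      (I := IsLocalRing.maximalIdeal O) ((1 - g) * a * (1 - g)) (by
        rw [← mapRingHom_residue_eq_zero_iff, map_sub, map_mul, hb, (he.idem 0).eq, sub_self])
    have h4' : q e₀ = e 0 := by
      rw [← mapRingHom_residue_eq_zero_iff, map_sub, hb, sub_eq_zero] at h₄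
      exact h₄
    have h5' : g * e₀ = 0 := h₅ g (by
      have : g * (1 - g) = 0 := by rw [mul_sub, mul_one, hgg, sub_self]
      rw [← mul_assoc, ← mul_assoc, this, zero_mul, zero_mul])
    have h6' : e₀ * g = 0 := h₆ g (by
      have : (1 - g) * g = 0 := by rw [sub_mul, one_mul, hgg, sub_self]
      rw [mul_assoc, this, mul_zero])
    refine ⟨_, (h₁.option _ h₃ h6' h5').embedding (finSuccEquiv n).toEmbedding, fun i ↦ ?_⟩
    obtain ⟨_ | i, rfl⟩ := (finSuccEquiv n).symm.surjective i <;> simp [*]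

/-- By Nakayama, left multiplication by x is surjective, which gives a right inverse. That inverse
also reduces to 1 and so has a right inverse of its own, which must be x. -/
theorem isUnit_of_map_residue_eq_one [Finite M] {x : MonoidAlgebra O M}
    (hx : mapRingHom M (IsLocalRing.residue O) x = 1) : IsUnit x := by
  have key : ∀ x : MonoidAlgebra O M, mapRingHom M (IsLocalRing.residue O) x = 1 →
      ∃ y, x * y = 1 := by
    intro x hx
    let N : Submodule O (MonoidAlgebra O M) := LinearMap.range (LinearMap.mulLeft O x)
    have h1 : (⊤ : Submodule O (MonoidAlgebra O M)) ≤ N := by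
      refine Submodule.le_of_le_smul_of_le_jacobson_bot (I := IsLocalRing.maximalIdeal O)
        Module.Finite.fg_top (IsLocalRing.maximalIdeal_le_jacobson _) fun y _ => ?_
      have h2 : y = x * y + (1 - x) * y := by noncomm_ring
      rw [h2]
      refine Submodule.add_mem_sup ⟨y, rfl⟩ ?_
      have h3 : (1 - x) * y ∈ coeffIdeal M (IsLocalRing.maximalIdeal O) := by
        rw [← mapRingHom_residue_eq_zero_iff, map_mul, map_sub, map_one, hx, sub_self, zero_mul]
      exact mem_smul_of_mem_coeffIdeal h3
    obtain ⟨y, hy⟩ := h1 (Submodule.mem_top (x := 1))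
    exact ⟨y, hy⟩
  obtain ⟨y, hy⟩ := key x hx
  obtain ⟨z, hz⟩ := key y (by
    have := congrArg (mapRingHom M (IsLocalRing.residue O)) hy
    rwa [map_mul, hx, one_mul, map_one] at this)
  have hxz : x = z := by rw [← mul_one x, ← hz, ← mul_assoc, hy, one_mul]
  exact ⟨⟨x, y, hy, by rw [hxz, hz]⟩, rfl⟩

end AdicLifting

/-! ### Basic idempotents -/

section Basic

open MonoidAlgebra IsLocalRing

/-- Modulo N the corner at f consists of scalars, so an idempotent below f is congruent to 0 or f;
it or its complement is then a nilpotent idempotent. -/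
theorem isPrimitiveIdempotent_of_nil {K A : Type*} [Field K] [Ring A] [Algebra K A] (N : Ideal A)
    [N.IsTwoSided] (hN : ∀ x ∈ N, IsNilpotent x) {f : A} (hf : IsIdempotentElem f) (hne : f ≠ 0)
    (h : ∀ x, ∃ c : K, f * x * f - c • f ∈ N) : IsPrimitiveIdempotent f := by
  refine ⟨hf, hne, fun a b ha hb hab hba hsum => ?_⟩
  have hfN : f ∉ N := fun h' => hne (hf.eq_zero_of_isNilpotent (hN f h'))
  have haf : a * f = a := by rw [← hsum, mul_add, ha.eq, hab, add_zero]
  have hfa : f * a = a := by rw [← hsum, add_mul, ha.eq, hba, add_zero]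
  obtain ⟨c, hc⟩ := h a
  rw [hfa, haf] at hc
  have h1 : (c - c * c) • f ∈ N := by
    have h2 : (c - c * c) • f = (a - c • f) * a + c • f * (a - c • f) - (a - c • f) := by
      simp only [sub_mul, mul_sub, smul_mul_assoc, mul_smul_comm, ha.eq, hfa, hf.eq,
        sub_smul, smul_smul]
      abel
    rw [h2]
    exact sub_mem (add_mem (Ideal.mul_mem_right _ _ hc) (Ideal.mul_mem_left _ _ hc)) hc
  have h2 : c - c * c = 0 := by
    by_contra h3
    apply hfN
    have := Submodule.smul_of_tower_mem N (c - c * c)⁻¹ h1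
    rwa [smul_smul, inv_mul_cancel₀ h3, one_smul] at this
  have h3 : c * (1 - c) = 0 := by rw [← h2]; ring
  rcases mul_eq_zero.1 h3 with h4 | h4
  · left
    rw [h4, zero_smul, sub_zero] at hc
    exact ha.eq_zero_of_isNilpotent (hN a hc)
  · right
    have h5 : c = 1 := (sub_eq_zero.1 h4).symm
    refine hb.eq_zero_of_isNilpotent (hN b ?_)
    rw [h5, one_smul, ← hsum, ← neg_mem_iff] at hc
    convert hc using 1
    abel

variable {M O : Type*} [Monoid M] [Finite M] [CommRing O] [IsLocalRing O]

/-- Nakayama for gAh, where A = O[M]. An element agrees with one of W up to something whose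
reduction is in the radical, and `hN` lifts that to N_O up to coefficients in the maximal ideal; the
error lies in the maximal ideal times gAh. -/
theorem mem_sup_of_residue
    (hN : ∀ x : MonoidAlgebra O M, mapRingHom M (residue O) x ∈
      Ring.jacobson (MonoidAlgebra (ResidueField O) M) →
      ∃ z ∈ coeffIdeal M (maximalIdeal O), x - z ∈ sandwichIdeal O M)
    (W : Submodule O (MonoidAlgebra O M)) {g h : MonoidAlgebra O M} (hg : IsIdempotentElem g)
    (hh : IsIdempotentElem h)
    (H : ∀ x, ∃ w ∈ W, g * w * h = w ∧ mapRingHom M (residue O) (g * x * h - w) ∈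
      Ring.jacobson (MonoidAlgebra (ResidueField O) M)) (x : MonoidAlgebra O M) :
    g * x * h ∈ (sandwichIdeal O M).restrictScalars O ⊔ W := by
  let L : MonoidAlgebra O M →ₗ[O] MonoidAlgebra O M :=
    LinearMap.mulRight O h ∘ₗ LinearMap.mulLeft O g
  have hL : ∀ x, L x = g * x * h := fun x => rfl
  suffices hle : LinearMap.range L ≤ (sandwichIdeal O M).restrictScalars O ⊔ W from hle ⟨x, rfl⟩
  refine Submodule.le_of_le_smul_of_le_jacobson_bot (I := maximalIdeal O)
    (by rw [LinearMap.range_eq_map]; exact Module.Finite.fg_top.map L)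
    (maximalIdeal_le_jacobson _) ?_
  rintro _ ⟨y, rfl⟩
  obtain ⟨w, hw, hwgh, hwr⟩ := H y
  obtain ⟨z, hz, hzN⟩ := hN _ hwr
  have h1 : g * (g * y * h) * h = g * y * h := by
    rw [← mul_assoc, ← mul_assoc, hg.eq, mul_assoc, hh.eq]
  have h2 : L y = L (g * y * h - w - z) + w + L z := by
    simp only [hL, mul_sub, sub_mul, h1, hwgh]
    abel
  rw [h2]
  refine Submodule.add_mem_sup (add_mem (Submodule.mem_sup_left ?_) (Submodule.mem_sup_right hw)) ?_
  · exact Ideal.mul_mem_right _ _ (Ideal.mul_mem_left _ _ hzN)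
  · rw [LinearMap.range_eq_map, ← Submodule.map_smul'']
    exact Submodule.mem_map_of_mem (mem_smul_of_mem_coeffIdeal hz)

theorem exists_mul_mul_sub_mem_of_map {M O F : Type*} [Monoid M] [CommRing O] [Field F]
    [Algebra O F] {g : MonoidAlgebra O M}
    (h : ∀ x, ∃ c : O, g * x * g - c • g ∈ sandwichIdeal O M) (y : MonoidAlgebra F M) :
    ∃ c : F, mapRingHom M (algebraMap O F) g * y * mapRingHom M (algebraMap O F) g -
      c • mapRingHom M (algebraMap O F) g ∈ sandwichIdeal F M := by
  induction y using MonoidAlgebra.induction_linear with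
  | zero => exact ⟨0, by simp⟩
  | add y z hy hz =>
    obtain ⟨c, hc⟩ := hy
    obtain ⟨d, hd⟩ := hz
    refine ⟨c + d, ?_⟩
    convert add_mem hc hd using 1
    rw [mul_add, add_mul, add_smul]
    abel
  | single m r =>
    obtain ⟨c, hc⟩ := h (single m 1)
    refine ⟨r * algebraMap O F c, ?_⟩
    have h1 := Submodule.smul_of_tower_mem (sandwichIdeal F M) r
      (map_mem_sandwichIdeal (algebraMap O F) hc)
    convert h1 using 1
    rw [map_sub, map_mul, map_mul, map_smul_eq_smul_map, mapRingHom_single, map_one, smul_sub,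
      smul_smul, ← smul_mul_assoc, ← mul_smul_comm, smul_single, smul_eq_mul, mul_one]

theorem mul_mul_mem_of_map {M O F : Type*} [Monoid M] [CommRing O] [Field F] [Algebra O F]
    {g g' : MonoidAlgebra O M}
    (h : ∀ x, g * x * g' ∈ sandwichIdeal O M) (y : MonoidAlgebra F M) :
    mapRingHom M (algebraMap O F) g * y * mapRingHom M (algebraMap O F) g' ∈
      sandwichIdeal F M := by
  induction y using MonoidAlgebra.induction_linear with
  | zero => simp
  | add y z hy hz =>
    rw [mul_add, add_mul]
    exact add_mem hy hz
  | single m r =>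
    have h1 := Submodule.smul_of_tower_mem (sandwichIdeal F M) r
      (map_mem_sandwichIdeal (algebraMap O F) (h (single m 1)))
    convert h1 using 1
    rw [map_mul, map_mul, mapRingHom_single, map_one, ← smul_mul_assoc, ← mul_smul_comm,
      smul_single, smul_eq_mul, mul_one]

variable [IsAdicComplete (maximalIdeal O) O]

/-- A basic idempotent of `k[M]` lifts to an idempotent of `O[M]`, together with a decomposition
adapted to the sandwich ideal. -/
theorem exists_lift_basic
    (hk : IsSplitAlgebra (ResidueField O) (MonoidAlgebra (ResidueField O) M))
    (hN : ∀ x : MonoidAlgebra O M, mapRingHom M (residue O) x ∈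
      Ring.jacobson (MonoidAlgebra (ResidueField O) M) →
      ∃ z ∈ coeffIdeal M (maximalIdeal O), x - z ∈ sandwichIdeal O M)
    {e : MonoidAlgebra (ResidueField O) M} (he : IsBasicIdempotent e) :
    ∃ (s : ℕ) (f : Fin s → MonoidAlgebra O M) (T : Finset (Fin s)),
      CompleteOrthogonalIdempotents f ∧
      (∀ i, mapRingHom M (residue O) (f i) ≠ 0) ∧
      (∀ i x, ∃ c : O, f i * x * f i - c • f i ∈ sandwichIdeal O M) ∧
      (∀ i ∈ T, ∀ j ∈ T, i ≠ j → ∀ x, f i * x * f j ∈ sandwichIdeal O M) ∧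
      (∀ j, ∃ i ∈ T, IsConj (f i) (f j)) ∧
      mapRingHom M (residue O) (∑ i ∈ T, f i) = e := by
  obtain ⟨s, ε, T, hε, hprim, hT, hcov, rfl⟩ := he
  obtain ⟨f, hf, hfε⟩ := OrthogonalIdempotents.lift_residue hε.toOrthogonalIdempotents
  have hcomplete : ∑ i, f i = 1 := by
    -- The sum is idempotent and reduces to 1; an invertible idempotent equals 1.
    have h1 : IsUnit (∑ i, f i) := isUnit_of_map_residue_eq_one (by
      rw [map_sum, ← hε.complete]
      exact Finset.sum_congr rfl fun i _ => hfε i)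
    exact (IsIdempotentElem.iff_eq_one_of_isUnit h1).1 hf.isIdempotentElem_sum
  refine ⟨s, f, T, ⟨hf, hcomplete⟩, fun i => ?_, fun i x => ?_, fun i hi j hj hij x => ?_,
    fun j => ?_, ?_⟩
  · rw [hfε]; exact (hprim i).2.1
  · have h1 := mem_sup_of_residue hN (Submodule.span O {f i}) (hf.idem i) (hf.idem i) (fun x => by
      obtain ⟨c, hc⟩ := (hprim i).exists_mul_mul_sub_mem hk (mapRingHom M (residue O) x)
      obtain ⟨c, rfl⟩ := residue_surjective c
      refine ⟨c • f i, Submodule.smul_mem _ _ (Submodule.mem_span_singleton_self _), ?_, ?_⟩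
      · rw [mul_smul_comm, smul_mul_assoc, (hf.idem i).eq, (hf.idem i).eq]
      · rw [map_sub, map_mul, map_mul, hfε]
        have := map_smul_eq_smul_map (ResidueField O) c (f i)
        rw [ResidueField.algebraMap_eq] at this
        rwa [this, hfε]) x
    obtain ⟨n, hn, w, hw, hnw⟩ := Submodule.mem_sup.1 h1
    obtain ⟨c, rfl⟩ := Submodule.mem_span_singleton.1 hw
    refine ⟨c, ?_⟩
    rw [← hnw, add_sub_cancel_right]
    exact hn
  · have h0 := ((hprim i).isConj_or hk (hprim j)).resolve_left fun h => hij (hT i hi j hj h)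
    have h1 := mem_sup_of_residue hN ⊥ (hf.idem i) (hf.idem j) (fun x =>
      ⟨0, zero_mem _, by simp, by rw [sub_zero, map_mul, map_mul, hfε, hfε]; exact h0 _⟩) x
    rwa [sup_bot_eq] at h1
  · obtain ⟨i, hi, hij⟩ := hcov (ε j) (hprim j)
    refine ⟨i, hi, isConj_of_isConj_map _ mapRingHom_residue_surjective
      (fun x hx => isUnit_of_map_residue_eq_one hx) (hf.idem i) (hf.idem j) ?_⟩
    rwa [hfε, hfε]
  · rw [map_sum]
    exact Finset.sum_congr rfl fun i _ => hfε i

theorem eq_zero_of_map_eq_zero {M O F : Type*} [Monoid M] [CommRing O] [CommRing F] [Algebra O F]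
    [FaithfulSMul O F] {x : MonoidAlgebra O M} (hx : mapRingHom M (algebraMap O F) x = 0) :
    x = 0 := by
  ext m
  apply FaithfulSMul.algebraMap_injective O F
  rw [← coeff_mapRingHom, hx, coeff_zero, coeff_zero, Finsupp.zero_apply, Finsupp.zero_apply,
    map_zero]

/-- Over F the corners are scalars modulo the radical, so the f_i stay primitive. Conjugate chosen
f_i and f_j with i ≠ j would put f_i in the radical. A primitive g conjugate to no f_j would have
every f_j g in the radical, hence g itself. -/
theorem isBasicIdempotent_map {M O F : Type*} [Monoid M] [Finite M] [CommRing O]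
    [Field F] [Algebra O F] [FaithfulSMul O F]
    (hF : IsSplitAlgebra F (MonoidAlgebra F M))
    (hrad : Ring.jacobson (MonoidAlgebra F M) = sandwichIdeal F M) {s : ℕ}
    {f : Fin s → MonoidAlgebra O M} {T : Finset (Fin s)} (hf : CompleteOrthogonalIdempotents f)
    (hne : ∀ i, f i ≠ 0) (h1 : ∀ i x, ∃ c : O, f i * x * f i - c • f i ∈ sandwichIdeal O M)
    (h2 : ∀ i ∈ T, ∀ j ∈ T, i ≠ j → ∀ x, f i * x * f j ∈ sandwichIdeal O M)
    (h3 : ∀ j, ∃ i ∈ T, IsConj (f i) (f j)) :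
    IsBasicIdempotent (mapRingHom M (algebraMap O F) (∑ i ∈ T, f i)) := by
  set ι := mapRingHom M (algebraMap O F)
  have hnil : ∀ x ∈ sandwichIdeal F M, IsNilpotent x := fun x hx =>
    isNilpotent_of_mem_jacobson F (hrad ▸ hx)
  have hprim : ∀ i, IsPrimitiveIdempotent (ι (f i)) := fun i =>
    isPrimitiveIdempotent_of_nil (sandwichIdeal F M) hnil ((hf.idem i).map ι)
      (fun h => hne i (eq_zero_of_map_eq_zero h)) (exists_mul_mul_sub_mem_of_map (h1 i))
  refine ⟨s, ι ∘ f, T, hf.map ι, hprim, fun i hi j hj hij => ?_, fun g hg => ?_, ?_⟩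
  · by_contra hne'
    obtain ⟨u, hu⟩ := hij
    have h4 := mul_mul_mem_of_map (F := F) (h2 i hi j hj hne') ↑u⁻¹
    have h5 : ι (f i) * ↑u⁻¹ * ι (f j) * u = ι (f i) := by
      have h6 : ι (f j) * u = u * ι (f i) := hu.eq.symm
      rw [mul_assoc, h6, mul_assoc, Units.inv_mul_cancel_left, ← map_mul, (hf.idem i).eq]
    refine (hprim i).2.1 ((hprim i).1.eq_zero_of_isNilpotent (hnil _ ?_))
    rw [← h5]
    exact Ideal.mul_mem_right _ _ h4
  · obtain ⟨j, hj⟩ : ∃ j, IsConj (ι (f j)) g := by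
      by_contra! hno
      refine hg.2.1 (hg.1.eq_zero_of_isNilpotent (isNilpotent_of_mem_jacobson F ?_))
      have h4 : g = ∑ j, ι (f j) * 1 * g := by
        simp only [mul_one]
        rw [← Finset.sum_mul, ← map_sum, hf.complete, map_one, one_mul]
      rw [h4]
      exact sum_mem fun j _ => ((hprim j).isConj_or hF hg).resolve_left (hno j) 1
    obtain ⟨i, hi, hij⟩ := h3 j
    exact ⟨i, hi, (show IsConj (ι (f i)) (ι (f j)) from ι.toMonoidHom.map_isConj hij).trans hj⟩
  · rw [map_sum]; rfl

/-! ### Representatives for arrows over a principal ideal domain. -/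

/-- Representatives for the arrows between two idempotents. -/
theorem exists_arrows {R A : Type*} [CommRing R] [IsDomain R] [IsPrincipalIdealRing R] [Ring A]
    [Algebra R A] [Module.Finite R A] (N : Ideal A) [N.IsTwoSided]
    (hN : ∀ (c : R) (x : A), c ≠ 0 → c • x ∈ N → x ∈ N)
    (hN2 : ∀ (c : R) (x : A), c ≠ 0 → c • x ∈ N * N → x ∈ N * N)
    {g h : A} (hg : IsIdempotentElem g) (hh : IsIdempotentElem h) :
    ∃ (n : ℕ) (x : Fin n → A) (l : Fin n → A →ₗ[R] R),
      (∀ α, x α ∈ N ∧ g * x α = x α ∧ x α * h = x α) ∧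
      (∀ α β, l α (x β) = if α = β then 1 else 0) ∧
      (∀ α, ∀ y ∈ N * N, l α y = 0) ∧
      (∀ α, ∀ y ∈ N, g * y * h = 0 → l α y = 0) ∧
      ∀ y ∈ N, ∃ c : Fin n → R, g * y * h - ∑ α, c α • x α ∈ N * N := by
  have htf : ∀ (I : Ideal A), (∀ (c : R) (x : A), c ≠ 0 → c • x ∈ I → x ∈ I) →
      Module.IsTorsionFree R (A ⧸ I.restrictScalars R) := by
    intro I hI
    refine ⟨fun c hc => ?_⟩
    refine isSMulRegular_iff_right_eq_zero_of_smul.2 fun y hy => ?_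
    obtain ⟨x, rfl⟩ := Submodule.Quotient.mk_surjective _ y
    rw [← Submodule.Quotient.mk_smul, Submodule.Quotient.mk_eq_zero] at hy
    exact (Submodule.Quotient.mk_eq_zero _).2 (hI c x hc.ne_zero hy)
  have := htf N hN
  have := htf (N * N) hN2
  obtain ⟨σ, hσ⟩ := Module.projective_lifting_property (N.restrictScalars R).mkQ LinearMap.id
    (Submodule.mkQ_surjective _)
  -- Since A/N is free, N is a direct summand; π extends to all of A the functionals that are
  -- naturally defined on N.
  let π : A →ₗ[R] A := LinearMap.id - σ ∘ₗ (N.restrictScalars R).mkQ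
  have hπN : ∀ x, π x ∈ N := by
    intro x
    have h1 : (N.restrictScalars R).mkQ (π x) = 0 := by
      have := LinearMap.congr_fun hσ ((N.restrictScalars R).mkQ x)
      simp only [LinearMap.comp_apply, LinearMap.id_apply] at this
      simp only [π, LinearMap.sub_apply, LinearMap.id_apply, LinearMap.comp_apply, map_sub, this,
        sub_self]
    exact (Submodule.Quotient.mk_eq_zero (N.restrictScalars R)).1 h1
  have hπ : ∀ x ∈ N, π x = x := by
    intro x hx
    have h1 : (N.restrictScalars R).mkQ x = 0 := (Submodule.Quotient.mk_eq_zero _).2 hx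
    simp [π, h1]
  let L : A →ₗ[R] A := LinearMap.mulRight R h ∘ₗ LinearMap.mulLeft R g
  have hL : ∀ x, L x = g * x * h := fun x => rfl
  let q := ((N * N).restrictScalars R).mkQ
  have hq : ∀ x, q x = 0 ↔ x ∈ N * N := fun x =>
    Submodule.Quotient.mk_eq_zero ((N * N).restrictScalars R)
  -- The image of gNh in the finite torsion-free module A/N² is free. Lifts of a basis are the
  -- arrows, and the coordinate functions give the dual functionals.
  let B : Submodule R (A ⧸ (N * N).restrictScalars R) := (N.restrictScalars R).map (q ∘ₗ L)
  let b := Module.finBasis R B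
  have hx : ∀ α, ∃ x ∈ N, q (L x) = b α := fun α => (b α).2
  choose x hxN hxb using hx
  let ρ : A →ₗ[R] B := (q ∘ₗ L ∘ₗ π).codRestrict B fun y => ⟨π y, hπN y, rfl⟩
  have hρ : ∀ y, (ρ y : A ⧸ (N * N).restrictScalars R) = q (L (π y)) := fun y => rfl
  have hLN : ∀ y ∈ N, L y ∈ N := fun y hy => Ideal.mul_mem_right _ _ (Ideal.mul_mem_left _ _ hy)
  have hLL : ∀ y, L (L y) = L y := by
    intro y
    simp only [hL]
    rw [← mul_assoc, ← mul_assoc, hg.eq, mul_assoc, hh.eq]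
  refine ⟨_, fun α => L (x α), fun α => b.coord α ∘ₗ ρ, fun α => ⟨hLN _ (hxN α), ?_, ?_⟩,
    fun α β => ?_, fun α y hy => ?_, fun α y hy hy0 => ?_, fun y hy => ?_⟩
  · simp only [hL]
    rw [← mul_assoc, ← mul_assoc, hg.eq]
  · simp only [hL]
    rw [mul_assoc, hh.eq]
  · have h1 : ρ (L (x β)) = b β := Subtype.ext (by
      rw [hρ, hπ _ (hLN _ (hxN β)), hLL, hxb])
    rw [LinearMap.comp_apply, h1, Module.Basis.coord_apply, Module.Basis.repr_self,
      Finsupp.single_apply]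
    simp only [eq_comm]
  · have h1 : ρ y = 0 := Subtype.ext (by
      rw [hρ, hπ _ (Ideal.mul_le_left hy)]
      exact (hq _).2 (Ideal.mul_mem_right _ _ (Ideal.mul_mem_left _ _ hy)))
    rw [LinearMap.comp_apply, h1, map_zero]
  · have h1 : ρ y = 0 := Subtype.ext (by
      rw [hρ, hπ _ hy, hL, hy0, map_zero]; rfl)
    rw [LinearMap.comp_apply, h1, map_zero]
  · refine ⟨fun α => b.repr (ρ y) α, ?_⟩
    have h1 := congrArg Subtype.val (b.sum_repr (ρ y))
    rw [hρ, hπ y hy] at h1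
    rw [← hq, map_sub, ← hL, ← h1, map_sum, sub_eq_zero, Submodule.coe_sum]
    refine Finset.sum_congr rfl fun α _ => ?_
    rw [Submodule.coe_smul, map_smul, ← hxb]

end Basic

/-! ### Realizations of quivers in algebras -/

/-- A realization of a quiver in a ring: orthogonal idempotents for the vertices, and elements of
the corresponding Peirce components for the arrows. -/
structure QuiverRealization (V : Type*) [Quiver V] (A : Type*) [Ring A] where
  vertex : V → A
  arrow : ∀ {a b : V}, (a ⟶ b) → A
  orthogonal : OrthogonalIdempotents vertex
  vertex_mul : ∀ {a b : V} (α : a ⟶ b), vertex b * arrow α = arrow α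
  mul_vertex : ∀ {a b : V} (α : a ⟶ b), arrow α * vertex a = arrow α

namespace QuiverRealization

open PathAlgebra

variable {V : Type*} [Quiver V] {A B : Type*} [Ring A] [Ring B] (D : QuiverRealization V A)

/-- The image of a realization under a ring homomorphism. -/
@[simps]
def map (φ : A →+* B) : QuiverRealization V B where
  vertex v := φ (D.vertex v)
  arrow α := φ (D.arrow α)
  orthogonal := D.orthogonal.map φ
  vertex_mul α := by rw [← map_mul, D.vertex_mul]
  mul_vertex α := by rw [← map_mul, D.mul_vertex]

/-- The element of the algebra given by a path. -/
def eval (D : QuiverRealization V A) {a : V} : {b : V} → Quiver.Path a b → A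
  | _, .nil => D.vertex a
  | _, .cons p α => D.arrow α * eval D p

theorem eval_cons {a b c : V} (p : Quiver.Path a b) (α : b ⟶ c) :
    D.eval (p.cons α) = D.arrow α * D.eval p := rfl

theorem vertex_mul_eval {a b : V} (p : Quiver.Path a b) : D.vertex b * D.eval p = D.eval p := by
  cases p with
  | nil => exact D.orthogonal.idem a
  | cons p α => rw [eval_cons, ← mul_assoc, D.vertex_mul]

theorem eval_mul_vertex {a b : V} (p : Quiver.Path a b) : D.eval p * D.vertex a = D.eval p := by
  induction p with
  | nil => exact D.orthogonal.idem a
  | cons p α ih => rw [eval_cons, mul_assoc, ih]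

theorem eval_comp {a b c : V} (p : Quiver.Path a b) (q : Quiver.Path b c) :
    D.eval (p.comp q) = D.eval q * D.eval p := by
  induction q with
  | nil => exact (D.vertex_mul_eval p).symm
  | cons q α ih => rw [Quiver.Path.comp_cons, eval_cons, eval_cons, ih, mul_assoc]

theorem eval_map (φ : A →+* B) {a b : V} (p : Quiver.Path a b) :
    (D.map φ).eval p = φ (D.eval p) := by
  induction p with
  | nil => rfl
  | cons p α ih => rw [eval_cons, eval_cons, ih, map_mul, map_arrow]

section Lift

variable (K : Type*) [CommRing K] [Algebra K A]

/-- The linear map from the path algebra extending `eval`. -/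
def lift : PathAlgebra K V →ₗ[K] A :=
  Finsupp.linearCombination K (fun p : QuiverPath V => D.eval p.path)

variable {K}

@[simp]
theorem lift_ofPath (p : QuiverPath V) : D.lift K (ofPath K p) = D.eval p.path :=
  (Finsupp.linearCombination_single K 1 p).trans (one_smul K _)

theorem lift_nilPath (v : V) : D.lift K (ofPath K (nilPath v)) = D.vertex v := D.lift_ofPath _

theorem lift_mul (x y : PathAlgebra K V) : D.lift K (x * y) = D.lift K x * D.lift K y := by
  induction x using PathAlgebra.induction with
  | h0 => simp only [zero_mul, map_zero]
  | hadd x x' hx hx' => simp only [add_mul, map_add, hx, hx']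
  | hof c p =>
  rw [PathAlgebra.smul_mul', map_smul, map_smul, smul_mul_assoc]
  congr 1
  induction y using PathAlgebra.induction with
  | h0 => simp only [mul_zero, map_zero]
  | hadd x x' hx hx' => simp only [mul_add, map_add, hx, hx']
  | hof c q =>
  rw [mul_smul', map_smul, map_smul, mul_smul_comm]
  congr 1
  obtain ⟨a, b, p⟩ := p
  obtain ⟨c, d, q⟩ := q
  by_cases h : d = a
  · subst h
    rw [ofPath_mul_of_eq, lift_ofPath, lift_ofPath, lift_ofPath, eval_comp]
  · rw [ofPath_mul_of_ne _ _ h, map_zero, lift_ofPath, lift_ofPath]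
    change 0 = D.eval p * D.eval q
    rw [← D.eval_mul_vertex p, ← D.vertex_mul_eval q, mul_assoc, ← mul_assoc (D.vertex a),
      D.orthogonal.ortho (Ne.symm h), zero_mul, mul_zero]

variable [Fintype V]

theorem lift_one : D.lift K 1 = ∑ v, D.vertex v := by
  rw [one_def, map_sum]
  exact Finset.sum_congr rfl fun v _ => D.lift_ofPath _

variable {e : A}

theorem mul_lift (hsum : ∑ v, D.vertex v = e) (x : PathAlgebra K V) :
    e * D.lift K x = D.lift K x := by
  rw [← hsum, ← D.lift_one (K := K), ← lift_mul, one_mul]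

theorem mul_mul_eq_sum (hsum : ∑ v, D.vertex v = e) (x : A) :
    e * x * e = ∑ b, ∑ a, D.vertex b * x * D.vertex a := by
  simp only [← hsum, Finset.sum_mul, Finset.mul_sum]
  exact Finset.sum_comm

theorem lift_mul_right (hsum : ∑ v, D.vertex v = e) (x : PathAlgebra K V) :
    D.lift K x * e = D.lift K x := by
  rw [← hsum, ← D.lift_one (K := K), ← lift_mul, mul_one]

variable (K) in
/-- The algebra homomorphism from the path algebra to the corner at the sum of the vertices. -/
def liftCorner (he : IsIdempotentElem e) (hsum : ∑ v, D.vertex v = e) :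
    PathAlgebra K V →ₐ[K] he.Corner :=
  AlgHom.ofLinearMap
    { toFun x := ⟨D.lift K x, (Subsemigroup.mem_corner_iff he).2
        ⟨D.mul_lift hsum x, D.lift_mul_right hsum x⟩⟩
      map_add' x y := Subtype.ext (map_add _ x y)
      map_smul' c x := Subtype.ext (map_smul _ c x) }
    (Subtype.ext (D.lift_one.trans hsum))
    (fun x y => Subtype.ext (D.lift_mul x y))

theorem liftCorner_eq_zero_iff (he : IsIdempotentElem e) (hsum : ∑ v, D.vertex v = e)
    (x : PathAlgebra K V) : D.liftCorner K he hsum x = 0 ↔ D.lift K x = 0 :=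
  Subtype.ext_iff

end Lift

theorem lift_coeffMap {O K : Type*} [CommRing O] [CommRing K] [Algebra O K] [Algebra O A]
    [Algebra K B] (φ : A →+* B) (hφ : ∀ (c : O) x, φ (c • x) = algebraMap O K c • φ x)
    (y : PathAlgebra O V) : (D.map φ).lift K (coeffMap O K V y) = φ (D.lift O y) := by
  induction y using PathAlgebra.induction with
  | h0 => simp only [map_zero]
  | hadd x y hx hy => simp only [map_add, hx, hy]
  | hof c p =>
    rw [(coeffMap O K V).map_smul, (D.lift O).map_smul, hφ, ← algebraMap_smul K c, map_smul,
      coeffMap_ofPath, lift_ofPath, lift_ofPath, eval_map]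

/-! #### Surjectivity -/

section Surjective

variable {R : Type*} [CommRing R] [Algebra R A] [Fintype V] (N : Ideal A) [N.IsTwoSided] {e : A}

/-- A product yz of radical elements need not pass through the corner at e. Inserting 1 = ∑ u_j e
v_j between the factors writes e(yz)e as a sum of products of corner elements, each factor being
approximated by paths. -/
theorem exists_sub_mem_pow_succ (hsum : ∑ v, D.vertex v = e)
    (harrow : ∀ (a b : V), ∀ y ∈ N, ∃ w ∈ LinearMap.range (D.lift R),
      D.vertex b * y * D.vertex a - w ∈ N * N)
    {ι : Type*} [Fintype ι] {u v : ι → A} (hfull : ∑ j, u j * e * v j = 1) (m : ℕ) {x : A}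
    (hx : x ∈ N ^ (m + 1)) :
    ∃ w ∈ LinearMap.range (D.lift R), e * x * e - w ∈ N ^ (m + 2) := by
  have he : IsIdempotentElem e := hsum ▸ D.orthogonal.isIdempotentElem_sum
  have base : ∀ x ∈ N, ∃ w ∈ LinearMap.range (D.lift R), e * x * e - w ∈ N * N := by
    intro x hx
    choose w hw hwN using fun a b => harrow a b x hx
    refine ⟨∑ b, ∑ a, w a b, sum_mem fun b _ => sum_mem fun a _ => hw a b, ?_⟩
    rw [D.mul_mul_eq_sum hsum, ← Finset.sum_sub_distrib]
    refine sum_mem fun b _ => ?_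
    rw [← Finset.sum_sub_distrib]
    exact sum_mem fun a _ => hwN a b
  induction m generalizing x with
  | zero =>
    rw [zero_add, Submodule.pow_one] at hx
    rw [zero_add, Submodule.pow_succ, Submodule.pow_one]
    exact base x hx
  | succ m ih =>
    rw [Submodule.pow_succ] at hx
    induction hx using Submodule.mul_induction_on' with
    | mem_mul_mem y hy z hz =>
      have h1 : ∀ j, ∃ w ∈ LinearMap.range (D.lift R),
          e * y * u j * e * (e * v j * z * e) - w ∈ N ^ (m + 1 + 2) := by
        intro j
        obtain ⟨s, hs, hsN⟩ := ih (Ideal.mul_mem_right (u j) _ hy)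
        obtain ⟨t, ht, htN⟩ := base _ (Ideal.mul_mem_left N (v j) hz)
        obtain ⟨s, rfl⟩ := hs
        obtain ⟨t, rfl⟩ := ht
        refine ⟨_, ⟨s * t, rfl⟩, ?_⟩
        have h2 : e * y * u j * e * (e * v j * z * e) - D.lift R (s * t) =
            (e * (y * u j) * e - D.lift R s) * (e * v j * z * e) +
              D.lift R s * (e * (v j * z) * e - D.lift R t) := by
          rw [lift_mul]
          simp only [sub_mul, mul_sub, mul_assoc]
          abel
        have h3 : D.lift R s ∈ N ^ (m + 1) := by
          have h4 : D.lift R s = e * (y * u j) * e - (e * (y * u j) * e - D.lift R s) := by abel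
          rw [h4]
          exact sub_mem (Ideal.mul_mem_right _ _ (Ideal.mul_mem_left _ _
            (Ideal.mul_mem_right _ _ hy))) (Ideal.pow_le_pow_right (by omega) hsN)
        rw [h2]
        refine add_mem ?_ ?_
        · rw [show m + 1 + 2 = (m + 2) + 1 by ring, Submodule.pow_succ]
          exact Ideal.mul_mem_mul hsN (Ideal.mul_mem_right _ _ (Ideal.mul_mem_left _ _ hz))
        · rw [Ideal.IsTwoSided.pow_add, Submodule.pow_succ (n := 1), Submodule.pow_one]
          exact Ideal.mul_mem_mul h3 htN
      choose w hw hwN using h1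
      refine ⟨∑ j, w j, sum_mem fun j _ => hw j, ?_⟩
      have h2 : e * (y * z) * e = ∑ j, e * y * u j * e * (e * v j * z * e) := by
        have h3 : y * z = ∑ j, y * (u j * e * v j) * z := by
          rw [← Finset.sum_mul, ← Finset.mul_sum, hfull, mul_one]
        rw [h3, Finset.mul_sum, Finset.sum_mul]
        refine Finset.sum_congr rfl fun j _ => ?_
        have h4 : e * (e * (v j * (z * e))) = e * (v j * (z * e)) := by rw [← mul_assoc, he.eq]
        simp only [mul_assoc, h4]
      rw [h2, ← Finset.sum_sub_distrib]
      exact sum_mem fun j _ => hwN j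
    | add y _ z _ hy hz =>
      obtain ⟨s, hs, hsN⟩ := hy
      obtain ⟨t, ht, htN⟩ := hz
      refine ⟨s + t, add_mem hs ht, ?_⟩
      convert add_mem hsN htN using 1
      rw [mul_add, add_mul]
      abel

/-- Vertices account for the corner modulo N, and arrows for N modulo N². The error is then pushed
through successive powers of N until it vanishes. -/
theorem mul_mul_mem_range_lift (hsum : ∑ v, D.vertex v = e)
    {n : ℕ} (hn : N ^ n = ⊥)
    (hdiag : ∀ v x, ∃ c : R, D.vertex v * x * D.vertex v - c • D.vertex v ∈ N)
    (hoff : ∀ v w, v ≠ w → ∀ x, D.vertex v * x * D.vertex w ∈ N)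
    (harrow : ∀ (a b : V), ∀ y ∈ N, ∃ w ∈ LinearMap.range (D.lift R),
      D.vertex b * y * D.vertex a - w ∈ N * N)
    {ι : Type*} [Fintype ι] {u v : ι → A} (hfull : ∑ j, u j * e * v j = 1) (x : A) :
    e * x * e ∈ LinearMap.range (D.lift R) := by
  have he : IsIdempotentElem e := hsum ▸ D.orthogonal.isIdempotentElem_sum
  -- Descending induction on the power of N, with k bounding the number of steps left before
  -- reaching the vanishing n-th power.
  have key : ∀ k m, n ≤ m + 1 + k → ∀ x ∈ N ^ (m + 1), e * x * e ∈ LinearMap.range (D.lift R) := by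
    intro k
    induction k with
    | zero =>
      intro m hm x hx
      have h1 : x ∈ N ^ n := Ideal.pow_le_pow_right hm hx
      rw [hn] at h1
      rw [(Submodule.mem_bot A).1 h1, mul_zero, zero_mul]
      exact zero_mem _
    | succ k ih =>
      intro m hm x hx
      obtain ⟨w, hw, hwN⟩ := D.exists_sub_mem_pow_succ N hsum harrow hfull m hx
      have h1 := ih (m + 1) (by omega) _ hwN
      obtain ⟨w, rfl⟩ := hw
      have h2 : e * (e * x * e - D.lift R w) * e = e * x * e - D.lift R w := by
        rw [mul_sub, sub_mul, D.mul_lift hsum, D.lift_mul_right hsum, ← mul_assoc, ← mul_assoc,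
          he.eq, mul_assoc, he.eq]
      rw [h2] at h1
      simpa using add_mem h1 (LinearMap.mem_range_self (D.lift R) w)
  have hN : ∀ y ∈ N, e * y * e = y → y ∈ LinearMap.range (D.lift R) := by
    intro y hy hye
    rw [← hye]
    refine key n 0 (by omega) y ?_
    rwa [zero_add, Submodule.pow_one]
  have hev : ∀ v, e * D.vertex v = D.vertex v := fun v => by
    rw [← D.lift_nilPath (K := R)]
    exact D.mul_lift hsum _
  have hve : ∀ v, D.vertex v * e = D.vertex v := fun v => by
    rw [← D.lift_nilPath (K := R)]
    exact D.lift_mul_right hsum _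
  have hcorner : ∀ v x w, e * (D.vertex v * x * D.vertex w) * e = D.vertex v * x * D.vertex w := by
    intro v x w
    rw [← mul_assoc, ← mul_assoc, hev, mul_assoc, hve]
  rw [D.mul_mul_eq_sum hsum]
  refine sum_mem fun b _ => sum_mem fun a _ => ?_
  by_cases hab : b = a
  · subst hab
    obtain ⟨c, hc⟩ := hdiag b x
    have h2 := hN _ hc (by
      rw [mul_sub, sub_mul, hcorner, mul_smul_comm, smul_mul_assoc, hev, hve])
    have h3 : c • D.vertex b ∈ LinearMap.range (D.lift R) :=
      ⟨c • ofPath R (nilPath b), by rw [map_smul, lift_ofPath]; rfl⟩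
    simpa using add_mem h2 h3
  · exact hN _ (hoff b a hab x) (hcorner b x a)

end Surjective

end QuiverRealization

/-! ### Admissibility of the kernel -/

namespace PathAlgebra

section Coefficients

variable {R V : Type*} [CommRing R] [Quiver V]

/-- The coefficient of a path, as a linear functional on the path algebra. -/
def pathCoeff (p : QuiverPath V) : PathAlgebra R V →ₗ[R] R := Finsupp.lapply p

theorem pathCoeff_ofPath_self (p : QuiverPath V) : pathCoeff p (ofPath R p) = 1 :=
  Finsupp.single_eq_same

theorem pathCoeff_ofPath_of_ne {p q : QuiverPath V} (h : q ≠ p) :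
    pathCoeff p (ofPath R q) = 0 :=
  Finsupp.single_eq_of_ne h.symm

theorem mem_of_forall_pathCoeff {I : Submodule R (PathAlgebra R V)} {y : PathAlgebra R V}
    (h : ∀ p, pathCoeff p y = 0 ∨ ofPath R p ∈ I) : y ∈ I := by
  have h1 : y = Finsupp.sum y fun p c => c • ofPath R p := by
    refine (Finsupp.sum_single y).symm.trans (Finsupp.sum_congr fun p _ => ?_)
    exact (Finsupp.smul_single_one p _).symm
  rw [h1]
  refine sum_mem fun p _ => ?_
  rcases h p with h2 | h2
  · change pathCoeff p y • ofPath R p ∈ I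
    rw [h2, zero_smul]
    exact zero_mem _
  · exact I.smul_mem _ h2

theorem nilPath_injective : Function.Injective (nilPath : V → QuiverPath V) :=
  fun _ _ h => congrArg QuiverPath.src h

theorem arrowPath_injective {a b : V} :
    Function.Injective (arrowPath : (a ⟶ b) → QuiverPath V) := by
  intro α β h
  simp only [arrowPath, QuiverPath.mk.injEq, heq_eq_eq, true_and] at h
  exact eq_of_heq (Quiver.Path.hom_heq_of_cons_eq_cons h)

theorem ofPath_cons {a b c : V} (p : Quiver.Path a b) (α : b ⟶ c) :
    ofPath R ⟨a, c, p.cons α⟩ = ofPath R (arrowPath α) * ofPath R ⟨a, b, p⟩ :=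
  (ofPath_mul_of_eq α.toPath p).symm

theorem mk_cons_ne_nilPath {a b c v : V} (p : Quiver.Path a b) (α : b ⟶ c) :
    (⟨a, c, p.cons α⟩ : QuiverPath V) ≠ nilPath v := by
  intro h
  have := congrArg (fun q : QuiverPath V => q.path.length) h
  simp [nilPath] at this

theorem mk_cons_cons_ne_arrowPath {a b c d v w : V} (p : Quiver.Path a b) (α : b ⟶ c) (β : c ⟶ d)
    (γ : v ⟶ w) : (⟨a, d, (p.cons α).cons β⟩ : QuiverPath V) ≠ arrowPath γ := by
  intro h
  have := congrArg (fun q : QuiverPath V => q.path.length) h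
  simp [arrowPath] at this

theorem nilPath_ne_arrowPath {a v w : V} (γ : v ⟶ w) : nilPath a ≠ arrowPath γ := by
  intro h
  have := congrArg (fun q : QuiverPath V => q.path.length) h
  simp [arrowPath, nilPath] at this

end Coefficients

variable {R V : Type*} [CommRing R] [Quiver V] [Fintype V]

instance : (arrowIdeal R V).IsTwoSided :=
  inferInstanceAs (TwoSidedIdeal.asIdeal _).IsTwoSided

theorem ofPath_arrowPath_mem_arrowIdeal {a b : V} (α : a ⟶ b) :
    ofPath R (arrowPath α) ∈ arrowIdeal R V :=
  TwoSidedIdeal.mem_asIdeal.2 (TwoSidedIdeal.subset_span ⟨a, b, α, rfl⟩)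

theorem ofPath_cons_mem_arrowIdeal {a b c : V} (p : Quiver.Path a b) (α : b ⟶ c) :
    ofPath R ⟨a, c, p.cons α⟩ ∈ arrowIdeal R V := by
  rw [ofPath_cons]
  exact Ideal.mul_mem_right _ _ (ofPath_arrowPath_mem_arrowIdeal α)

theorem ofPath_cons_cons_mem_arrowIdeal_sq {a b c d : V} (p : Quiver.Path a b) (α : b ⟶ c)
    (β : c ⟶ d) : ofPath R ⟨a, d, (p.cons α).cons β⟩ ∈ arrowIdeal R V ^ 2 := by
  rw [ofPath_cons, Submodule.pow_succ, Submodule.pow_one]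
  exact Ideal.mul_mem_mul (ofPath_arrowPath_mem_arrowIdeal β) (ofPath_cons_mem_arrowIdeal p α)

end PathAlgebra

namespace QuiverRealization

open PathAlgebra

variable {V : Type*} [Quiver V] [Fintype V] {B : Type*} [Ring B] (D : QuiverRealization V B)
  {K : Type*} [Field K] [Algebra K B] (N : Ideal B) [N.IsTwoSided]

theorem lift_mem_of_mem_arrowIdeal (hN : ∀ {a b : V} (α : a ⟶ b), D.arrow α ∈ N)
    {y : PathAlgebra K V} (hy : y ∈ arrowIdeal K V) : D.lift K y ∈ N := by
  rw [arrowIdeal, TwoSidedIdeal.mem_asIdeal] at hy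
  induction hy using TwoSidedIdeal.span_induction with
  | mem x h =>
    obtain ⟨a, b, α, rfl⟩ := h
    rw [lift_ofPath]
    exact Ideal.mul_mem_right _ _ (hN α)
  | zero => rw [map_zero]; exact zero_mem _
  | add x y _ _ hx hy => rw [map_add]; exact add_mem hx hy
  | neg x _ hx => rw [map_neg]; exact neg_mem hx
  | left_absorb a x _ hx => rw [lift_mul]; exact Ideal.mul_mem_left _ _ hx
  | right_absorb a x _ hx => rw [lift_mul]; exact Ideal.mul_mem_right _ _ hx

theorem lift_mem_pow (hN : ∀ {a b : V} (α : a ⟶ b), D.arrow α ∈ N) (n : ℕ)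
    {y : PathAlgebra K V} (hy : y ∈ arrowIdeal K V ^ n) : D.lift K y ∈ N ^ n := by
  induction n generalizing y with
  | zero => rw [Submodule.pow_zero, Ideal.one_eq_top]; trivial
  | succ n ih =>
    rw [Submodule.pow_succ] at hy ⊢
    induction hy using Submodule.mul_induction_on' with
    | mem_mul_mem x hx y hy =>
      rw [lift_mul]
      exact Ideal.mul_mem_mul (ih hx) (D.lift_mem_of_mem_arrowIdeal N hN hy)
    | add x _ y _ hx hy => rw [map_add]; exact add_mem hx hy

end QuiverRealization

namespace QuiverRealization

open PathAlgebra

variable {V : Type*} [Quiver V] {B : Type*} [Ring B] (D : QuiverRealization V B)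
  {K : Type*} [Field K] [Algebra K B] (N : Ideal B) [N.IsTwoSided]

/-- Paths of positive length evaluate into N, and multiplying by one vertex kills all other empty
paths. This isolates a single degree zero coefficient. -/
theorem vertex_mul_lift_sub_mem (hN : ∀ {a b : V} (α : a ⟶ b), D.arrow α ∈ N) (v : V)
    (y : PathAlgebra K V) :
    D.vertex v * D.lift K y - pathCoeff (nilPath v) y • D.vertex v ∈ N := by
  induction y using PathAlgebra.induction with
  | h0 => simp
  | hadd x y hx hy =>
    convert add_mem hx hy using 1
    rw [map_add, map_add, mul_add, add_smul]
    abel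
  | hof c p =>
    rw [map_smul, map_smul, mul_smul_comm, smul_assoc, ← smul_sub]
    refine Submodule.smul_of_tower_mem N c ?_
    rw [lift_ofPath]
    obtain ⟨a, b, p⟩ := p
    cases p with
    | nil =>
      change D.vertex v * D.vertex a - pathCoeff (nilPath v) (ofPath K (nilPath a)) • _ ∈ N
      by_cases h : a = v
      · subst h
        rw [pathCoeff_ofPath_self, one_smul, D.orthogonal.idem, sub_self]
        exact zero_mem _
      · rw [pathCoeff_ofPath_of_ne fun h' => h (nilPath_injective h'),
          D.orthogonal.ortho (Ne.symm h), zero_smul, sub_zero]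
        exact zero_mem _
    | cons p α =>
      rw [pathCoeff_ofPath_of_ne (mk_cons_ne_nilPath p α), zero_smul, sub_zero]
      exact Ideal.mul_mem_left _ _ (Ideal.mul_mem_right _ _ (hN α))

variable [Fintype V]

/-- The functional kills N², hence all paths of length at least two, and among arrows it sees only
α. Empty paths remain as an error term, since l is not assumed to vanish on vertices. -/
theorem apply_lift (hN : ∀ {a b : V} (α : a ⟶ b), D.arrow α ∈ N) {a b : V} (α : a ⟶ b)
    (l : B →ₗ[K] K) (hl : ∀ y ∈ N * N, l y = 0) (hα : l (D.arrow α) = 1)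
    (hpar : ∀ β : a ⟶ b, β ≠ α → l (D.arrow β) = 0)
    (hnpar : ∀ {a' b' : V} (β : a' ⟶ b'), ¬ (a' = a ∧ b' = b) → l (D.arrow β) = 0)
    (y : PathAlgebra K V) :
    l (D.lift K y) = pathCoeff (arrowPath α) y +
      ∑ v, pathCoeff (nilPath v) y * l (D.vertex v) := by
  classical
  induction y using PathAlgebra.induction with
  | h0 => simp
  | hadd x y hx hy =>
    simp only [map_add, hx, hy, add_mul, Finset.sum_add_distrib]
    abel
  | hof c p =>
    simp only [map_smul, smul_eq_mul, mul_assoc]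
    rw [← Finset.mul_sum, ← mul_add, lift_ofPath]
    congr 1
    obtain ⟨a', b', p⟩ := p
    cases p with
    | nil =>
      change l (D.vertex a') = pathCoeff _ (ofPath K (nilPath a')) +
        ∑ v, pathCoeff _ (ofPath K (nilPath a')) * _
      rw [pathCoeff_ofPath_of_ne (nilPath_ne_arrowPath α), zero_add,
        Finset.sum_eq_single_of_mem a' (Finset.mem_univ _) fun v _ hv => by
          rw [pathCoeff_ofPath_of_ne fun h => hv (nilPath_injective h).symm, zero_mul],
        pathCoeff_ofPath_self, one_mul]
    | @cons c _ p β =>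
      rw [Finset.sum_eq_zero fun v _ => by
        rw [pathCoeff_ofPath_of_ne (mk_cons_ne_nilPath p β), zero_mul], add_zero]
      cases p with
      | nil =>
        change l (D.arrow β * D.vertex a') = pathCoeff _ (ofPath K (arrowPath β))
        rw [D.mul_vertex]
        by_cases h : a' = a ∧ b' = b
        · obtain ⟨rfl, rfl⟩ := h
          by_cases hβ : β = α
          · rw [hβ, pathCoeff_ofPath_self, hα]
          · rw [hpar β hβ, pathCoeff_ofPath_of_ne fun h => hβ (arrowPath_injective h)]
        · rw [hnpar β h, pathCoeff_ofPath_of_ne]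
          intro h'
          exact h ⟨congrArg QuiverPath.src h', congrArg QuiverPath.tgt h'⟩
      | cons p γ =>
        rw [pathCoeff_ofPath_of_ne (mk_cons_cons_ne_arrowPath p γ β α)]
        exact hl _ (Ideal.mul_mem_mul (hN β) (Ideal.mul_mem_right _ _ (hN γ)))

/-- The kernel of the map from the path algebra is admissible if the arrows form a basis of the
radical modulo its square. -/
theorem isAdmissible_of_mem_iff (hN : ∀ {a b : V} (α : a ⟶ b), D.arrow α ∈ N)
    {n : ℕ} (hn : N ^ n = ⊥) (hv : ∀ v, D.vertex v ≠ 0)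
    (hl : ∀ {a b : V} (α : a ⟶ b), ∃ l : B →ₗ[K] K, (∀ y ∈ N * N, l y = 0) ∧
      l (D.arrow α) = 1 ∧ (∀ β : a ⟶ b, β ≠ α → l (D.arrow β) = 0) ∧
      ∀ {a' b' : V} (β : a' ⟶ b'), ¬ (a' = a ∧ b' = b) → l (D.arrow β) = 0)
    (I : Ideal (PathAlgebra K V)) [hI : I.IsTwoSided] (hmem : ∀ y, y ∈ I ↔ D.lift K y = 0) :
    IsAdmissible I := by
  -- The exponent n would suffice for nilpotency; adding 2 meets the requirement that it be at least
  -- 2.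
  refine ⟨hI, n + 2, by omega, fun y hy => ?_, fun y hy => ?_⟩
  · rw [hmem, ← Submodule.mem_bot B, ← hn]
    exact Ideal.pow_le_pow_right (by omega) (D.lift_mem_pow N hN _ hy)
  · rw [hmem] at hy
    have hvN : ∀ v, D.vertex v ∉ N := fun v h => hv v <|
      (D.orthogonal.idem v).eq_zero_of_isNilpotent (isNilpotent_of_mem_of_pow_eq_bot hn h)
    -- A nonzero coefficient could be inverted, which would place a nonzero idempotent in the
    -- nilpotent ideal N.
    have h0 : ∀ v, pathCoeff (nilPath v) y = 0 := by
      intro v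
      by_contra hc
      have h1 := D.vertex_mul_lift_sub_mem N hN v y
      rw [hy, mul_zero, zero_sub, neg_mem_iff] at h1
      have h2 := Submodule.smul_of_tower_mem N (pathCoeff (nilPath v) y)⁻¹ h1
      rw [smul_smul, inv_mul_cancel₀ hc, one_smul] at h2
      exact hvN v h2
    have h1 : ∀ {a b : V} (α : a ⟶ b), pathCoeff (arrowPath α) y = 0 := by
      intro a b α
      obtain ⟨l, hl, hα, hpar, hnpar⟩ := hl α
      have h2 := D.apply_lift N hN α l hl hα hpar hnpar y
      rw [hy, map_zero, Finset.sum_eq_zero fun v _ => by rw [h0, zero_mul], add_zero] at h2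
      exact h2.symm
    have h2 : y ∈ (arrowIdeal K V ^ 2).restrictScalars K := by
      refine mem_of_forall_pathCoeff fun p => ?_
      obtain ⟨a, b, p⟩ := p
      cases p with
      | nil => exact Or.inl (h0 a)
      | cons p β =>
        cases p with
        | nil => exact Or.inl (h1 β)
        | cons p γ => exact Or.inr (ofPath_cons_cons_mem_arrowIdeal_sq p γ β)
    exact h2

end QuiverRealization

/-! ### Base change of presentations by quivers -/

namespace QuiverRealization

open PathAlgebra MonoidAlgebra

variable {O K M V : Type*} [CommRing O] [CommRing K] [Algebra O K] [Monoid M] [Quiver V]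
  (D : QuiverRealization V (MonoidAlgebra O M)) {e : MonoidAlgebra O M}

/-- The realization over `K` obtained from a realization over `O`. -/
abbrev baseChange (K : Type*) [CommRing K] [Algebra O K] :
    QuiverRealization V (MonoidAlgebra K M) :=
  D.map (mapRingHom M (algebraMap O K))

theorem lift_baseChange (y : PathAlgebra O V) :
    (D.baseChange K).lift K (coeffMap O K V y) = mapRingHom M (algebraMap O K) (D.lift O y) :=
  D.lift_coeffMap _ (map_smul_eq_smul_map K) y

theorem exists_lift_baseChange_eq {σ : MonoidAlgebra O M →ₗ[O] PathAlgebra O V}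
    (hσ : ∀ x, D.lift O (σ x) = e * x * e) (b : MonoidAlgebra K M) :
    ∃ y, (D.baseChange K).lift K y =
      mapRingHom M (algebraMap O K) e * b * mapRingHom M (algebraMap O K) e := by
  refine ⟨extendLinear K (coeffMap O K V ∘ₗ σ) b, ?_⟩
  induction b using MonoidAlgebra.induction_linear with
  | zero => simp
  | add x y hx hy => simp only [map_add, hx, hy, mul_add, add_mul]
  | single m c =>
    rw [extendLinear_single, map_smul, LinearMap.comp_apply, lift_baseChange, hσ, map_mul, map_mul,
      mapRingHom_single, map_one, ← smul_mul_assoc, ← mul_smul_comm, smul_single, smul_eq_mul,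
      mul_one]

variable [Fintype V]

/-- O[M] is free, so compression to the corner lifts through the surjection from OQ onto the image
of `lift`. This section, given by explicit linear data over O, controls every base change below. -/
theorem exists_section (hsum : ∑ v, D.vertex v = e)
    (hsurj : ∀ x, e * x * e ∈ LinearMap.range (D.lift O)) :
    ∃ σ : MonoidAlgebra O M →ₗ[O] PathAlgebra O V,
      (∀ x, D.lift O (σ x) = e * x * e) ∧ ∀ y, D.lift O (σ (D.lift O y)) = D.lift O y := by
  let L : MonoidAlgebra O M →ₗ[O] MonoidAlgebra O M :=
    LinearMap.mulRight O e ∘ₗ LinearMap.mulLeft O e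
  obtain ⟨σ, hσ⟩ := Module.projective_lifting_property (D.lift O).rangeRestrict
    (L.codRestrict _ hsurj) (D.lift O).surjective_rangeRestrict
  have h1 : ∀ x, D.lift O (σ x) = e * x * e := fun x =>
    congrArg Subtype.val (LinearMap.congr_fun hσ x)
  refine ⟨σ, h1, fun y => ?_⟩
  rw [h1, D.mul_lift hsum, D.lift_mul_right hsum]

/-- The map y ↦ y - σ(lift y) is a retraction of OQ onto I. A direct summand stays one after
tensoring. -/
theorem injective_baseChangeMap (I : Ideal (PathAlgebra O V)) (hI : ∀ y, y ∈ I ↔ D.lift O y = 0)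
    {σ : MonoidAlgebra O M →ₗ[O] PathAlgebra O V}
    (hσ : ∀ y, D.lift O (σ (D.lift O y)) = D.lift O y) :
    Function.Injective (baseChangeMap K I) := by
  let π : PathAlgebra O V →ₗ[O] I.restrictScalars O :=
    (LinearMap.id - σ ∘ₗ D.lift O).codRestrict _ fun y => by
      refine (hI _).2 ?_
      rw [LinearMap.sub_apply, map_sub, sub_eq_zero]
      exact (hσ y).symm
  have hπ : ∀ y : I.restrictScalars O, π y = y := fun y => Subtype.ext (by
    change (y : PathAlgebra O V) - σ (D.lift O y) = y
    rw [(hI _).1 y.2, map_zero, sub_zero])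
  let ρ : PathAlgebra K V →ₗ[K] K ⊗[O] (I.restrictScalars O) :=
    Finsupp.linearCombination K fun q : QuiverPath V => (1 : K) ⊗ₜ[O] π (ofPath O q)
  have hρ : ∀ y, ρ (coeffMap O K V y) = 1 ⊗ₜ π y := by
    intro y
    induction y using PathAlgebra.induction with
    | h0 => simp only [map_zero, TensorProduct.tmul_zero]
    | hadd x y hx hy => simp only [map_add, hx, hy, TensorProduct.tmul_add]
    | hof c p =>
      rw [(coeffMap O K V).map_smul, π.map_smul, coeffMap_ofPath, ← algebraMap_smul K c, map_smul,
        TensorProduct.tmul_smul, ← algebraMap_smul K c]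
      congr 1
      exact (Finsupp.linearCombination_single K 1 p).trans (one_smul K _)
  refine Function.LeftInverse.injective (g := ρ) fun t => ?_
  induction t with
  | zero => rw [map_zero, map_zero]
  | add x y hx hy => rw [map_add, map_add, hx, hy]
  | tmul c x => rw [baseChangeMap_tmul, map_smul, hρ, hπ, TensorProduct.smul_tmul', smul_eq_mul,
      mul_one]

theorem mem_baseChangeIdeal_iff (I : Ideal (PathAlgebra O V)) (hI : ∀ y, y ∈ I ↔ D.lift O y = 0)
    {σ : MonoidAlgebra O M →ₗ[O] PathAlgebra O V}
    (hσ : ∀ y, D.lift O (σ (D.lift O y)) = D.lift O y) (y : PathAlgebra K V) :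
    y ∈ baseChangeIdeal K I ↔ (D.baseChange K).lift K y = 0 := by
  constructor
  · rintro ⟨t, rfl⟩
    induction t with
    | zero => rw [map_zero, map_zero]
    | add x y hx hy => rw [map_add, map_add, hx, hy, add_zero]
    | tmul c x =>
      rw [baseChangeMap_tmul, map_smul, lift_baseChange, (hI _).1 x.2, map_zero, smul_zero]
  · intro hy
    let τ := extendLinear K (coeffMap O K V ∘ₗ σ)
    have hτ : ∀ x, τ (mapRingHom M (algebraMap O K) x) = coeffMap O K V (σ x) :=
      extendLinear_map K (coeffMap O K V ∘ₗ σ)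
    -- The retraction onto I extends to K: subtracting the section applied to the image lands in K ⊗
    -- I, as is seen on paths, which are defined over O.
    have key : ∀ y, y - τ ((D.baseChange K).lift K y) ∈ LinearMap.range (baseChangeMap K I) := by
      intro y
      induction y using PathAlgebra.induction with
      | h0 => rw [map_zero, map_zero, sub_zero]; exact zero_mem _
      | hadd x y hx hy =>
        convert add_mem hx hy using 1
        rw [map_add, map_add]
        abel
      | hof c p =>
        rw [map_smul, map_smul, ← smul_sub]
        refine Submodule.smul_mem _ c ?_
        rw [← coeffMap_ofPath (O := O), lift_baseChange, hτ, ← map_sub]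
        refine ⟨1 ⊗ₜ ⟨_, (hI _).2 ?_⟩, by rw [baseChangeMap_tmul, one_smul]⟩
        rw [map_sub, hσ, sub_self]
    have h1 := key y
    rwa [hy, map_zero, sub_zero] at h1

/-- The presentation of a corner of `K[M]` by the quiver. -/
theorem nonempty_algEquiv_corner (I : Ideal (PathAlgebra O V)) [I.IsTwoSided]
    (hI : ∀ y, y ∈ I ↔ D.lift O y = 0) (hsum : ∑ v, D.vertex v = e)
    {σ : MonoidAlgebra O M →ₗ[O] PathAlgebra O V}
    (hσ : ∀ x, D.lift O (σ x) = e * x * e)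
    (hσ' : ∀ y, D.lift O (σ (D.lift O y)) = D.lift O y)
    {e' : MonoidAlgebra K M} (he' : IsIdempotentElem e')
    (hee' : mapRingHom M (algebraMap O K) e = e') :
    Nonempty ((PathAlgebra K V ⧸ baseChangeIdeal K I) ≃ₐ[K] he'.Corner) := by
  have hsum' : ∑ v, (D.baseChange K).vertex v = e' := by
    rw [← hee', ← hsum, map_sum]; rfl
  have hsurj : Function.Surjective ((D.baseChange K).liftCorner K he' hsum') := by
    intro x
    obtain ⟨y, hy⟩ := D.exists_lift_baseChange_eq hσ (K := K) x.1
    have h1 := (Subsemigroup.mem_corner_iff he').1 x.2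
    rw [hee', h1.1, h1.2] at hy
    exact ⟨y, Subtype.ext hy⟩
  have hker : baseChangeIdeal K I = RingHom.ker ((D.baseChange K).liftCorner K he' hsum') := by
    ext y
    rw [D.mem_baseChangeIdeal_iff I hI hσ', RingHom.mem_ker, liftCorner_eq_zero_iff]
  exact ⟨(Ideal.quotientEquivAlgOfEq K hker).trans (Ideal.quotientKerAlgEquivOfSurjective hsurj)⟩

end QuiverRealization

/-! ### Presentations over fields -/

section Presentation

open PathAlgebra MonoidAlgebra IsLocalRing

theorem extendLinear_eq_zero_of_mem_mul {O K M : Type*} [CommRing O] [CommRing K] [Algebra O K]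
    [Monoid M]
    (hspan : ∀ x ∈ sandwichIdeal K M,
      x ∈ Submodule.span K (mapRingHom M (algebraMap O K) '' (sandwichIdeal O M)))
    {l : MonoidAlgebra O M →ₗ[O] K} (hl : ∀ y ∈ sandwichIdeal O M * sandwichIdeal O M, l y = 0)
    {y : MonoidAlgebra K M} (hy : y ∈ sandwichIdeal K M * sandwichIdeal K M) :
    extendLinear K l y = 0 := by
  induction hy using Submodule.mul_induction_on' with
  | mem_mul_mem a ha b hb =>
    have hab := Submodule.mul_mem_mul (hspan a ha) (hspan b hb)
    rw [Submodule.span_mul_span] at hab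
    refine (Submodule.span_le.2 ?_ : _ ≤ LinearMap.ker (extendLinear K l)) hab
    rintro _ ⟨_, ⟨a, ha, rfl⟩, _, ⟨b, hb, rfl⟩, rfl⟩
    rw [SetLike.mem_coe, LinearMap.mem_ker]
    exact (congrArg _ (map_mul _ a b).symm).trans
      ((extendLinear_map K l (a * b)).trans (hl _ (Ideal.mul_mem_mul ha hb)))
  | add x _ y _ hx hy => rw [map_add, hx, hy, add_zero]

/-- Serves both K = F and K = k. The link between the ideal over O and the radical over K is
`hspan`, which makes the extended functionals vanish on the squared radical. -/
theorem QuiverRealization.presentation_baseChange {O K M V : Type*} [CommRing O] [Field K]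
    [Algebra O K] [Monoid M] [Finite M] [Quiver V] [Fintype V]
    (D : QuiverRealization V (MonoidAlgebra O M)) {e : MonoidAlgebra O M}
    (I : Ideal (PathAlgebra O V)) [I.IsTwoSided]
    (hI : ∀ y, y ∈ I ↔ D.lift O y = 0) (hsum : ∑ v, D.vertex v = e)
    (hsurj : ∀ x, e * x * e ∈ LinearMap.range (D.lift O))
    (hN : ∀ {a b : V} (α : a ⟶ b), D.arrow α ∈ sandwichIdeal O M)
    (hl : ∀ {a b : V} (α : a ⟶ b), ∃ l : MonoidAlgebra O M →ₗ[O] O,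
      (∀ y ∈ sandwichIdeal O M * sandwichIdeal O M, l y = 0) ∧
      l (D.arrow α) = 1 ∧ (∀ β : a ⟶ b, β ≠ α → l (D.arrow β) = 0) ∧
      ∀ {a' b' : V} (β : a' ⟶ b'), ¬ (a' = a ∧ b' = b) → l (D.arrow β) = 0)
    (hspan : ∀ x ∈ sandwichIdeal K M,
      x ∈ Submodule.span K (mapRingHom M (algebraMap O K) '' (sandwichIdeal O M)))
    (hv : ∀ v, mapRingHom M (algebraMap O K) (D.vertex v) ≠ 0)
    {e' : MonoidAlgebra K M} (he' : IsIdempotentElem e')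
    (hee' : mapRingHom M (algebraMap O K) e = e') :
    Function.Injective (baseChangeMap K I) ∧ IsAdmissible (baseChangeIdeal K I) ∧
      Nonempty ((PathAlgebra K V ⧸ baseChangeIdeal K I) ≃ₐ[K] he'.Corner) := by
  obtain ⟨σ, hσ, hσ'⟩ := D.exists_section hsum hsurj
  obtain ⟨n, hn⟩ := exists_sandwichIdeal_pow_eq_bot K M
  refine ⟨D.injective_baseChangeMap I hI hσ', ?_,
    D.nonempty_algEquiv_corner I hI hsum hσ hσ' he' hee'⟩
  refine (D.baseChange K).isAdmissible_of_mem_iff (sandwichIdeal K M)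
    (fun α => map_mem_sandwichIdeal _ (hN α)) hn hv (fun α => ?_) _
    (D.mem_baseChangeIdeal_iff I hI hσ')
  obtain ⟨l, hl, hα, hpar, hnpar⟩ := hl α
  have h1 : ∀ x, extendLinear K (Algebra.linearMap O K ∘ₗ l) (mapRingHom M (algebraMap O K) x) =
    algebraMap O K (l x) := extendLinear_map K (Algebra.linearMap O K ∘ₗ l)
  refine ⟨extendLinear K (Algebra.linearMap O K ∘ₗ l),
    fun y hy => extendLinear_eq_zero_of_mem_mul hspan (fun y hy => ?_) hy, ?_, fun β hβ => ?_,
    fun β hβ => ?_⟩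
  · rw [LinearMap.comp_apply, hl y hy, map_zero]
  · exact (h1 _).trans (by rw [hα, map_one])
  · exact (h1 _).trans (by rw [hpar β hβ, map_zero])
  · exact (h1 _).trans (by rw [hnpar β hβ, map_zero])

/-- Representatives of the arrows of the Gabriel quiver, with respect to a family of orthogonal
idempotents. -/
theorem exists_quiverRealization {R A : Type*} [CommRing R] [IsDomain R] [IsPrincipalIdealRing R]
    [Ring A] [Algebra R A] [Module.Finite R A] (N : Ideal A) [N.IsTwoSided]
    (hN : ∀ (c : R) (x : A), c ≠ 0 → c • x ∈ N → x ∈ N)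
    (hN2 : ∀ (c : R) (x : A), c ≠ 0 → c • x ∈ N * N → x ∈ N * N)
    {V : Type} {f : V → A} (hf : OrthogonalIdempotents f) :
    ∃ (_ : Quiver.{0} V) (_ : ∀ a b : V, Finite (a ⟶ b)) (D : QuiverRealization V A),
      D.vertex = f ∧ (∀ {a b : V} (α : a ⟶ b), D.arrow α ∈ N) ∧
      (∀ {a b : V} (α : a ⟶ b), ∃ l : A →ₗ[R] R, (∀ y ∈ N * N, l y = 0) ∧
        l (D.arrow α) = 1 ∧ (∀ β : a ⟶ b, β ≠ α → l (D.arrow β) = 0) ∧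
        ∀ {a' b' : V} (β : a' ⟶ b'), ¬ (a' = a ∧ b' = b) → l (D.arrow β) = 0) ∧
      ∀ (a b : V), ∀ y ∈ N, ∃ w ∈ LinearMap.range (D.lift R), f b * y * f a - w ∈ N * N := by
  -- Arrows a → b are taken in f_b N f_a, in accordance with paths composing from right to left.
  choose n x l hx hlx hl2 hl0 hspan using fun a b =>
    exists_arrows N hN hN2 (hf.idem b) (hf.idem a)
  let Q : Quiver.{0} V := ⟨fun a b => Fin (n a b)⟩
  let D : QuiverRealization V A :=
    { vertex := f
      arrow := fun {a b} α => x a b α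
      orthogonal := hf
      vertex_mul := fun {a b} α => (hx a b α).2.1
      mul_vertex := fun {a b} α => (hx a b α).2.2 }
  refine ⟨Q, fun a b => inferInstanceAs (Finite (Fin (n a b))), D, rfl,
    fun {a b} α => (hx a b α).1, fun {a b} α => ⟨l a b α, hl2 a b α, ?_, fun β hβ => ?_,
    fun {a' b'} β hβ => ?_⟩, fun a b y hy => ?_⟩
  · exact (hlx a b α α).trans (if_pos rfl)
  · exact (hlx a b α β).trans (if_neg (Ne.symm hβ))
  · refine hl0 a b α _ (hx a' b' β).1 ?_
    change f b * x a' b' β * f a = 0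
    rw [← (hx a' b' β).2.1, ← (hx a' b' β).2.2]
    by_cases hb : b' = b
    · have ha : a' ≠ a := fun ha => hβ ⟨ha, hb⟩
      rw [mul_assoc, mul_assoc, mul_assoc, hf.ortho ha, mul_zero, mul_zero, mul_zero]
    · rw [← mul_assoc (f b), hf.ortho (Ne.symm hb), zero_mul, zero_mul]
  · obtain ⟨c, hc⟩ := hspan a b y hy
    refine ⟨_, sum_mem fun α _ => ?_, hc⟩
    refine ⟨c α • ofPath R (arrowPath (V := V) (a := a) (b := b) α), ?_⟩
    rw [map_smul, D.lift_ofPath]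
    congr 1
    exact D.mul_vertex (a := a) (b := b) α

/-- The chosen idempotent is full: each f_j is c f_i c⁻¹ for a chosen i, and f_i absorbs the sum
over T. -/
theorem exists_sum_mul_mul_eq_one {A : Type*} [Ring A] {s : ℕ} {f : Fin s → A}
    {T : Finset (Fin s)} (hf : CompleteOrthogonalIdempotents f)
    (hconj : ∀ j, ∃ i ∈ T, IsConj (f i) (f j)) :
    ∃ u v : Fin s → A, ∑ j, u j * (∑ i ∈ T, f i) * v j = 1 := by
  choose i hi c hc using hconj
  refine ⟨fun j => c j, fun j => f (i j) * ↑(c j)⁻¹, ?_⟩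
  rw [← hf.complete]
  refine Finset.sum_congr rfl fun j _ => ?_
  have h1 : (∑ i ∈ T, f i) * f (i j) = f (i j) := by
    rw [Finset.sum_mul, Finset.sum_eq_single_of_mem (i j) (hi j) fun k _ hk => hf.ortho hk,
      (hf.idem _).eq]
  rw [mul_assoc, ← mul_assoc _ (f (i j)), h1, ← mul_assoc, (hc j).eq, mul_assoc,
    Units.mul_inv, mul_one]

end Presentation

/-! ### The sandwich ideal and extension of scalars -/

section ExtensionOfScalars

open MonoidAlgebra IsLocalRing

theorem mem_sandwichIdeal_of_smul_mem {R M : Type*} [CommRing R] [IsDomain R] [Monoid M] {c : R}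
    (hc : c ≠ 0) {x : MonoidAlgebra R M} (hx : c • x ∈ sandwichIdeal R M) :
    x ∈ sandwichIdeal R M := by
  rw [mem_sandwichIdeal] at hx ⊢
  intro e he a b ha hb
  have h1 := hx e he a b ha hb
  rw [mul_smul_comm, smul_mul_assoc, coeff_smul, Finsupp.smul_apply, smul_eq_mul] at h1
  exact (mul_eq_zero.1 h1).resolve_left hc

theorem mem_span_sandwichIdeal_of_isFractionRing (O : Type*) {F M : Type*} [CommRing O]
    [IsDomain O] [Field F] [Algebra O F] [IsFractionRing O F] [Monoid M] {x : MonoidAlgebra F M}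
    (hx : x ∈ sandwichIdeal F M) :
    x ∈ Submodule.span F (mapRingHom M (algebraMap O F) '' (sandwichIdeal O M)) := by
  classical
  obtain ⟨b, hb⟩ := IsLocalization.exist_integer_multiples (nonZeroDivisors O) x.coeff.support
    x.coeff
  have hb' : ∀ m, ∃ c, algebraMap O F c = (b : O) • x.coeff m := fun m => by
    by_cases hm : m ∈ x.coeff.support
    · exact hb m hm
    · exact ⟨0, by rw [Finsupp.notMem_support_iff.1 hm, map_zero, smul_zero]⟩
  choose c hc using hb'
  have hb0 : algebraMap O F b ≠ 0 := IsFractionRing.to_map_ne_zero_of_mem_nonZeroDivisors b.2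
  let y : MonoidAlgebra O M := ∑ m ∈ x.coeff.support, single m (c m)
  have hy : mapRingHom M (algebraMap O F) y = algebraMap O F b • x := by
    ext m
    rw [map_sum, coeff_sum, Finsupp.finsetSum_apply, coeff_smul, Finsupp.smul_apply, smul_eq_mul]
    simp only [mapRingHom_single, coeff_single, Finsupp.single_apply, hc, Finset.sum_ite_eq',
      Algebra.smul_def]
    split_ifs with h
    · rfl
    · rw [Finsupp.notMem_support_iff.1 h, mul_zero]
  have hyN : y ∈ sandwichIdeal O M := by
    rw [← map_mem_sandwichIdeal_iff _ (IsFractionRing.injective O F), hy]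
    exact Submodule.smul_of_tower_mem _ _ hx
  have h1 : x = (algebraMap O F b)⁻¹ • mapRingHom M (algebraMap O F) y := by
    rw [hy, smul_smul, inv_mul_cancel₀ hb0, one_smul]
  rw [h1]
  exact Submodule.smul_mem _ _ (Submodule.subset_span ⟨y, hyN, rfl⟩)

theorem exists_sub_mem_sandwichIdeal_of_residue {O M : Type*} [CommRing O] [IsLocalRing O]
    [Monoid M] [Finite M]
    (hG : ∀ (e : M) (he : IsIdempotentElem e), IsUnit (Nat.card (MaximalSubgroup he) : O))
    (hT : ∀ (e : M) (he : IsIdempotentElem e), IsUnit (Nat.card (AddCommGroup.torsion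
      (ZRDual he ⧸ LinearMap.range (sandwichMap he))) : O))
    {x : MonoidAlgebra O M}
    (hx : mapRingHom M (residue O) x ∈ sandwichIdeal (ResidueField O) M) :
    ∃ z ∈ coeffIdeal M (maximalIdeal O), x - z ∈ sandwichIdeal O M := by
  obtain ⟨z, hz, hxz⟩ := exists_sub_mem_sandwichIdeal hG hT (maximalIdeal O) x
    fun e he a b ha hb => by
      have h1 := mem_sandwichIdeal.1 hx e he a b ha hb
      rwa [map_coeff_single_mul_single, residue_eq_zero_iff] at h1
  exact ⟨z, mem_coeffIdeal.2 hz, hxz⟩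

end ExtensionOfScalars

end

/-! ### The main theorem. -/

open PathAlgebra in
theorem theoremt {M O F : Type*} [Monoid M] [Finite M]
    [CommRing O] [IsDomain O] [IsDiscreteValuationRing O] [CharZero O]
    [IsAdicComplete (IsLocalRing.maximalIdeal O) O]
    [Field F] [Algebra O F] [IsFractionRing O F]
    (p : ℕ) (hp : p.Prime) [CharP (IsLocalRing.ResidueField O) p]
    (hF : IsSplitAlgebra F (MonoidAlgebra F M))
    (hk : IsSplitAlgebra (IsLocalRing.ResidueField O)
      (MonoidAlgebra (IsLocalRing.ResidueField O) M))
    (hM : ¬ IsModular p M)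
    (e : MonoidAlgebra (IsLocalRing.ResidueField O) M) (he : IsBasicIdempotent e) :
    ∃ e' : MonoidAlgebra O M,
      IsIdempotentElem e' ∧
      MonoidAlgebra.mapRingHom M (IsLocalRing.residue O) e' = e ∧
      ∃ he' : IsBasicIdempotent (MonoidAlgebra.mapRingHom M (algebraMap O F) e'),
      ∃ (V : Type) (_ : Fintype V) (_ : Quiver.{0} V) (_ : ∀ a b : V, Finite (a ⟶ b))
        (I : Ideal (PathAlgebra O V)) (_ : I.IsTwoSided),
        (Function.Injective (baseChangeMap F I) ∧
          IsAdmissible (baseChangeIdeal F I) ∧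
          Nonempty ((PathAlgebra F V ⧸ baseChangeIdeal F I) ≃ₐ[F]
            he'.isIdempotentElem.Corner)) ∧
        (Function.Injective (baseChangeMap (IsLocalRing.ResidueField O) I) ∧
          IsAdmissible (baseChangeIdeal (IsLocalRing.ResidueField O) I) ∧
          Nonempty ((PathAlgebra (IsLocalRing.ResidueField O) V ⧸
              baseChangeIdeal (IsLocalRing.ResidueField O) I) ≃ₐ[IsLocalRing.ResidueField O]
            he.isIdempotentElem.Corner)) := by
  have : CharZero F := charZero_of_injective_algebraMap (IsFractionRing.injective O F)
  have hGp : ∀ (e : M) (he : IsIdempotentElem e), ¬ p ∣ Nat.card (MaximalSubgroup he) :=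
    fun e he h => hM (Or.inl ⟨e, he, Or.inl h⟩)
  have hTp : ∀ (e : M) (he : IsIdempotentElem e), ¬ p ∣ Nat.card
      (AddCommGroup.torsion (ZRDual he ⧸ LinearMap.range (sandwichMap he))) :=
    fun e he h => hM (Or.inl ⟨e, he, Or.inr h⟩)
  have hradF := jacobson_eq_sandwichIdeal F M fun e he => by
    exact_mod_cast (Nat.card_pos (α := MaximalSubgroup he)).ne'
  have hradk := jacobson_eq_sandwichIdeal (IsLocalRing.ResidueField O) M fun e he => by
    rw [Ne, CharP.cast_eq_zero_iff _ p]
    exact hGp e he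
  -- Reduction maps N_O onto N_k. This is used twice: to lift the Peirce decomposition, and to show
  -- that N_k is spanned by the reduction of N_O.
  have hlift : ∀ x : MonoidAlgebra O M,
      MonoidAlgebra.mapRingHom M (IsLocalRing.residue O) x ∈
        sandwichIdeal (IsLocalRing.ResidueField O) M →
      ∃ z ∈ coeffIdeal M (IsLocalRing.maximalIdeal O), x - z ∈ sandwichIdeal O M :=
    fun x hx => exists_sub_mem_sandwichIdeal_of_residue
      (fun e he => isUnit_natCast_of_not_dvd (hGp e he))
      (fun e he => isUnit_natCast_of_not_dvd (hTp e he)) hx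
  obtain ⟨s, f, T, hf, hfne, hdiag, hoff, hconj, hfe⟩ :=
    exists_lift_basic hk (fun x hx => hlift x (hradk ▸ hx)) he
  have hfne' : ∀ i, f i ≠ 0 := fun i h => hfne i (by rw [h, map_zero])
  have he' : IsBasicIdempotent (MonoidAlgebra.mapRingHom M (algebraMap O F) (∑ i ∈ T, f i)) :=
    isBasicIdempotent_map hF hradF hf hfne' hdiag hoff hconj
  obtain ⟨t, htp, ht⟩ := exists_coprime_of_not_isModular hp hM
  have hpure : ∀ (c : O) (x : MonoidAlgebra O M), c ≠ 0 → c • x ∈ sandwichIdeal O M →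
      x ∈ sandwichIdeal O M := fun c x hc hx => mem_sandwichIdeal_of_smul_mem hc hx
  have hpure2 : ∀ (c : O) (x : MonoidAlgebra O M), c ≠ 0 →
      c • x ∈ sandwichIdeal O M * sandwichIdeal O M → x ∈ sandwichIdeal O M * sandwichIdeal O M :=
    fun c x hc hx => mem_sandwichIdeal_mul_of_smul_mem t (isUnit_natCast_of_not_dvd htp) ht hc hx
  have hfT : OrthogonalIdempotents fun i : {i // i ∈ T} => f i :=
    hf.toOrthogonalIdempotents.embedding (Function.Embedding.subtype (· ∈ T))
  obtain ⟨Q, hfin, D, hDf, hDN, hDl, hDspan⟩ :=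
    exists_quiverRealization (sandwichIdeal O M) hpure hpure2 hfT
  have hsum : ∑ v, D.vertex v = ∑ i ∈ T, f i := by
    rw [hDf]
    exact Finset.sum_coe_sort T f
  obtain ⟨u, v, huv⟩ := exists_sum_mul_mul_eq_one hf hconj
  obtain ⟨n, hn⟩ := exists_sandwichIdeal_pow_eq_bot O M
  have hidem : IsIdempotentElem (∑ i ∈ T, f i) := hf.toOrthogonalIdempotents.isIdempotentElem_sum
  have hsurj := D.mul_mul_mem_range_lift (R := O) (sandwichIdeal O M) hsum hn
    (fun v x => by rw [hDf]; exact hdiag v x)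
    (fun v w hvw x => by
      rw [hDf]
      exact hoff v v.2 w w.2 (fun h => hvw (Subtype.ext h)) x)
    (by rw [hDf]; exact hDspan) huv
  have hI : ∀ y, y ∈ RingHom.ker (D.liftCorner O hidem hsum) ↔ D.lift O y = 0 := fun y => by
    rw [RingHom.mem_ker, D.liftCorner_eq_zero_iff]
  -- The vertex set is the index set T itself, and one kernel I over O provides both presentations.
  refine ⟨_, hidem, hfe, he', _, inferInstance, Q, hfin,
    RingHom.ker (D.liftCorner O hidem hsum), inferInstance, ?_, ?_⟩
  · refine D.presentation_baseChange _ hI hsum hsurj hDN hDl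
      (fun x hx => mem_span_sandwichIdeal_of_isFractionRing O hx) (fun v => ?_) _ rfl
    rw [hDf]
    exact fun h => hfne' v (eq_zero_of_map_eq_zero h)
  · refine D.presentation_baseChange _ hI hsum hsurj hDN hDl (fun x hx => ?_) (fun v => ?_) _ hfe
    · obtain ⟨x, rfl⟩ := mapRingHom_residue_surjective x
      obtain ⟨z, hz, hxz⟩ := hlift x hx
      refine Submodule.subset_span ⟨x - z, hxz, ?_⟩
      rw [IsLocalRing.ResidueField.algebraMap_eq, map_sub, mapRingHom_residue_eq_zero_iff.2 hz,
        sub_zero]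
    · rw [hDf]
      exact hfne v
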